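/- **Setting.** Let $D\subset\mathbb R^2$ be a bounded, connected, nonempty open set with $C^\infty$ boundary. The basic-flow problem with viscosity $\nu>0$ and flux $f$ is $$\partial_t w-\nu\Delta w=\pi(t)\ \text{ in } \mathbb R\times D,\qquad w=0\ \text{ on }\mathbb R\times\partial D,\qquad \int_D w(t,x)\,dx=f(t),\quad t\in\mathbb R,$$ with unknowns $w=w(t,x)$ and $\pi=\pi(t)$. For a function $g$ on $\mathbb R$ with values in a complex Banach space $X$, its generalized Fourier coefficient at $\xi\in\mathbb R$ is $g_\xi=\lim_{R\to\infty}\frac1{2R}\int_{-R}^{R}g(t)e^{-i\xi t}\,dt$ (when the limit exists), and $g\overset{\mathrm{ap}}\sim h$ means that all Fourier coefficients of $g-h$ exist and vanish. $AP(\mathbb R;X)$ is the space of Bohr almost periodic functions: continuous functions having, for every $\varepsilon>0$, a relatively dense set of $\varepsilon$-almost periods. $B^2(\mathbb R;X)$ is the closure of the $X$-valued trigonometric polynomials with respect to the seminorm $\limsup_{R\to\infty}\big(\frac1{2R}\int_{-R}^R\|g(t)\|_X^2dt\big)^{1/2}$. All functions are complex valued. A *Besicovitch solution* with flux $f$ is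 a pair $w\in B^2(\mathbb R;H^2(D))$, $\pi\in B^2(\mathbb R)$ with $w_\xi\in H^1_0(D)$ for all $\xi$, such that there is a function $\partial_tw\in B^2(\mathbb R;L^2(D))$ with Fourier coefficients $i\xi w_\xi$, and $\partial_t w-\nu\Delta w\overset{\mathrm{ap}}\sim\pi$ and $\int_D w\,dx\overset{\mathrm{ap}}\sim f$. A *Bohr solution* with flux $g$ is a pair with $w\in AP(\mathbb R;H^2(D))$, $w(t)\in H^1_0(D)$, $w$ differentiable in time with values in $L^2(D)$, $\partial_t w\in AP(\mathbb R;L^2(D))$, $\pi\in AP(\mathbb R)$, and $\partial_tw(t)-\nu\Delta w(t)=\pi(t)$, $\int_Dw(t)\,dx=g(t)$ for every $t\in\mathbb R$. **Proposition 3.6.** There is a constant $c>0$, depending only on $D$, such that for all $\nu>0$ the following holds. Let $f\in L^1_{\mathrm{loc}}(\mathbb R)$ have generalized Fourier coefficients $f_\xi$ at all $\xi\in\mathbb R$ and assume $$\sum_{\xi\in\mathbb R}(1+|\xi|)\,|f_\xi|<\infty .$$ Then there is a pair $(w,\pi)$ which is a Besicovitch solution with flux $f$, and is also a Bohr solution with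 flux the continuous representative $\sum_\xi f_\xi e^{i\xi t}$ of $f$; in particular $w\in AP(\mathbb R;H^2(D))$, $\partial_tw\in AP(\mathbb R;L^2(D))$ and $\pi\in AP(\mathbb R)$. Its Fourier coefficients $w_\xi\in H^2(D)$, $\pi_\xi\in\mathbb C$ exist, the series on the left below converge, and $$\sum_\xi\|\Delta w_\xi\|_{L^2(D)}\le c\sum_\xi|f_\xi|+\frac c\nu\sum_\xi|\xi|\,|f_\xi|,$$ $$\sum_\xi|\pi_\xi|+\sum_\xi|\xi|\,\|w_\xi\|_{L^2(D)}\le c\,\nu\sum_\xi|f_\xi|+c\sum_\xi|\xi|\,|f_\xi|.$$ The solution is unique: every Besicovitch solution $(w',\pi')$ with flux $f$ satisfies $w'\overset{\mathrm{ap}}\sim w$ and $\pi'\overset{\mathrm{ap}}\sim\pi$, and every Bohr solution with flux $\sum_\xi f_\xi e^{i\xi t}$ is equal to $(w,\pi)$. If $f$ is real valued, then so are $w$ and $\pi$. -/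

import Mathlib

open MeasureTheory Filter Topology
open scoped ContDiff ENNReal

noncomputable section

/-! ### Almost periodic functions of time with values in a complex normed space -/

section AlmostPeriodic

variable {X : Type*} [NormedAddCommGroup X] [NormedSpace ℂ X]

/-- The character `t ↦ exp (i ξ t)`. -/
def bohrChar (ξ t : ℝ) : ℂ := Complex.exp (Complex.I * (ξ : ℂ) * (t : ℂ))

/-- A set `A ⊆ ℝ` is relatively dense if for some `L > 0` every closed interval of length `L`
meets `A`. -/
def IsRelativelyDense (A : Set ℝ) : Prop :=
  ∃ L : ℝ, 0 < L ∧ ∀ a : ℝ, ∃ τ ∈ A, a ≤ τ ∧ τ ≤ a + L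

/-- Bohr almost periodic functions, `f ∈ AP(ℝ; X)`: continuous functions which have, for every
`ε > 0`, a relatively dense set of `ε`-almost periods. -/
def IsBohrAP (f : ℝ → X) : Prop :=
  Continuous f ∧
    ∀ ε : ℝ, 0 < ε → IsRelativelyDense {τ : ℝ | ∀ t : ℝ, ‖f (t + τ) - f t‖ ≤ ε}

/-- `a` is the generalized Fourier coefficient of `f` at the frequency `ξ`:
`a = lim_{R → ∞} (1 / 2R) ∫_{-R}^{R} exp (-i ξ t) f(t) dt`, and in particular the limit exists. -/
def HasBohrCoeff (f : ℝ → X) (ξ : ℝ) (a : X) : Prop :=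
  Tendsto (fun R : ℝ => (2 * R)⁻¹ • ∫ t in (-R)..R, bohrChar (-ξ) t • f t) atTop (𝓝 a)

/-- Equality of generalized Fourier coefficients: all coefficients of `f - g` vanish. -/
def ApEquiv (f g : ℝ → X) : Prop :=
  ∀ ξ : ℝ, HasBohrCoeff (fun t => f t - g t) ξ 0

/-- Trigonometric polynomials with coefficients in `X`. -/
def IsTrigPoly (P : ℝ → X) : Prop :=
  ∃ (s : Finset ℝ) (c : ℝ → X), ∀ t : ℝ, P t = ∑ ξ ∈ s, bohrChar ξ t • c ξ

/-- The square of the Besicovitch seminorm: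
`limsup_{R → ∞} (1 / 2R) ∫_{-R}^{R} ‖f(t)‖² dt`, as an extended nonnegative number. -/
def besicovitchSq (f : ℝ → X) : ℝ≥0∞ :=
  limsup (fun R : ℝ => (∫⁻ t in Set.Ioc (-R) R, ‖f t‖ₑ ^ 2) / ENNReal.ofReal (2 * R)) atTop

/-- The Besicovitch class `B²(ℝ; X)`: the closure of the trigonometric polynomials in the
Besicovitch seminorm, among the (strongly) measurable functions.  Such a function is
automatically locally square integrable. -/
def IsBesicovitch (f : ℝ → X) : Prop :=
  AEStronglyMeasurable f volume ∧
    ∀ ε : ℝ≥0∞, 0 < ε → ∃ P : ℝ → X, IsTrigPoly P ∧ besicovitchSq (fun t => f t - P t) ≤ ε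

end AlmostPeriodic

/-! ### The cross section and its Sobolev spaces -/

/-- The plane `ℝ²` with its Euclidean structure. -/
abbrev Plane : Type := EuclideanSpace ℝ (Fin 2)

/-- A bounded, connected (in particular nonempty) open set `D ⊆ ℝ²` with `C^∞` boundary: near each
boundary point, in suitable orthogonal coordinates, `D` is the set of points lying above the graph
of a smooth function. -/
structure SmoothDomain where
  carrier : Set Plane
  isOpen : IsOpen carrier
  isConnected : IsConnected carrier
  isBounded : Bornology.IsBounded carrier
  smooth_boundary : ∀ x₀ ∈ frontier carrier,
    ∃ (r : ℝ) (e : Plane ≃ₗᵢ[ℝ] Plane) (φ : ℝ → ℝ), 0 < r ∧ ContDiff ℝ ∞ φ ∧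
      ∀ x ∈ Metric.ball x₀ r, (x ∈ carrier ↔ φ ((e x) 0) < (e x) 1)

namespace SmoothDomain

variable (D : SmoothDomain)

/-- Lebesgue measure on the cross section. -/
abbrev μ : Measure Plane := volume.restrict D.carrier

instance isFiniteMeasure_μ : IsFiniteMeasure D.μ :=
  isFiniteMeasure_restrict.2 D.isBounded.measure_lt_top.ne

/-- The space `L²(D; ℂ)`. -/
abbrev L2 : Type := Lp ℂ 2 D.μ

/-- Test functions: complex valued `C^∞` functions with compact support contained in `D`. -/
def IsTest (φ : Plane → ℂ) : Prop :=
  ContDiff ℝ ∞ φ ∧ HasCompactSupport φ ∧ tsupport φ ⊆ D.carrier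

/-- The classical partial derivative `∂φ/∂xᵢ`. -/
def partialDeriv (i : Fin 2) (φ : Plane → ℂ) (x : Plane) : ℂ :=
  fderiv ℝ φ x (EuclideanSpace.single i 1)

/-- `v = ∂u/∂xᵢ` in the weak sense in `D`. -/
def IsWeakDeriv (i : Fin 2) (u v : D.L2) : Prop :=
  ∀ φ : Plane → ℂ, D.IsTest φ →
    ∫ x, u x * partialDeriv i φ x ∂D.μ = -∫ x, v x * φ x ∂D.μ

/-- Labels of the derivatives of order at most two: the function, its first derivatives `∂ᵢ`, and
its second derivatives `∂ⱼ∂ᵢ`, the latter labelled by `(i, j)`. -/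
abbrev Jet : Type := Unit ⊕ Fin 2 ⊕ Fin 2 × Fin 2

variable {D} in
theorem IsTest.memLp {φ : Plane → ℂ} (hφ : D.IsTest φ) : MemLp φ 2 D.μ :=
  hφ.1.continuous.memLp_of_hasCompactSupport hφ.2.1

variable {D} in
theorem IsTest.memLp_partialDeriv {φ : Plane → ℂ} (hφ : D.IsTest φ) (i : Fin 2) :
    MemLp (partialDeriv i φ) 2 D.μ := by
  have hc : Continuous (partialDeriv i φ) := by
    have := hφ.1.continuous_fderiv (by simp)
    unfold partialDeriv
    fun_prop
  have hs : HasCompactSupport (partialDeriv i φ) :=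
    hφ.2.1.fderiv_apply (𝕜 := ℝ) (EuclideanSpace.single i 1)
  exact hc.memLp_of_hasCompactSupport hs

theorem integrable_mul (u : D.L2) {ψ : Plane → ℂ} (hψ : MemLp ψ 2 D.μ) :
    Integrable (fun x => u x * ψ x) D.μ :=
  (Lp.memLp u).integrable_mul hψ

/-- The Sobolev space `H²(D; ℂ)`.  A function `u ∈ H²(D)` is recorded together with its weak
derivatives of order at most two, which it determines; the norm is
`(‖u‖² + ∑ᵢ ‖∂ᵢu‖² + ∑ᵢⱼ ‖∂ⱼ∂ᵢu‖²)^(1/2)`. -/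
def H2 : Submodule ℂ (PiLp 2 (fun _ : Jet => D.L2)) where
  carrier := {U |
    (∀ i, D.IsWeakDeriv i (U (.inl ())) (U (.inr (.inl i)))) ∧
    ∀ i j, D.IsWeakDeriv j (U (.inr (.inl i))) (U (.inr (.inr (i, j))))}
  add_mem' := by
    have key : ∀ (i : Fin 2) (u v u' v' : D.L2), D.IsWeakDeriv i u v → D.IsWeakDeriv i u' v' →
        D.IsWeakDeriv i (u + u') (v + v') := by
      intro i u v u' v' h h' φ hφ
      have e1 : ∀ (a b : D.L2) (ψ : Plane → ℂ), MemLp ψ 2 D.μ →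
          ∫ x, (a + b : D.L2) x * ψ x ∂D.μ = ∫ x, a x * ψ x ∂D.μ + ∫ x, b x * ψ x ∂D.μ := by
        intro a b ψ hψ
        rw [← integral_add (D.integrable_mul a hψ) (D.integrable_mul b hψ)]
        refine integral_congr_ae ?_
        filter_upwards [Lp.coeFn_add a b] with x hx
        rw [hx, Pi.add_apply, add_mul]
      rw [e1 _ _ _ (hφ.memLp_partialDeriv i), e1 _ _ _ hφ.memLp, h φ hφ, h' φ hφ]
      ring
    intro U V hU hV
    exact ⟨fun i => key _ _ _ _ _ (hU.1 i) (hV.1 i),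
      fun i j => key _ _ _ _ _ (hU.2 i j) (hV.2 i j)⟩
  zero_mem' := by
    have key : ∀ i : Fin 2, D.IsWeakDeriv i 0 0 := by
      intro i φ _
      have e1 : ∀ ψ : Plane → ℂ, ∫ x, (0 : D.L2) x * ψ x ∂D.μ = 0 := by
        intro ψ
        rw [← integral_zero Plane ℂ (μ := D.μ)]
        refine integral_congr_ae ?_
        filter_upwards [Lp.coeFn_zero ℂ 2 D.μ] with x hx
        rw [hx, Pi.zero_apply, zero_mul]
      rw [e1, e1, neg_zero]
    exact ⟨fun i => key i, fun _ j => key j⟩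
  smul_mem' := by
    have key : ∀ (c : ℂ) (i : Fin 2) (u v : D.L2), D.IsWeakDeriv i u v →
        D.IsWeakDeriv i (c • u) (c • v) := by
      intro c i u v h φ hφ
      have e1 : ∀ (a : D.L2) (ψ : Plane → ℂ),
          ∫ x, (c • a : D.L2) x * ψ x ∂D.μ = c * ∫ x, a x * ψ x ∂D.μ := by
        intro a ψ
        rw [← integral_const_mul]
        refine integral_congr_ae ?_
        filter_upwards [Lp.coeFn_smul c a] with x hx
        rw [hx, Pi.smul_apply, smul_eq_mul, mul_assoc]
      rw [e1, e1, h φ hφ, mul_neg]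
    intro c U hU
    exact ⟨fun i => key c _ _ _ (hU.1 i), fun i j => key c _ _ _ (hU.2 i j)⟩

/-- `H²(D)` is complete, so that integrals of `H²(D)`-valued functions are meaningful. -/
instance completeSpace_H2 (D : SmoothDomain) : CompleteSpace D.H2 := by
  have cont : ∀ ψ : Plane → ℂ, MemLp ψ 2 D.μ →
      Continuous (fun a : D.L2 => ∫ x, a x * ψ x ∂D.μ) := by
    intro ψ hψ
    have hs : MemLp (fun x => star (ψ x)) 2 D.μ := hψ.star
    have e : (fun a : D.L2 => ∫ x, a x * ψ x ∂D.μ) = fun a : D.L2 => inner ℂ (hs.toLp _) a := by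
      funext a
      rw [L2.inner_def]
      refine integral_congr_ae ?_
      filter_upwards [hs.coeFn_toLp] with x hx
      rw [hx]
      simp [mul_comm]
    rw [e]
    fun_prop
  have coord : ∀ k : Jet, Continuous (fun U : PiLp 2 (fun _ : Jet => D.L2) => U k) :=
    fun k => by fun_prop
  have key : ∀ (i : Fin 2) (k l : Jet),
      IsClosed {U : PiLp 2 (fun _ : Jet => D.L2) | D.IsWeakDeriv i (U k) (U l)} := by
    intro i k l
    simp only [IsWeakDeriv, Set.ofPred_forall]
    exact isClosed_iInter fun φ => isClosed_iInter fun hφ =>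
      isClosed_eq ((cont _ (hφ.memLp_partialDeriv i)).comp (coord k))
        ((cont _ hφ.memLp).comp (coord l)).neg
  have hc : IsClosed (D.H2 : Set (PiLp 2 (fun _ : Jet => D.L2))) := by
    have : (D.H2 : Set (PiLp 2 (fun _ : Jet => D.L2))) =
        (⋂ i, {U | D.IsWeakDeriv i (U (.inl ())) (U (.inr (.inl i)))}) ∩
        ⋂ i, ⋂ j, {U | D.IsWeakDeriv j (U (.inr (.inl i))) (U (.inr (.inr (i, j))))} := by
      ext U
      simp only [Set.mem_inter_iff, Set.mem_iInter, Set.mem_ofPred_eq]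
      rfl
    rw [this]
    exact (isClosed_iInter fun i => key _ _ _).inter
      (isClosed_iInter fun i => isClosed_iInter fun j => key _ _ _)
  exact hc.completeSpace_coe

variable {D}

/-- The underlying element of `L²(D)` of `u ∈ H²(D)`. -/
def toL2 (u : D.H2) : D.L2 := u.1 (.inl ())

/-- The first derivative `∂ᵢu` of `u ∈ H²(D)`. -/
def grad (u : D.H2) (i : Fin 2) : D.L2 := u.1 (.inr (.inl i))

/-- The Laplacian `Δu = ∂₁∂₁u + ∂₂∂₂u` of `u ∈ H²(D)`. -/
def lap (u : D.H2) : D.L2 := ∑ i : Fin 2, u.1 (.inr (.inr (i, i)))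

/-- The homogeneous Dirichlet condition `u = 0` on `∂D`, that is `u ∈ H¹₀(D)`: the function `u` is a
limit, in the norm of `H¹(D)`, of test functions. -/
def VanishesOnBoundary (u : D.H2) : Prop :=
  ∀ ε : ℝ≥0∞, 0 < ε → ∃ φ : Plane → ℂ, D.IsTest φ ∧
    eLpNorm (fun x => toL2 u x - φ x) 2 D.μ ≤ ε ∧
    ∀ i : Fin 2, eLpNorm (fun x => grad u i x - partialDeriv i φ x) 2 D.μ ≤ ε

/-- The flux `∫_D u(x) dx`. -/
def flux (u : D.H2) : ℂ := ∫ x, toL2 u x ∂D.μ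

/-- The constant function on `D` with value `c`, as an element of `L²(D)`. -/
def const (D : SmoothDomain) (c : ℂ) : D.L2 := Lp.const 2 D.μ c

/-! ### The basic flow problem -/

/-- Solutions `(w, π)` of the basic flow problem
`∂ₜw - ν Δw = π` in `D`, `w = 0` on `∂D`, `∫_D w(t) = g(t)`, for all `t ∈ ℝ`, in the Bohr class:
`w ∈ AP(ℝ; H²(D))`, `∂ₜw ∈ AP(ℝ; L²(D))` and `π ∈ AP(ℝ)`, where `∂ₜw` is the derivative of `w` as a
function of time with values in `L²(D)`. -/
def IsBohrSolution (D : SmoothDomain) (ν : ℝ) (g : ℝ → ℂ) (w : ℝ → D.H2) (π : ℝ → ℂ) : Prop :=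
  IsBohrAP w ∧ IsBohrAP π ∧
  ∃ wt : ℝ → D.L2, IsBohrAP wt ∧
    ∀ t : ℝ, HasDerivAt (fun s => toL2 (w s)) (wt t) t ∧
      VanishesOnBoundary (w t) ∧
      wt t - (ν : ℂ) • lap (w t) = D.const (π t) ∧
      flux (w t) = g t

/-- Solutions `(w, π)` of the basic flow problem with flux `f` in the sense of Besicovitch:
`w ∈ B²(ℝ; H²(D))`, `π ∈ B²(ℝ)`, the time derivative `∂ₜw` (the function with Fourier coefficients
`i ξ w_ξ`) exists in `B²(ℝ; L²(D))`, the Fourier coefficients of `w` vanish on `∂D`, and the two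
equations `∂ₜw - ν Δw = π` and `∫_D w = f` hold up to equality of Fourier coefficients. -/
def IsBesicovitchSolution (D : SmoothDomain) (ν : ℝ) (f : ℝ → ℂ) (w : ℝ → D.H2) (π : ℝ → ℂ) :
    Prop :=
  IsBesicovitch w ∧ IsBesicovitch π ∧
  (∀ (ξ : ℝ) (a : D.H2), HasBohrCoeff w ξ a → VanishesOnBoundary a) ∧
  (∃ wt : ℝ → D.L2, IsBesicovitch wt ∧
    (∀ (ξ : ℝ) (a : D.H2), HasBohrCoeff w ξ a →
      HasBohrCoeff wt ξ ((Complex.I * (ξ : ℂ)) • toL2 a)) ∧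
    ApEquiv (fun t => wt t - (ν : ℂ) • lap (w t)) (fun t => D.const (π t))) ∧
  ApEquiv (fun t => flux (w t)) f

end SmoothDomain

end

set_option linter.unusedSectionVars false

noncomputable section


/-! ### Almost periodic functions -/

section AlmostPeriodicTheory

variable {X : Type*} [NormedAddCommGroup X] [NormedSpace ℂ X]
variable {Y : Type*} [NormedAddCommGroup Y] [NormedSpace ℂ Y]

/-! The problem decouples over frequencies. The Fourier coefficients of a solution must satisfy the
resolvent problem iξ w_ξ - νΔw_ξ = π_ξ with zero boundary values and flux f_ξ (`IsModeSolution`).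
Once this problem is solved with bounds uniform in ν and ξ, the series of modes converge absolutely,
and their sums (`trigSeries`) are almost periodic in the sense of Bohr and of Besicovitch and may be
differentiated term by term.

A mode with pressure 1 comes from coercivity of the form ν(∇v,∇u) + iξ(v,u) on `H10`
(`exists_mode`); it has nonzero flux and can be rescaled to any flux. The uniform bounds
(`exists_mode_bound`) combine two facts. Pairing the equation with w_ξ gives π_ξ conj(f_ξ) =
ν‖∇w_ξ‖² + iξ‖w_ξ‖², so by Poincaré (ν+|ξ|)‖w_ξ‖² is at most a constant times |π_ξ||f_ξ|. Pairing it
with a fixed test function of integral one gives |π_ξ| ≤ T(ν+|ξ|)‖w_ξ‖. The factor (ν+|ξ|)‖w_ξ‖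
cancels, which leaves ‖w_ξ‖ ≤ c|f_ξ|. The pressure bound follows, and the equation then bounds Δw_ξ.

Membership in H² needs elliptic regularity up to the boundary (`exists_regularity`), which is the
longest part. In a boundary chart the difference quotients are taken along shears parallel to the
graph. These preserve the measure and, when small, keep functions supported in the chart and
vanishing near the boundary of that kind, so second differences are admissible in the weak equation.
This bounds tangential derivatives of first derivatives; the Laplacian supplies the missing normal
one (`norm_integral_second_le`). A partition of unity glues the charts, and Riesz representation
turns bounds on distributional derivatives into square integrable functions. Differences are taken
of smooth approximants of the weak solution, whose equation holds up to a small H⁻¹ error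
(`ApproxSol`).

Uniqueness among Besicovitch solutions holds frequency by frequency, since a mode of zero flux
vanishes. For Bohr solutions, the difference z of two of them has zero flux, so the pressure drops
out of the energy balance: the derivative of ‖z‖² is -2ν‖∇z‖² ≤ -κ‖z‖², and a bounded function on
the whole line with this decay is zero. A real flux gives a real solution because the conjugate
solves the same problem. -/

theorem bohrChar_eq (ξ t : ℝ) : bohrChar ξ t = Complex.exp (((ξ * t : ℝ) : ℂ) * Complex.I) := by
  unfold bohrChar; congr 1; push_cast; ring

theorem norm_bohrChar (ξ t : ℝ) : ‖bohrChar ξ t‖ = 1 := by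
  rw [bohrChar_eq]; exact Complex.norm_exp_ofReal_mul_I _

theorem continuous_bohrChar (ξ : ℝ) : Continuous (bohrChar ξ) := by
  unfold bohrChar; fun_prop

theorem bohrChar_add (ξ s t : ℝ) : bohrChar ξ (s + t) = bohrChar ξ s * bohrChar ξ t := by
  unfold bohrChar; rw [← Complex.exp_add]; congr 1; push_cast; ring

theorem bohrChar_mul (ξ η t : ℝ) : bohrChar ξ t * bohrChar η t = bohrChar (ξ + η) t := by
  unfold bohrChar; rw [← Complex.exp_add]; congr 1; push_cast; ring

theorem bohrChar_zero (t : ℝ) : bohrChar 0 t = 1 := by simp [bohrChar]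

theorem bohrChar_neg (ξ t : ℝ) : bohrChar (-ξ) t = star (bohrChar ξ t) := by
  unfold bohrChar
  rw [Complex.star_def, ← Complex.exp_conj]; congr 1; simp

theorem hasDerivAt_bohrChar (ξ t : ℝ) :
    HasDerivAt (bohrChar ξ) (Complex.I * ξ * bohrChar ξ t) t := by
  have h : HasDerivAt (fun t : ℝ => Complex.I * (ξ : ℂ) * (t : ℂ)) (Complex.I * ξ * 1) t :=
    (Complex.ofRealCLM.hasDerivAt (x := t)).const_mul (Complex.I * (ξ : ℂ))
  have := h.cexp
  unfold bohrChar
  convert this using 1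
  ring

theorem LocallyIntegrable.bohrChar_smul {f : ℝ → X} (hf : LocallyIntegrable f volume) (ξ : ℝ) :
    LocallyIntegrable (fun t => bohrChar ξ t • f t) volume := by
  rw [locallyIntegrable_iff] at hf ⊢
  intro k hk
  exact (hf k hk).bdd_smul 1 (continuous_bohrChar ξ).aestronglyMeasurable
    (Eventually.of_forall fun t => (norm_bohrChar ξ t).le)

theorem HasBohrCoeff.unique {f : ℝ → X} {ξ : ℝ} {a b : X} (ha : HasBohrCoeff f ξ a)
    (hb : HasBohrCoeff f ξ b) : a = b :=
  tendsto_nhds_unique ha hb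

theorem HasBohrCoeff.add {f g : ℝ → X} {ξ : ℝ} {a b : X} (ha : HasBohrCoeff f ξ a)
    (hb : HasBohrCoeff g ξ b) (hf : LocallyIntegrable f volume) (hg : LocallyIntegrable g volume) :
    HasBohrCoeff (fun t => f t + g t) ξ (a + b) := by
  unfold HasBohrCoeff at *
  refine (Tendsto.add ha hb).congr fun R => ?_
  rw [← smul_add, ← intervalIntegral.integral_add]
  · simp only [smul_add]
  · exact ((LocallyIntegrable.bohrChar_smul hf _).integrableOn_isCompact
      isCompact_uIcc).intervalIntegrable
  · exact ((LocallyIntegrable.bohrChar_smul hg _).integrableOn_isCompact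
      isCompact_uIcc).intervalIntegrable

theorem HasBohrCoeff.map [CompleteSpace X] [CompleteSpace Y] {f : ℝ → X} {ξ : ℝ} {a : X}
    (ha : HasBohrCoeff f ξ a)
    (hf : LocallyIntegrable f volume) (L : X →L[ℂ] Y) :
    HasBohrCoeff (fun t => L (f t)) ξ (L a) := by
  unfold HasBohrCoeff at *
  refine ((L.continuous.tendsto a).comp ha).congr fun R => ?_
  simp only [Function.comp]
  rw [L.map_smul_of_tower]
  congr 1
  have := L.intervalIntegral_comp_comm (μ := volume) (a := -R) (b := R)
    (f := fun t => bohrChar (-ξ) t • f t)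
    ((LocallyIntegrable.bohrChar_smul hf _).integrableOn_isCompact
      isCompact_uIcc).intervalIntegrable
  simp only [map_smul] at this
  exact this.symm

theorem HasBohrCoeff.neg {f : ℝ → X} {ξ : ℝ} {a : X} (ha : HasBohrCoeff f ξ a) :
    HasBohrCoeff (fun t => - f t) ξ (-a) := by
  unfold HasBohrCoeff at *
  refine (Tendsto.neg ha).congr fun R => ?_
  simp [intervalIntegral.integral_neg]

theorem HasBohrCoeff.const_smul {f : ℝ → X} {ξ : ℝ} {a : X} (ha : HasBohrCoeff f ξ a) (c : ℂ) :
    HasBohrCoeff (fun t => c • f t) ξ (c • a) := by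
  unfold HasBohrCoeff at *
  refine (Tendsto.const_smul ha c).congr fun R => ?_
  rw [smul_comm, ← intervalIntegral.integral_smul]
  simp only [smul_comm c]

theorem HasBohrCoeff.sub {f g : ℝ → X} {ξ : ℝ} {a b : X} (ha : HasBohrCoeff f ξ a)
    (hb : HasBohrCoeff g ξ b) (hf : LocallyIntegrable f volume) (hg : LocallyIntegrable g volume) :
    HasBohrCoeff (fun t => f t - g t) ξ (a - b) := by
  simpa [sub_eq_add_neg] using ha.add hb.neg hf hg.neg

theorem hasBohrCoeff_zero (ξ : ℝ) : HasBohrCoeff (fun _ => (0 : X)) ξ 0 := by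
  unfold HasBohrCoeff; simp

/-- Orthogonality of characters. Off the diagonal the integrand is a nontrivial character, whose
primitive is bounded, so its mean over [-R, R] is O(1/R). -/
theorem hasBohrCoeff_bohrChar_smul [CompleteSpace X] (η ξ : ℝ) (c : X) :
    HasBohrCoeff (fun t => bohrChar η t • c) ξ (if ξ = η then c else 0) := by
  unfold HasBohrCoeff
  have e : ∀ t : ℝ, bohrChar (-ξ) t • bohrChar η t • c = bohrChar (η - ξ) t • c := by
    intro t; rw [smul_smul, bohrChar_mul]; congr 2; ring
  simp only [e]
  split_ifs with h
  · subst h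
    refine tendsto_const_nhds.congr' ?_
    filter_upwards [eventually_gt_atTop 0] with R hR
    simp only [sub_self, bohrChar_zero, one_smul, intervalIntegral.integral_const, smul_smul]
    rw [show R - -R = 2 * R by ring, inv_mul_cancel₀ (by positivity), one_smul]
  · have hne : η - ξ ≠ 0 := sub_ne_zero.2 (Ne.symm h)
    set z := η - ξ
    have hI : ∀ R : ℝ, ∫ t in (-R)..R, bohrChar z t • c =
        ((Complex.I * z)⁻¹ * (bohrChar z R - bohrChar z (-R))) • c := by
      intro R
      rw [intervalIntegral.integral_smul_const]
      congr 1
      have : ∀ t ∈ Set.uIcc (-R) R,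
          HasDerivAt (fun s => (Complex.I * z)⁻¹ * bohrChar z s) (bohrChar z t) t := by
        intro t _
        have := (hasDerivAt_bohrChar z t).const_mul (Complex.I * z : ℂ)⁻¹
        rwa [← mul_assoc, inv_mul_cancel₀ (by simp [hne]), one_mul] at this
      rw [intervalIntegral.integral_eq_sub_of_hasDerivAt this
        ((continuous_bohrChar z).intervalIntegrable _ _)]
      ring
    simp only [hI]
    rw [tendsto_zero_iff_norm_tendsto_zero]
    have hb : ∀ᶠ R : ℝ in atTop,
        ‖(2 * R)⁻¹ • ((Complex.I * z)⁻¹ * (bohrChar z R - bohrChar z (-R))) • c‖ ≤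
          R⁻¹ * (|z|⁻¹ * ‖c‖) := by
      filter_upwards [eventually_gt_atTop 0] with R hR
      rw [norm_smul, norm_smul, norm_mul]
      have h1 : ‖bohrChar z R - bohrChar z (-R)‖ ≤ 2 := by
        refine (norm_sub_le _ _).trans ?_
        rw [norm_bohrChar, norm_bohrChar]; norm_num
      have h2 : ‖(Complex.I * (z : ℂ))⁻¹‖ = |z|⁻¹ := by simp
      rw [h2, Real.norm_of_nonneg (by positivity), mul_inv]
      calc 2⁻¹ * R⁻¹ * (|z|⁻¹ * ‖bohrChar z R - bohrChar z (-R)‖ * ‖c‖)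
          ≤ 2⁻¹ * R⁻¹ * (|z|⁻¹ * 2 * ‖c‖) := by gcongr
        _ = _ := by ring
    refine squeeze_zero' (Eventually.of_forall fun _ => norm_nonneg _) hb ?_
    simpa using tendsto_inv_atTop_zero.mul_const (|z|⁻¹ * ‖c‖)

theorem hasBohrCoeff_trigSum [CompleteSpace X] (s : Finset ℝ) (c : ℝ → X) (ξ : ℝ) :
    HasBohrCoeff (fun t => ∑ η ∈ s, bohrChar η t • c η) ξ (if ξ ∈ s then c ξ else 0) := by
  classical
  have h : ∀ s : Finset ℝ, HasBohrCoeff (fun t => ∑ η ∈ s, bohrChar η t • c η) ξ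
      (∑ η ∈ s, if ξ = η then c η else 0) := by
    intro s
    induction s using Finset.induction_on with
    | empty => simpa using hasBohrCoeff_zero ξ
    | insert a s ha ih =>
      simp only [Finset.sum_insert ha]
      refine (hasBohrCoeff_bohrChar_smul a ξ (c a)).add ih ?_ ?_
      · exact ((continuous_bohrChar a).smul continuous_const).locallyIntegrable
      · exact (continuous_finsetSum _ fun i _ =>
          (continuous_bohrChar i).smul continuous_const).locallyIntegrable
  have := h s
  simpa using this

theorem IsTrigPoly.continuous {P : ℝ → X} (hP : IsTrigPoly P) : Continuous P := by
  obtain ⟨s, c, h⟩ := hP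
  rw [funext h]
  exact continuous_finsetSum _ fun i _ => (continuous_bohrChar i).smul continuous_const

theorem IsTrigPoly.exists_coeff [CompleteSpace X] {P : ℝ → X} (hP : IsTrigPoly P) (ξ : ℝ) :
    ∃ a, HasBohrCoeff P ξ a := by
  obtain ⟨s, c, h⟩ := hP
  rw [funext h]
  exact ⟨_, hasBohrCoeff_trigSum s c ξ⟩

/-! ### Absolutely convergent trigonometric series -/

/-- The sum of an absolutely convergent trigonometric series. -/
def trigSeries (c : ℝ → X) (t : ℝ) : X := ∑' ξ : ℝ, bohrChar ξ t • c ξ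

theorem norm_bohrChar_smul (ξ t : ℝ) (c : X) : ‖bohrChar ξ t • c‖ = ‖c‖ := by
  rw [norm_smul, norm_bohrChar, one_mul]

theorem trigSeries_approx [CompleteSpace X] {c : ℝ → X} (hc : Summable fun ξ => ‖c ξ‖) {ε : ℝ}
    (hε : 0 < ε) : ∃ s₀ : Finset ℝ, ∀ s, s₀ ⊆ s → ∀ t,
      ‖trigSeries c t - ∑ ξ ∈ s, bohrChar ξ t • c ξ‖ ≤ ε := by
  have := tendstoUniformly_tsum (f := fun ξ t => bohrChar ξ t • c ξ) hc
    (fun ξ t => (norm_bohrChar_smul ξ t (c ξ)).le)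
  rw [Metric.tendstoUniformly_iff] at this
  obtain ⟨s₀, hs⟩ := eventually_atTop.1 (this ε hε)
  refine ⟨s₀, fun s h t => ?_⟩
  have := hs s h t
  rw [dist_eq_norm] at this
  exact this.le

theorem continuous_trigSeries [CompleteSpace X] {c : ℝ → X} (hc : Summable fun ξ => ‖c ξ‖) :
    Continuous (trigSeries c) :=
  continuous_tsum (fun ξ => (continuous_bohrChar ξ).smul continuous_const) hc
    (fun ξ t => (norm_bohrChar_smul ξ t (c ξ)).le)

theorem summable_trigSeries [CompleteSpace X] {c : ℝ → X} (hc : Summable fun ξ => ‖c ξ‖) (t : ℝ) :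
    Summable fun ξ => bohrChar ξ t • c ξ :=
  Summable.of_norm (by simpa only [norm_bohrChar_smul] using hc)

theorem map_trigSeries [CompleteSpace X] {c : ℝ → X} (hc : Summable fun ξ => ‖c ξ‖)
    (L : X →L[ℂ] Y) (t : ℝ) : L (trigSeries c t) = trigSeries (fun ξ => L (c ξ)) t := by
  unfold trigSeries
  rw [L.map_tsum (summable_trigSeries hc t)]
  simp only [map_smul]

theorem norm_bohrAverage_le {f : ℝ → X} {ξ R ε : ℝ} (hR : 0 < R) (h : ∀ t, ‖f t‖ ≤ ε) :
    ‖(2 * R)⁻¹ • ∫ t in (-R)..R, bohrChar (-ξ) t • f t‖ ≤ ε := by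
  have := intervalIntegral.norm_integral_le_of_norm_le_const (a := -R) (b := R)
    (f := fun t => bohrChar (-ξ) t • f t) (C := ε)
    (fun t _ => (norm_bohrChar_smul (-ξ) t (f t)).le.trans (h t))
  rw [show R - -R = 2 * R by ring, abs_of_pos (by positivity)] at this
  rw [norm_smul, Real.norm_of_nonneg (by positivity)]
  calc (2 * R)⁻¹ * _ ≤ (2 * R)⁻¹ * (ε * (2 * R)) := by gcongr
    _ = ε := by field_simp

/-- Averaging against a unimodular character does not increase the sup norm, so the averages of `F`
and `P` differ by at most ε for every R > 0. All approximants `P` share the same coefficient `a`. -/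
theorem HasBohrCoeff.of_uniform_limit {F : ℝ → X} {ξ : ℝ} {a : X}
    (hF : LocallyIntegrable F volume)
    (h : ∀ ε : ℝ, 0 < ε → ∃ P : ℝ → X, LocallyIntegrable P volume ∧ HasBohrCoeff P ξ a ∧
      ∀ t, ‖F t - P t‖ ≤ ε) : HasBohrCoeff F ξ a := by
  unfold HasBohrCoeff
  rw [Metric.tendsto_nhds]
  intro ε hε
  obtain ⟨P, hP, hPa, hFP⟩ := h (ε / 2) (by positivity)
  have h1 := (Metric.tendsto_nhds.1 hPa) (ε / 2) (by positivity)
  filter_upwards [h1, eventually_gt_atTop 0] with R hR hR0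
  have h2 := norm_bohrAverage_le (ξ := ξ) hR0 hFP
  have hi : ∀ g : ℝ → X, LocallyIntegrable g volume →
      IntervalIntegrable (fun t => bohrChar (-ξ) t • g t) volume (-R) R := fun g hg =>
    ((LocallyIntegrable.bohrChar_smul hg _).integrableOn_isCompact
      isCompact_uIcc).intervalIntegrable
  simp only [smul_sub] at h2
  rw [intervalIntegral.integral_sub (hi _ hF) (hi _ hP), smul_sub] at h2
  rw [dist_eq_norm] at hR ⊢
  calc _ = ‖((2 * R)⁻¹ • (∫ t in (-R)..R, bohrChar (-ξ) t • F t) -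
          (2 * R)⁻¹ • (∫ t in (-R)..R, bohrChar (-ξ) t • P t)) +
          ((2 * R)⁻¹ • (∫ t in (-R)..R, bohrChar (-ξ) t • P t) - a)‖ := by congr 1; abel
    _ < ε / 2 + ε / 2 := (norm_add_le _ _).trans_lt (by linarith)
    _ = ε := by ring

theorem hasBohrCoeff_trigSeries [CompleteSpace X] {c : ℝ → X} (hc : Summable fun ξ => ‖c ξ‖)
    (ξ : ℝ) : HasBohrCoeff (trigSeries c) ξ (c ξ) := by
  classical
  refine HasBohrCoeff.of_uniform_limit (continuous_trigSeries hc).locallyIntegrable ?_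
  intro ε hε
  obtain ⟨s₀, hs⟩ := trigSeries_approx hc hε
  refine ⟨_, ?_, ?_, hs (insert ξ s₀) (Finset.subset_insert _ _)⟩
  · exact (continuous_finsetSum _ fun i _ =>
      (continuous_bohrChar i).smul continuous_const).locallyIntegrable
  · have := hasBohrCoeff_trigSum (insert ξ s₀) c ξ
    simpa using this

/-- Simultaneous almost periods of finitely many characters are relatively dense. -/
theorem isRelativelyDense_bohrChar (s : Finset ℝ) {ε : ℝ} (hε : 0 < ε) :
    IsRelativelyDense {τ : ℝ | ∀ ξ ∈ s, ‖bohrChar ξ τ - 1‖ ≤ ε} := by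
  -- Pigeonhole by compactness: the vector of characters stays in the unit ball of a
  -- finite-dimensional space, so finitely many of its values `Φ u` form an ε-net of its range.
  let Φ : ℝ → (s → ℂ) := fun t ξ => bohrChar ξ t
  have hb : TotallyBounded (Set.range Φ) := by
    refine TotallyBounded.subset ?_ (isCompact_closedBall (0 : s → ℂ) 1).totallyBounded
    rintro _ ⟨t, rfl⟩
    rw [mem_closedBall_zero_iff, pi_norm_le_iff_of_nonneg zero_le_one]
    exact fun ξ => (norm_bohrChar ξ t).le
  obtain ⟨T, hTs, hTf, hT⟩ := Metric.finite_approx_of_totallyBounded hb ε hε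
  obtain ⟨U, hU, hUf, rfl⟩ : ∃ U : Set ℝ, U.Nonempty ∧ U.Finite ∧ Φ '' U = T := by
    obtain ⟨U, -, hU⟩ := Set.SurjOn.exists_bijOn_subset (f := Φ) (s := Set.univ) (t := T)
      (by simpa [Set.SurjOn] using hTs)
    refine ⟨U, ?_, ?_, hU.image_eq⟩
    · by_contra hne
      rw [Set.not_nonempty_iff_eq_empty] at hne
      have hTe : T = ∅ := by rw [← hU.image_eq, hne, Set.image_empty]
      have := hT ⟨0, rfl⟩
      simp [hTe] at this
    · exact Set.Finite.of_finite_image (by rw [hU.image_eq]; exact hTf) hU.injOn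
  obtain ⟨M, hM⟩ := hUf.isBounded.exists_norm_le
  have hM0 : 0 ≤ M := by
    obtain ⟨u, hu⟩ := hU
    exact (norm_nonneg _).trans (hM u hu)
  -- If `Φ u` is ε-close to `Φ (a + M)`, then a + M - u is a common almost period. It lies in [a, a
  -- + 2M] because |u| ≤ M. The extra 1 keeps the length positive when M = 0.
  refine ⟨2 * M + 1, by positivity, fun a => ?_⟩
  have := hT ⟨a + M, rfl⟩
  simp only [Set.mem_iUnion, Set.mem_image, exists_prop, exists_exists_and_eq_and] at this
  obtain ⟨u, hu, hau⟩ := this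
  have hMu := abs_le.1 (hM u hu)
  refine ⟨a + M - u, fun ξ hξ => ?_, by linarith, by linarith⟩
  rw [Metric.mem_ball, dist_pi_lt_iff hε] at hau
  have h1 := hau ⟨ξ, hξ⟩
  simp only [Φ, dist_eq_norm] at h1
  have h2 : bohrChar ξ (a + M) = bohrChar ξ (a + M - u) * bohrChar ξ u := by
    rw [← bohrChar_add]; congr 1; ring
  rw [h2, show bohrChar ξ (a + M - u) * bohrChar ξ u - bohrChar ξ u =
    (bohrChar ξ (a + M - u) - 1) * bohrChar ξ u by ring, norm_mul, norm_bohrChar, mul_one] at h1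
  exact h1.le

theorem IsRelativelyDense.mono {A B : Set ℝ} (hA : IsRelativelyDense A) (h : A ⊆ B) :
    IsRelativelyDense B := by
  obtain ⟨L, hL, hA⟩ := hA
  refine ⟨L, hL, fun a => ?_⟩
  obtain ⟨τ, hτ, h1⟩ := hA a
  exact ⟨τ, h hτ, h1⟩

theorem isBohrAP_trigSeries [CompleteSpace X] {c : ℝ → X} (hc : Summable fun ξ => ‖c ξ‖) :
    IsBohrAP (trigSeries c) := by
  refine ⟨continuous_trigSeries hc, fun ε hε => ?_⟩
  obtain ⟨s, hs⟩ := trigSeries_approx hc (ε := ε / 3) (by positivity)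
  have hs := hs s subset_rfl
  set M := ∑ ξ ∈ s, ‖c ξ‖
  have hM : 0 ≤ M := Finset.sum_nonneg fun _ _ => norm_nonneg _
  -- A common almost period of the characters in `s` moves the partial sum by at most M times the
  -- tolerance, hence by ε/3; M + 1 avoids division by zero. The two tails account for the other
  -- 2ε/3.
  refine (isRelativelyDense_bohrChar s (ε := ε / (3 * (M + 1))) (by positivity)).mono ?_
  intro τ hτ t
  have hsum : ‖∑ ξ ∈ s, bohrChar ξ (t + τ) • c ξ - ∑ ξ ∈ s, bohrChar ξ t • c ξ‖ ≤ ε / 3 := by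
    rw [← Finset.sum_sub_distrib]
    calc _ ≤ ∑ ξ ∈ s, ‖bohrChar ξ (t + τ) • c ξ - bohrChar ξ t • c ξ‖ := norm_sum_le _ _
      _ ≤ ∑ ξ ∈ s, ε / (3 * (M + 1)) * ‖c ξ‖ := by
        refine Finset.sum_le_sum fun ξ hξ => ?_
        rw [← sub_smul, norm_smul, bohrChar_add,
          show bohrChar ξ t * bohrChar ξ τ - bohrChar ξ t =
            bohrChar ξ t * (bohrChar ξ τ - 1) by ring, norm_mul, norm_bohrChar, one_mul]
        gcongr
        exact hτ ξ hξ
      _ = ε / (3 * (M + 1)) * M := by rw [Finset.mul_sum]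
      _ ≤ ε / (3 * (M + 1)) * (M + 1) := by gcongr; linarith
      _ = ε / 3 := by field_simp
  have h1 := hs (t + τ)
  have h2 := hs t
  calc ‖trigSeries c (t + τ) - trigSeries c t‖
      = ‖(trigSeries c (t + τ) - ∑ ξ ∈ s, bohrChar ξ (t + τ) • c ξ)
        + (∑ ξ ∈ s, bohrChar ξ (t + τ) • c ξ - ∑ ξ ∈ s, bohrChar ξ t • c ξ)
        - (trigSeries c t - ∑ ξ ∈ s, bohrChar ξ t • c ξ)‖ := by congr 1; abel
    _ ≤ ε / 3 + ε / 3 + ε / 3 :=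
      (norm_sub_le _ _).trans (add_le_add ((norm_add_le _ _).trans (add_le_add h1 hsum)) h2)
    _ = ε := by ring

/-! ### Besicovitch means, boundedness and existence of Fourier coefficients -/

theorem besicovitchSq_le_of_norm_le {f : ℝ → X} {δ : ℝ≥0∞} (h : ∀ t, ‖f t‖ₑ ^ 2 ≤ δ) :
    besicovitchSq f ≤ δ := by
  refine limsup_le_of_le (by isBoundedDefault) ?_
  filter_upwards [eventually_gt_atTop 0] with R hR
  have h2 : (∫⁻ t in Set.Ioc (-R) R, ‖f t‖ₑ ^ 2) ≤ δ * ENNReal.ofReal (2 * R) := by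
    calc _ ≤ ∫⁻ _ in Set.Ioc (-R) R, δ := lintegral_mono fun t => h t
      _ = _ := by
        rw [setLIntegral_const, Real.volume_Ioc]; congr 2; ring
  exact ENNReal.div_le_of_le_mul h2

theorem isBesicovitch_trigSeries [CompleteSpace X] {c : ℝ → X} (hc : Summable fun ξ => ‖c ξ‖) :
    IsBesicovitch (trigSeries c) := by
  refine ⟨(continuous_trigSeries hc).aestronglyMeasurable, fun ε hε => ?_⟩
  obtain ⟨δ, hδ, hδε⟩ : ∃ δ : ℝ, 0 < δ ∧ ENNReal.ofReal δ ^ 2 ≤ ε := by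
    by_cases h : ε = ⊤
    · exact ⟨1, one_pos, by simp [h]⟩
    · have he : 0 < ε.toReal := ENNReal.toReal_pos hε.ne' h
      refine ⟨Real.sqrt ε.toReal, Real.sqrt_pos.2 he, ?_⟩
      rw [← ENNReal.ofReal_pow (Real.sqrt_nonneg _), Real.sq_sqrt he.le, ENNReal.ofReal_toReal h]
  obtain ⟨s, hs⟩ := trigSeries_approx hc hδ
  refine ⟨_, ⟨s, c, fun t => rfl⟩, besicovitchSq_le_of_norm_le fun t => ?_⟩
  refine le_trans ?_ hδε
  gcongr
  rw [← ofReal_norm]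
  exact ENNReal.ofReal_le_ofReal (hs s subset_rfl t)

/-- A 1-almost period chosen in [-t, -t + L] carries t into the compact interval [0, L], where `f`
is bounded. -/
theorem IsBohrAP.bounded {f : ℝ → X} (hf : IsBohrAP f) : ∃ M : ℝ, ∀ t, ‖f t‖ ≤ M := by
  obtain ⟨L, hL, h⟩ := hf.2 1 one_pos
  obtain ⟨M, hM⟩ := (isCompact_Icc (a := (0 : ℝ)) (b := L)).exists_bound_of_continuousOn
    hf.1.continuousOn
  refine ⟨M + 1, fun t => ?_⟩
  obtain ⟨τ, hτ, h1, h2⟩ := h (-t)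
  have h3 := hM (t + τ) ⟨by linarith, by linarith⟩
  have h4 := hτ t
  calc ‖f t‖ = ‖f (t + τ) - (f (t + τ) - f t)‖ := by congr 1; abel
    _ ≤ M + 1 := (norm_sub_le _ _).trans (add_le_add h3 h4)

/-- Replaces Cauchy–Schwarz in the passage from quadratic means to means; being pointwise, it asks
for no measurability of the function. -/
theorem ENNReal.le_sq_div_add (x δ : ℝ≥0∞) (h0 : δ ≠ 0) (ht : δ ≠ ⊤) : x ≤ x ^ 2 / δ + δ := by
  rcases le_total x δ with h | h
  · exact h.trans le_add_self
  · refine le_trans ?_ le_self_add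
    rw [ENNReal.le_div_iff_mul_le (Or.inl h0) (Or.inl ht), sq]
    gcongr

/-- A small quadratic mean gives a small mean. -/
theorem eventually_mean_le {g : ℝ → X} {δ : ℝ} (hδ : 0 < δ)
    (hg : besicovitchSq g < ENNReal.ofReal δ ^ 2) :
    ∀ᶠ R : ℝ in atTop,
      ∫⁻ t in Set.Ioc (-R) R, ‖g t‖ₑ ≤ ENNReal.ofReal (2 * δ) * ENNReal.ofReal (2 * R) := by
  have h := eventually_lt_of_limsup_lt hg
  filter_upwards [h, eventually_gt_atTop 0] with R hR hR0
  have hd0 : ENNReal.ofReal δ ≠ 0 := by simpa using hδ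
  have hR2 : ENNReal.ofReal (2 * R) ≠ 0 := by
    rw [Ne, ENNReal.ofReal_eq_zero, not_le]; positivity
  rw [ENNReal.div_lt_iff (Or.inl hR2) (Or.inl ENNReal.ofReal_ne_top)] at hR
  calc ∫⁻ t in Set.Ioc (-R) R, ‖g t‖ₑ
      ≤ ∫⁻ t in Set.Ioc (-R) R, (‖g t‖ₑ ^ 2 / ENNReal.ofReal δ + ENNReal.ofReal δ) :=
        lintegral_mono fun t => ENNReal.le_sq_div_add _ _ hd0 ENNReal.ofReal_ne_top
    _ = (∫⁻ t in Set.Ioc (-R) R, ‖g t‖ₑ ^ 2) / ENNReal.ofReal δ +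
        ENNReal.ofReal δ * ENNReal.ofReal (2 * R) := by
        rw [lintegral_add_right _ measurable_const, setLIntegral_const, Real.volume_Ioc]
        simp only [div_eq_mul_inv]
        rw [lintegral_mul_const' _ _ (ENNReal.inv_ne_top.2 hd0)]
        congr 3; ring
    _ ≤ ENNReal.ofReal δ ^ 2 * ENNReal.ofReal (2 * R) / ENNReal.ofReal δ +
        ENNReal.ofReal δ * ENNReal.ofReal (2 * R) := by gcongr
    _ = ENNReal.ofReal (2 * δ) * ENNReal.ofReal (2 * R) := by
        rw [two_mul δ, ENNReal.ofReal_add hδ.le hδ.le, add_mul]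
        congr 1
        rw [sq, mul_assoc, mul_div_assoc, ENNReal.mul_div_cancel hd0 ENNReal.ofReal_ne_top]

/-- One trigonometric polynomial at finite Besicovitch distance suffices: the integral of ‖f - P‖
over (-R, R] is finite for all large R, and these intervals exhaust the line. -/
theorem IsBesicovitch.locallyIntegrable {f : ℝ → X} (hf : IsBesicovitch f) :
    LocallyIntegrable f volume := by
  obtain ⟨P, hP, hPf⟩ := hf.2 (ENNReal.ofReal 1 ^ 2 / 2) (by simp)
  have hlt : besicovitchSq (fun t => f t - P t) < ENNReal.ofReal 1 ^ 2 :=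
    hPf.trans_lt (ENNReal.half_lt_self (by simp) (by simp))
  have h := eventually_mean_le one_pos hlt
  have hg : LocallyIntegrable (fun t => f t - P t) volume := by
    rw [locallyIntegrable_iff]
    intro k hk
    obtain ⟨M, hM⟩ := hk.isBounded.exists_norm_le
    obtain ⟨R, hR, hRM⟩ := (h.and (eventually_gt_atTop M)).exists
    have : IntegrableOn (fun t => f t - P t) (Set.Ioc (-R) R) volume := by
      refine ⟨(hf.1.sub hP.continuous.aestronglyMeasurable).restrict, ?_⟩
      exact hR.trans_lt (ENNReal.mul_lt_top ENNReal.ofReal_lt_top ENNReal.ofReal_lt_top)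
    refine this.mono_set fun x hx => ?_
    have := abs_le.1 (hM x hx)
    exact ⟨by linarith, by linarith⟩
  have := hg.add hP.continuous.locallyIntegrable
  rwa [show (fun t => f t - P t) + P = f by ext; simp] at this

theorem IsBesicovitch.exists_coeff [CompleteSpace X] {f : ℝ → X} (hf : IsBesicovitch f) (ξ : ℝ) :
    ∃ a, HasBohrCoeff f ξ a := by
  unfold HasBohrCoeff
  refine cauchySeq_tendsto_of_complete ?_
  rw [Metric.cauchySeq_iff]
  intro ε hε
  -- Replacing f by P changes a late average by at most 2δ, and the average of P is within δ of its
  -- coefficient. So every late average of f is within 4δ of `a`, and two of them differ by less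
  -- than 8δ = ε.
  set δ := ε / 8 with hδd
  have hδ : 0 < δ := by positivity
  have hδ2 : ENNReal.ofReal δ ^ 2 ≠ 0 := by simpa using hδ
  obtain ⟨P, hP, hPf⟩ := hf.2 (ENNReal.ofReal δ ^ 2 / 2) (by simpa using hδ)
  have hlt : besicovitchSq (fun t => f t - P t) < ENNReal.ofReal δ ^ 2 :=
    hPf.trans_lt (ENNReal.half_lt_self hδ2 (by simp))
  have h := eventually_mean_le hδ hlt
  obtain ⟨a, ha⟩ := hP.exists_coeff ξ
  have h1 := (Metric.tendsto_nhds.1 ha) δ hδ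
  have key : ∀ᶠ R : ℝ in atTop,
      dist ((2 * R)⁻¹ • ∫ t in (-R)..R, bohrChar (-ξ) t • f t) a < 3 * δ + δ := by
    filter_upwards [h, h1, eventually_gt_atTop 0] with R hR hR1 hR0
    have hi : ∀ g : ℝ → X, LocallyIntegrable g volume →
        IntervalIntegrable (fun t => bohrChar (-ξ) t • g t) volume (-R) R := fun g hg =>
      ((LocallyIntegrable.bohrChar_smul hg _).integrableOn_isCompact
        isCompact_uIcc).intervalIntegrable
    have h2 : ‖∫ t in (-R)..R, bohrChar (-ξ) t • (f t - P t)‖ ≤ 2 * δ * (2 * R) := by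
      rw [intervalIntegral.integral_of_le (by linarith)]
      refine (norm_integral_le_lintegral_norm _).trans ?_
      simp only [norm_bohrChar_smul, ofReal_norm]
      refine ENNReal.toReal_le_of_le_ofReal (by positivity) ?_
      rw [ENNReal.ofReal_mul (by positivity)]
      exact hR
    have h3 : ‖(2 * R)⁻¹ • ∫ t in (-R)..R, bohrChar (-ξ) t • (f t - P t)‖ ≤ 2 * δ := by
      rw [norm_smul, Real.norm_of_nonneg (by positivity)]
      calc (2 * R)⁻¹ * _ ≤ (2 * R)⁻¹ * (2 * δ * (2 * R)) := by gcongr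
        _ = 2 * δ := by field_simp
    simp only [smul_sub] at h3
    rw [intervalIntegral.integral_sub (hi _ hf.locallyIntegrable)
      (hi _ hP.continuous.locallyIntegrable), smul_sub] at h3
    refine (dist_triangle _ ((2 * R)⁻¹ • ∫ t in (-R)..R, bohrChar (-ξ) t • P t) _).trans_lt ?_
    rw [dist_eq_norm]
    linarith
  obtain ⟨N, hN⟩ := eventually_atTop.1 key
  refine ⟨N, fun m hm n hn => ?_⟩
  refine (dist_triangle_right _ _ a).trans_lt ?_
  have := hN m hm
  have := hN n hn
  rw [hδd] at *
  linarith

/-- No linearity is assumed, since the map of interest is complex conjugation, which is not complex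
linear. -/
theorem IsBohrAP.comp_isometry {f : ℝ → X} (hf : IsBohrAP f) {Z : Type*} [NormedAddCommGroup Z]
    [NormedSpace ℂ Z] (L : X → Z) (hL : ∀ x y, ‖L x - L y‖ = ‖x - y‖) :
    IsBohrAP fun t => L (f t) := by
  have hiso : Isometry L := Isometry.of_dist_eq fun x y => by
    rw [dist_eq_norm, dist_eq_norm, hL]
  refine ⟨hiso.continuous.comp hf.1, fun ε hε => ?_⟩
  simpa only [hL] using hf.2 ε hε

end AlmostPeriodicTheory


/-! ### Compactly supported functions on the plane -/

/-- Continuous functions with compact support. -/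
def IsCC (f : Plane → ℂ) : Prop := Continuous f ∧ HasCompactSupport f

/-- Smooth functions with compact support. -/
def IsSC (f : Plane → ℂ) : Prop := ContDiff ℝ ∞ f ∧ HasCompactSupport f

/-- The derivative in the direction `c`. -/
def dirDeriv (c : Plane) (f : Plane → ℂ) (x : Plane) : ℂ := fderiv ℝ f x c

/-- The norm of `L²(ℝ²)`. -/
def nrm (f : Plane → ℂ) : ℝ := (eLpNorm f 2 volume).toReal

theorem IsSC.isCC {f : Plane → ℂ} (hf : IsSC f) : IsCC f := ⟨hf.1.continuous, hf.2⟩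

theorem contDiff_dirDeriv {f : Plane → ℂ} (hf : ContDiff ℝ ∞ f) (c : Plane) :
    ContDiff ℝ ∞ (dirDeriv c f) := by
  have : ContDiff ℝ ∞ (fderiv ℝ f) := hf.fderiv_right (m := ∞) (by simp)
  exact this.clm_apply contDiff_const

theorem tsupport_dirDeriv_subset (c : Plane) (f : Plane → ℂ) :
    tsupport (dirDeriv c f) ⊆ tsupport f :=
  tsupport_fderiv_apply_subset ℝ c

theorem IsSC.dirDeriv {f : Plane → ℂ} (hf : IsSC f) (c : Plane) : IsSC (dirDeriv c f) :=
  ⟨contDiff_dirDeriv hf.1 c, hf.2.fderiv_apply (𝕜 := ℝ) c⟩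

theorem IsSC.differentiable {f : Plane → ℂ} (hf : IsSC f) : Differentiable ℝ f :=
  hf.1.differentiable (by simp)

theorem IsSC.add {f g : Plane → ℂ} (hf : IsSC f) (hg : IsSC g) : IsSC fun x => f x + g x :=
  ⟨hf.1.add hg.1, hf.2.add hg.2⟩

theorem IsSC.mul_left {f m : Plane → ℂ} (hf : IsSC f) (hm : ContDiff ℝ ∞ m) :
    IsSC fun x => m x * f x :=
  ⟨hm.mul hf.1, hf.2.mul_left⟩

theorem IsSC.sub {f g : Plane → ℂ} (hf : IsSC f) (hg : IsSC g) : IsSC fun x => f x - g x := by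
  have := hf.add (hg.mul_left (m := fun _ => -1) contDiff_const)
  simpa [sub_eq_add_neg] using this

theorem IsSC.conj {f : Plane → ℂ} (hf : IsSC f) : IsSC fun x => star (f x) := by
  refine ⟨Complex.conjCLE.contDiff.comp hf.1, ?_⟩
  exact hf.2.comp_left (g := fun z : ℂ => star z) (by simp)

theorem IsCC.add {f g : Plane → ℂ} (hf : IsCC f) (hg : IsCC g) : IsCC fun x => f x + g x :=
  ⟨hf.1.add hg.1, hf.2.add hg.2⟩

theorem IsCC.mul_left {f m : Plane → ℂ} (hf : IsCC f) (hm : Continuous m) :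
    IsCC fun x => m x * f x :=
  ⟨hm.mul hf.1, hf.2.mul_left⟩

theorem IsCC.conj {f : Plane → ℂ} (hf : IsCC f) : IsCC fun x => star (f x) :=
  ⟨hf.1.star, hf.2.comp_left (g := fun z : ℂ => star z) (by simp)⟩

theorem IsCC.memLp {f : Plane → ℂ} (hf : IsCC f) : MemLp f 2 volume :=
  hf.1.memLp_of_hasCompactSupport hf.2

theorem IsCC.integrable {f : Plane → ℂ} (hf : IsCC f) : Integrable f volume :=
  hf.1.integrable_of_hasCompactSupport hf.2

theorem IsCC.integrable_mul {f g : Plane → ℂ} (hf : IsCC f) (hg : Continuous g) :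
    Integrable (fun x => f x * g x) volume := by
  simpa only [mul_comm] using (hf.mul_left hg).integrable

theorem dirDeriv_mul {f g : Plane → ℂ} (hf : Differentiable ℝ f) (hg : Differentiable ℝ g)
    (c x : Plane) : dirDeriv c (fun x => f x * g x) x = dirDeriv c f x * g x + f x * dirDeriv c g x := by
  have := fderiv_mul (hf x) (hg x)
  unfold dirDeriv
  change (fderiv ℝ (f * g) x) c = _
  rw [this]
  simp
  ring

theorem dirDeriv_sub {f g : Plane → ℂ} (hf : Differentiable ℝ f) (hg : Differentiable ℝ g)
    (c x : Plane) : dirDeriv c (fun x => f x - g x) x = dirDeriv c f x - dirDeriv c g x := by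
  unfold dirDeriv
  rw [fderiv_fun_sub (hf x) (hg x)]
  rfl

theorem dirDeriv_add {f g : Plane → ℂ} (hf : Differentiable ℝ f) (hg : Differentiable ℝ g)
    (c x : Plane) : dirDeriv c (fun x => f x + g x) x = dirDeriv c f x + dirDeriv c g x := by
  unfold dirDeriv
  rw [fderiv_fun_add (hf x) (hg x)]
  rfl

theorem dirDeriv_conj {f : Plane → ℂ} (hf : Differentiable ℝ f) (c x : Plane) :
    dirDeriv c (fun x => star (f x)) x = star (dirDeriv c f x) := by
  have := (Complex.conjCLE.toContinuousLinearMap.hasFDerivAt.comp x (hf x).hasFDerivAt).fderiv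
  unfold dirDeriv
  change (fderiv ℝ (⇑Complex.conjCLE.toContinuousLinearMap ∘ f) x) c = _
  rw [this]
  simp

/-- Integration by parts. -/
theorem integral_dirDeriv_mul {f g : Plane → ℂ} (hf : IsSC f) (hg : ContDiff ℝ ∞ g) (c : Plane) :
    ∫ x, dirDeriv c f x * g x = -∫ x, f x * dirDeriv c g x := by
  have := integral_mul_fderiv_eq_neg_fderiv_mul_of_integrable (μ := (volume : Measure Plane))
    (f := f) (g := g) (v := c) ((hf.dirDeriv c).isCC.integrable_mul hg.continuous)
    (hf.isCC.integrable_mul (contDiff_dirDeriv hg c).continuous)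
    (hf.isCC.integrable_mul hg.continuous) (fun x _ => hf.differentiable x)
    (fun x _ => hg.differentiable (by simp) x)
  unfold dirDeriv
  rw [this, neg_neg]

theorem nrm_nonneg (f : Plane → ℂ) : 0 ≤ nrm f := ENNReal.toReal_nonneg

theorem nrm_add_le {f g : Plane → ℂ} (hf : IsCC f) (hg : IsCC g) :
    nrm (fun x => f x + g x) ≤ nrm f + nrm g := by
  unfold nrm
  rw [← ENNReal.toReal_add hf.memLp.eLpNorm_ne_top hg.memLp.eLpNorm_ne_top]
  refine ENNReal.toReal_mono (ENNReal.add_ne_top.2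
    ⟨hf.memLp.eLpNorm_ne_top, hg.memLp.eLpNorm_ne_top⟩) ?_
  exact eLpNorm_add_le hf.1.aestronglyMeasurable hg.1.aestronglyMeasurable (by norm_num)

theorem nrm_le_mul_of_le {f g : Plane → ℂ} (hg : IsCC g) {C : ℝ} (hC : 0 ≤ C)
    (h : ∀ x, ‖f x‖ ≤ C * ‖g x‖) : nrm f ≤ C * nrm g := by
  unfold nrm
  have := eLpNorm_le_mul_eLpNorm_of_ae_le_mul (μ := (volume : Measure Plane))
    (Eventually.of_forall h) 2
  refine (ENNReal.toReal_mono ?_ this).trans ?_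
  · exact ENNReal.mul_ne_top ENNReal.ofReal_ne_top hg.memLp.eLpNorm_ne_top
  · rw [ENNReal.toReal_mul, ENNReal.toReal_ofReal hC]

theorem nrm_mul_le {m g : Plane → ℂ} (hg : IsCC g) {C : ℝ} (hC : 0 ≤ C)
    (h : ∀ x, ‖m x‖ ≤ C) : nrm (fun x => m x * g x) ≤ C * nrm g :=
  nrm_le_mul_of_le hg hC fun x => by
    rw [norm_mul]; exact mul_le_mul_of_nonneg_right (h x) (norm_nonneg _)

theorem nrm_congr_norm {f g : Plane → ℂ} (h : ∀ x, ‖f x‖ = ‖g x‖) : nrm f = nrm g := by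
  unfold nrm
  rw [eLpNorm_congr_norm_ae (Eventually.of_forall h)]

theorem nrm_conj (f : Plane → ℂ) : nrm (fun x => star (f x)) = nrm f :=
  nrm_congr_norm fun _ => norm_star _

theorem nrm_sub_le {f g : Plane → ℂ} (hf : IsCC f) (hg : IsCC g) :
    nrm (fun x => f x - g x) ≤ nrm f + nrm g := by
  have h1 := nrm_add_le hf (hg.mul_left (m := fun _ => -1) continuous_const)
  have h2 : nrm (fun x => -1 * g x) = nrm g := nrm_congr_norm fun x => by simp
  rw [h2] at h1
  simpa [sub_eq_add_neg] using h1

theorem nrm_comp {f : Plane → ℂ} (hf : Continuous f) {T : Plane → Plane}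
    (hT : MeasurePreserving T volume volume) : nrm (fun x => f (T x)) = nrm f := by
  unfold nrm
  rw [← eLpNorm_comp_measurePreserving hf.aestronglyMeasurable hT]
  rfl

/-- Conjugating the first factor turns the bilinear pairing into an inner product of L². -/
theorem norm_integral_mul_le_of_memLp {μ : Measure Plane} {f g : Plane → ℂ} (hf : MemLp f 2 μ)
    (hg : MemLp g 2 μ) :
    ‖∫ x, f x * g x ∂μ‖ ≤ (eLpNorm f 2 μ).toReal * (eLpNorm g 2 μ).toReal := by
  have hs : MemLp (fun x => star (f x)) 2 μ := hf.star
  have h : ∫ x, f x * g x ∂μ = inner ℂ (hs.toLp _) (hg.toLp _) := by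
    rw [L2.inner_def]
    refine integral_congr_ae ?_
    filter_upwards [hs.coeFn_toLp, hg.coeFn_toLp] with x h1 h2
    rw [h1, h2]
    simp [mul_comm]
  rw [h]
  refine (norm_inner_le_norm _ _).trans ?_
  rw [Lp.norm_toLp, Lp.norm_toLp]
  have : eLpNorm (fun x => star (f x)) 2 μ = eLpNorm f 2 μ :=
    eLpNorm_congr_norm_ae (Eventually.of_forall fun x => norm_star _)
  rw [this]

theorem norm_integral_mul_le {f g : Plane → ℂ} (hf : IsCC f) (hg : IsCC g) :
    ‖∫ x, f x * g x‖ ≤ nrm f * nrm g :=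
  norm_integral_mul_le_of_memLp hf.memLp hg.memLp

theorem nrm_sq_eq_lintegral (f : Plane → ℂ) :
    eLpNorm f 2 volume ^ 2 = ∫⁻ x, ‖f x‖ₑ ^ 2 := by
  have := eLpNorm_nnreal_pow_eq_lintegral (μ := (volume : Measure Plane)) (f := f)
    (p := 2) (by norm_num)
  simpa using this

theorem integral_mul_conj {f : Plane → ℂ} (hf : IsCC f) :
    ∫ x, f x * star (f x) = ((nrm f ^ 2 : ℝ) : ℂ) := by
  have h1 : ∀ x, f x * star (f x) = ((‖f x‖ ^ 2 : ℝ) : ℂ) := by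
    intro x
    rw [Complex.star_def, Complex.mul_conj, Complex.normSq_eq_norm_sq]
  simp only [h1]
  rw [integral_complex_ofReal]
  congr 1
  unfold nrm
  rw [← ENNReal.toReal_pow, nrm_sq_eq_lintegral,
    integral_eq_lintegral_of_nonneg_ae (Eventually.of_forall fun x => by positivity)
      (by exact (hf.1.norm.pow 2).aestronglyMeasurable)]
  congr 1
  refine lintegral_congr fun x => ?_
  rw [ENNReal.ofReal_pow (norm_nonneg _), ofReal_norm]

/-! ### The gradient and an orthonormal frame -/

/-- The coordinate directions. -/
def stdDir (i : Fin 2) : Plane := EuclideanSpace.single i 1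

/-- The directions of the coordinates given by `e`. -/
def frame (e : Plane ≃ₗᵢ[ℝ] Plane) (i : Fin 2) : Plane := e.symm (stdDir i)

theorem plane_eq (x : Plane) : x = x 0 • stdDir 0 + x 1 • stdDir 1 := by
  ext i
  fin_cases i <;> simp [stdDir]

theorem norm_stdDir (i : Fin 2) : ‖stdDir i‖ = 1 := by simp [stdDir]

theorem norm_frame (e : Plane ≃ₗᵢ[ℝ] Plane) (i : Fin 2) : ‖frame e i‖ = 1 := by
  rw [frame, LinearIsometryEquiv.norm_map, norm_stdDir]

theorem eq_frame (e : Plane ≃ₗᵢ[ℝ] Plane) (x : Plane) :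
    x = (e x) 0 • frame e 0 + (e x) 1 • frame e 1 := by
  apply e.injective
  conv_lhs => rw [plane_eq (e x)]
  simp [frame]

theorem abs_coord_le (x : Plane) (i : Fin 2) : |x i| ≤ ‖x‖ := by
  have := PiLp.norm_apply_le x i
  simpa using this

theorem dirDeriv_eq_frame (e : Plane ≃ₗᵢ[ℝ] Plane) (c : Plane) (f : Plane → ℂ) (x : Plane) :
    dirDeriv c f x = ((e c) 0 : ℂ) * dirDeriv (frame e 0) f x
      + ((e c) 1 : ℂ) * dirDeriv (frame e 1) f x := by
  unfold dirDeriv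
  conv_lhs => rw [eq_frame e c]
  simp

/-- The trace of a bilinear form is the same in every orthonormal basis: the matrix with entries (e
(stdDir i)) j is orthogonal, and `c00`, `c11`, `c01` are the orthonormality relations of its
columns. This lets the Dirichlet form be computed in the directions adapted to a chart. -/
theorem frame_mul_sum (e : Plane ≃ₗᵢ[ℝ] Plane) (L M : Plane →L[ℝ] ℂ) :
    L (frame e 0) * M (frame e 0) + L (frame e 1) * M (frame e 1)
      = L (stdDir 0) * M (stdDir 0) + L (stdDir 1) * M (stdDir 1) := by
  have h : ∀ (N : Plane →L[ℝ] ℂ) i, N (stdDir i) = ((e (stdDir i)) 0 : ℂ) * N (frame e 0)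
      + ((e (stdDir i)) 1 : ℂ) * N (frame e 1) := by
    intro N i
    conv_lhs => rw [eq_frame e (stdDir i)]
    simp
  have o : ∀ j k : Fin 2, ((e (stdDir 0)) j * (e (stdDir 0)) k
      + (e (stdDir 1)) j * (e (stdDir 1)) k : ℝ) = (if j = k then 1 else 0 : ℝ) := by
    intro j k
    have h1 : ∀ i j : Fin 2, (e (stdDir i)) j = (frame e j) i := by
      intro i j
      have h2 : inner ℝ (stdDir j) (e (stdDir i)) = inner ℝ (frame e j) (stdDir i) := by
        rw [frame, ← e.inner_map_map (e.symm _), e.apply_symm_apply]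
      simpa [stdDir, EuclideanSpace.inner_single_left, EuclideanSpace.inner_single_right] using h2
    simp only [h1]
    have h3 : inner ℝ (frame e j) (frame e k) = inner ℝ (stdDir j) (stdDir k) := by
      rw [frame, frame, e.symm.inner_map_map]
    rw [PiLp.inner_apply, Fin.sum_univ_two] at h3
    simp only [stdDir, EuclideanSpace.inner_single_left, PiLp.single_apply] at h3
    simp only [RCLike.inner_apply, conj_trivial, one_mul] at h3
    rw [mul_comm (frame e j 0), mul_comm (frame e j 1), h3]
  have o00 := o 0 0
  have o11 := o 1 1
  have o01 := o 0 1
  simp only [↓reduceIte, Fin.isValue, zero_ne_one] at o00 o11 o01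
  have c00 : ((e (stdDir 0)) 0 : ℂ) * (e (stdDir 0)) 0 + (e (stdDir 1)) 0 * (e (stdDir 1)) 0 = 1 := by
    exact_mod_cast o00
  have c11 : ((e (stdDir 0)) 1 : ℂ) * (e (stdDir 0)) 1 + (e (stdDir 1)) 1 * (e (stdDir 1)) 1 = 1 := by
    exact_mod_cast o11
  have c01 : ((e (stdDir 0)) 0 : ℂ) * (e (stdDir 0)) 1 + (e (stdDir 1)) 0 * (e (stdDir 1)) 1 = 0 := by
    exact_mod_cast o01
  rw [h L 0, h L 1, h M 0, h M 1]
  linear_combination -(L (frame e 0) * M (frame e 0)) * c00 - (L (frame e 1) * M (frame e 1)) * c11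
    - (L (frame e 0) * M (frame e 1) + L (frame e 1) * M (frame e 0)) * c01

/-- The bilinear Dirichlet form. -/
def dirichlet (f g : Plane → ℂ) : ℂ :=
  ∫ x, (dirDeriv (stdDir 0) f x * dirDeriv (stdDir 0) g x
    + dirDeriv (stdDir 1) f x * dirDeriv (stdDir 1) g x)

theorem dirichlet_eq_frame (e : Plane ≃ₗᵢ[ℝ] Plane) (f g : Plane → ℂ) :
    dirichlet f g = ∫ x, (dirDeriv (frame e 0) f x * dirDeriv (frame e 0) g x
      + dirDeriv (frame e 1) f x * dirDeriv (frame e 1) g x) := by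
  unfold dirichlet
  congr 1
  ext x
  exact (frame_mul_sum e _ _).symm

/-- A norm of the gradient in `L²(ℝ²)`. -/
def gnrm (f : Plane → ℂ) : ℝ :=
  nrm (dirDeriv (stdDir 0) f) + nrm (dirDeriv (stdDir 1) f)

theorem gnrm_nonneg (f : Plane → ℂ) : 0 ≤ gnrm f := add_nonneg (nrm_nonneg _) (nrm_nonneg _)

theorem abs_le_one_of_norm {c : Plane} (e : Plane ≃ₗᵢ[ℝ] Plane) (hc : ‖c‖ = 1) (i : Fin 2) :
    ‖((e c) i : ℂ)‖ ≤ 1 := by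
  rw [Complex.norm_real, Real.norm_eq_abs]
  refine (abs_coord_le _ i).trans ?_
  rw [LinearIsometryEquiv.norm_map, hc]

theorem nrm_dirDeriv_le_frame (e : Plane ≃ₗᵢ[ℝ] Plane) {c : Plane} (hc : ‖c‖ = 1)
    {f : Plane → ℂ} (hf : IsSC f) :
    nrm (dirDeriv c f) ≤ nrm (dirDeriv (frame e 0) f) + nrm (dirDeriv (frame e 1) f) := by
  have h0 := (hf.dirDeriv (frame e 0)).isCC
  have h1 := (hf.dirDeriv (frame e 1)).isCC
  have h : dirDeriv c f = fun x => ((e c) 0 : ℂ) * dirDeriv (frame e 0) f x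
      + ((e c) 1 : ℂ) * dirDeriv (frame e 1) f x := by
    ext x; exact dirDeriv_eq_frame e c f x
  rw [h]
  refine (nrm_add_le (h0.mul_left (m := fun _ => ((e c) 0 : ℂ)) continuous_const)
    (h1.mul_left (m := fun _ => ((e c) 1 : ℂ)) continuous_const)).trans ?_
  refine add_le_add ?_ ?_
  · simpa using nrm_mul_le h0 zero_le_one fun _ => abs_le_one_of_norm e hc 0
  · simpa using nrm_mul_le h1 zero_le_one fun _ => abs_le_one_of_norm e hc 1

theorem nrm_dirDeriv_le_gnrm {c : Plane} (hc : ‖c‖ = 1) {f : Plane → ℂ} (hf : IsSC f) :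
    nrm (dirDeriv c f) ≤ gnrm f :=
  nrm_dirDeriv_le_frame (LinearIsometryEquiv.refl ℝ Plane) hc hf

theorem gnrm_le_frame (e : Plane ≃ₗᵢ[ℝ] Plane) {f : Plane → ℂ} (hf : IsSC f) :
    gnrm f ≤ 2 * (nrm (dirDeriv (frame e 0) f) + nrm (dirDeriv (frame e 1) f)) := by
  have h0 := nrm_dirDeriv_le_frame e (norm_stdDir 0) hf
  have h1 := nrm_dirDeriv_le_frame e (norm_stdDir 1) hf
  unfold gnrm
  linarith


/-! ### Shears along a graph -/

/-- The volume preserving flow which moves points parallel to the graph of `φ`, in the coordinates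
given by `e`. -/
def shear (e : Plane ≃ₗᵢ[ℝ] Plane) (φ : ℝ → ℝ) (h : ℝ) (x : Plane) : Plane :=
  x + h • frame e 0 + (φ ((e x) 0 + h) - φ ((e x) 0)) • frame e 1

section Shear

variable (e : Plane ≃ₗᵢ[ℝ] Plane) {φ : ℝ → ℝ}

theorem shear_coord_zero (h : ℝ) (x : Plane) : (e (shear e φ h x)) 0 = (e x) 0 + h := by
  simp [shear, frame, stdDir]

theorem shear_coord_one (h : ℝ) (x : Plane) :
    (e (shear e φ h x)) 1 = (e x) 1 + (φ ((e x) 0 + h) - φ ((e x) 0)) := by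
  simp [shear, frame, stdDir]

theorem plane_ext_frame {x y : Plane} (h0 : (e x) 0 = (e y) 0) (h1 : (e x) 1 = (e y) 1) : x = y := by
  rw [eq_frame e x, eq_frame e y, h0, h1]

theorem shear_shear (h k : ℝ) (x : Plane) :
    shear e φ h (shear e φ k x) = shear e φ (h + k) x := by
  apply plane_ext_frame e
  · simp only [shear_coord_zero]; ring
  · simp only [shear_coord_zero, shear_coord_one]
    rw [show (e x) 0 + (h + k) = (e x) 0 + k + h by ring]; ring

theorem shear_zero (x : Plane) : shear e φ 0 x = x := by simp [shear]

theorem shear_neg_shear (h : ℝ) (x : Plane) : shear e φ (-h) (shear e φ h x) = x := by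
  rw [shear_shear, neg_add_cancel, shear_zero]

theorem shear_shear_neg (h : ℝ) (x : Plane) : shear e φ h (shear e φ (-h) x) = x := by
  rw [shear_shear, add_neg_cancel, shear_zero]

theorem contDiff_coord (i : Fin 2) : ContDiff ℝ ∞ fun x : Plane => (e x) i := by
  have h1 : ContDiff ℝ ∞ fun x : Plane => e x := e.toContinuousLinearEquiv.contDiff
  exact (EuclideanSpace.proj (𝕜 := ℝ) i : Plane →L[ℝ] ℝ).contDiff.comp h1

theorem contDiff_shear (hφ : ContDiff ℝ ∞ φ) (h : ℝ) : ContDiff ℝ ∞ (shear e φ h) := by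
  have h0 := contDiff_coord e 0
  unfold shear
  exact (contDiff_id.add contDiff_const).add
    (((hφ.comp (h0.add contDiff_const)).sub (hφ.comp h0)).smul contDiff_const)

/-- Shears as homeomorphisms. -/
def shearHomeo (hφ : ContDiff ℝ ∞ φ) (h : ℝ) : Plane ≃ₜ Plane where
  toFun := shear e φ h
  invFun := shear e φ (-h)
  left_inv := shear_neg_shear e h
  right_inv := shear_shear_neg e h
  continuous_toFun := (contDiff_shear e hφ h).continuous
  continuous_invFun := (contDiff_shear e hφ (-h)).continuous

/-- In the coordinates (s, z) given by `e` the shear is a skew product: a translation in s followed,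
for each fixed s, by a translation in z. -/
theorem measurePreserving_shear (hφ : ContDiff ℝ ∞ φ) (h : ℝ) :
    MeasurePreserving (shear e φ h) volume volume := by
  have hp : MeasurePreserving
      (fun p : ℝ × ℝ => (p.1 + h, p.2 + (φ (p.1 + h) - φ p.1))) volume volume := by
    have hm : Measurable (Function.uncurry fun (s z : ℝ) => z + (φ (s + h) - φ s)) := by
      have := hφ.continuous.measurable
      unfold Function.uncurry
      fun_prop
    exact (measurePreserving_add_right volume h).skew_product hm
      (Eventually.of_forall fun s => (measurePreserving_add_right volume _).map_eq)
  let M : Plane ≃ᵐ ℝ × ℝ := (MeasurableEquiv.toLp 2 (Fin 2 → ℝ)).symm.trans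
    MeasurableEquiv.finTwoArrow
  have hM : MeasurePreserving M volume volume :=
    (EuclideanSpace.volume_preserving_symm_measurableEquiv_toLp (Fin 2)).trans
      (volume_preserving_finTwoArrow ℝ)
  have h3 := e.symm.measurePreserving.comp
    ((hM.symm M).comp (hp.comp (hM.comp e.measurePreserving)))
  have heq : shear e φ h = e.symm ∘ M.symm ∘
      (fun p : ℝ × ℝ => (p.1 + h, p.2 + (φ (p.1 + h) - φ p.1))) ∘ M ∘ e := ?_
  · rw [heq]; exact h3
  funext x
  change _ = e.symm (M.symm _)
  rw [← e.symm_apply_apply (shear e φ h x)]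
  congr 1
  rw [MeasurableEquiv.eq_symm_apply]
  have hMv : ∀ y : Plane, M y = (y 0, y 1) := fun y => rfl
  rw [hMv, shear_coord_zero, shear_coord_one]
  rfl

variable {e}

theorem integral_shear (hφ : ContDiff ℝ ∞ φ) (h : ℝ) (g : Plane → ℂ) :
    ∫ x, g (shear e φ h x) = ∫ x, g x :=
  (measurePreserving_shear e hφ h).integral_comp
    (shearHomeo e hφ h).measurableEmbedding g

theorem IsSC.shear {f : Plane → ℂ} (hf : IsSC f) (hφ : ContDiff ℝ ∞ φ) (h : ℝ) :
    IsSC fun x => f (shear e φ h x) :=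
  ⟨hf.1.comp (contDiff_shear e hφ h), hf.2.comp_homeomorph (shearHomeo e hφ h)⟩

theorem IsCC.shear {f : Plane → ℂ} (hf : IsCC f) (hφ : ContDiff ℝ ∞ φ) (h : ℝ) :
    IsCC fun x => f (shear e φ h x) :=
  ⟨hf.1.comp (contDiff_shear e hφ h).continuous, hf.2.comp_homeomorph (shearHomeo e hφ h)⟩

theorem nrm_shear {f : Plane → ℂ} (hf : Continuous f) (hφ : ContDiff ℝ ∞ φ) (h : ℝ) :
    nrm (fun x => f (_root_.shear e φ h x)) = nrm f :=
  nrm_comp hf (measurePreserving_shear e hφ h)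

theorem norm_shear_sub_le {M : ℝ} (hM : ∀ s t, |φ (s + t) - φ s| ≤ M * |t|) (h : ℝ) (x : Plane) :
    ‖shear e φ h x - x‖ ≤ (1 + M) * |h| := by
  have : shear e φ h x - x = h • frame e 0 + (φ ((e x) 0 + h) - φ ((e x) 0)) • frame e 1 := by
    unfold shear; abel
  rw [this]
  refine (norm_add_le _ _).trans ?_
  rw [norm_smul, norm_smul, norm_frame, norm_frame, Real.norm_eq_abs, Real.norm_eq_abs]
  linarith [hM ((e x) 0) h]

theorem hasFDerivAt_coord (i : Fin 2) (x : Plane) :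
    HasFDerivAt (fun x : Plane => (e x) i)
      ((EuclideanSpace.proj (𝕜 := ℝ) i : Plane →L[ℝ] ℝ).comp
        (e.toContinuousLinearEquiv : Plane →L[ℝ] Plane)) x :=
  ContinuousLinearMap.hasFDerivAt ((EuclideanSpace.proj (𝕜 := ℝ) i : Plane →L[ℝ] ℝ).comp
        (e.toContinuousLinearEquiv : Plane →L[ℝ] Plane))

theorem frame_coord (i j : Fin 2) : (e (frame e i)) j = if j = i then 1 else 0 := by
  simp [frame, stdDir, PiLp.single_apply]

theorem fderiv_shear (hφ : ContDiff ℝ ∞ φ) (h : ℝ) (x c : Plane) :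
    fderiv ℝ (shear e φ h) x c = c + ((deriv φ ((e x) 0 + h) - deriv φ ((e x) 0)) * (e c) 0) •
      frame e 1 := by
  have hd : Differentiable ℝ φ := hφ.differentiable (by simp)
  have h0 := hasFDerivAt_coord (e := e) 0 x
  have h1 := (hd ((e x) 0 + h)).hasDerivAt.comp_hasFDerivAt x (h0.add_const h)
  have h2 := (hd ((e x) 0)).hasDerivAt.comp_hasFDerivAt x h0
  have h3 := (((hasFDerivAt_id (𝕜 := ℝ) x).add_const (h • frame e 0)).add
    ((h1.sub h2).smul_const (frame e 1)))
  have h4 : fderiv ℝ (shear e φ h) x = _ := HasFDerivAt.fderiv h3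
  rw [h4]
  simp
  rw [← sub_mul]

theorem dirDeriv_shear {f : Plane → ℂ} (hf : Differentiable ℝ f) (hφ : ContDiff ℝ ∞ φ) (h : ℝ)
    (c x : Plane) : dirDeriv c (fun x => f (shear e φ h x)) x =
      dirDeriv c f (shear e φ h x) +
      ((deriv φ ((e x) 0 + h) - deriv φ ((e x) 0)) * (e c) 0 : ℝ) *
        dirDeriv (frame e 1) f (shear e φ h x) := by
  have hT : DifferentiableAt ℝ (shear e φ h) x := (contDiff_shear e hφ h).differentiable (by simp) x
  unfold dirDeriv
  have : fderiv ℝ (fun x => f (shear e φ h x)) x = (fderiv ℝ f (shear e φ h x)).comp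
      (fderiv ℝ (shear e φ h) x) := fderiv_comp x (hf _) hT
  rw [this, ContinuousLinearMap.comp_apply, fderiv_shear hφ, map_add, map_smul]
  simp

theorem dirDeriv_shear_zero {f : Plane → ℂ} (hf : Differentiable ℝ f) (hφ : ContDiff ℝ ∞ φ) (h : ℝ)
    (x : Plane) : dirDeriv (frame e 0) (fun x => f (shear e φ h x)) x =
      dirDeriv (frame e 0) f (shear e φ h x) +
      ((deriv φ ((e x) 0 + h) - deriv φ ((e x) 0) : ℝ) : ℂ) *
        dirDeriv (frame e 1) f (shear e φ h x) := by
  rw [dirDeriv_shear hf hφ, frame_coord]; simp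

theorem dirDeriv_shear_one {f : Plane → ℂ} (hf : Differentiable ℝ f) (hφ : ContDiff ℝ ∞ φ) (h : ℝ)
    (x : Plane) : dirDeriv (frame e 1) (fun x => f (shear e φ h x)) x =
      dirDeriv (frame e 1) f (shear e φ h x) := by
  rw [dirDeriv_shear hf hφ, frame_coord]; simp

/-- The derivative along the generator of the shears. -/
def tangDeriv (e : Plane ≃ₗᵢ[ℝ] Plane) (φ : ℝ → ℝ) (f : Plane → ℂ) (x : Plane) : ℂ :=
  dirDeriv (frame e 0) f x + ((deriv φ ((e x) 0) : ℝ) : ℂ) * dirDeriv (frame e 1) f x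

theorem contDiff_deriv_coord (hφ : ContDiff ℝ ∞ φ) :
    ContDiff ℝ ∞ fun x : Plane => ((deriv φ ((e x) 0) : ℝ) : ℂ) := by
  have h1 : ContDiff ℝ ∞ (deriv φ) := (contDiff_infty_iff_deriv.1 hφ).2
  exact Complex.ofRealCLM.contDiff.comp (h1.comp (contDiff_coord e 0))

theorem IsSC.tangDeriv {f : Plane → ℂ} (hf : IsSC f) (hφ : ContDiff ℝ ∞ φ) :
    IsSC (tangDeriv e φ f) :=
  (hf.dirDeriv _).add ((hf.dirDeriv _).mul_left (contDiff_deriv_coord hφ))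

theorem hasDerivAt_shear_param {f : Plane → ℂ} (hf : Differentiable ℝ f) (hφ : ContDiff ℝ ∞ φ)
    (x : Plane) (h : ℝ) :
    HasDerivAt (fun h => f (shear e φ h x)) (tangDeriv e φ f (shear e φ h x)) h := by
  have hd : Differentiable ℝ φ := hφ.differentiable (by simp)
  have h1 : HasDerivAt (fun h => shear e φ h x)
      (frame e 0 + deriv φ ((e x) 0 + h) • frame e 1) h := by
    have a1 : HasDerivAt (fun h : ℝ => φ ((e x) 0 + h)) (deriv φ ((e x) 0 + h)) h := by
      exact HasDerivAt.congr_deriv ((hd ((e x) 0 + h)).hasDerivAt.comp h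
        ((hasDerivAt_id h).const_add ((e x) 0))) (by simp)
    have a2 := (((hasDerivAt_id h).smul_const (frame e 0)).const_add x).add
      ((a1.sub_const (φ ((e x) 0))).smul_const (frame e 1))
    exact HasDerivAt.congr_deriv a2 (by simp)
  have h2 := (hf (shear e φ h x)).hasFDerivAt.comp_hasDerivAt h h1
  refine HasDerivAt.congr_deriv h2 ?_
  unfold tangDeriv dirDeriv
  rw [shear_coord_zero, map_add, map_smul]
  simp

theorem sq_lintegral_le {α : Type*} [MeasurableSpace α] (μ : Measure α) {g : α → ℝ≥0∞}
    (hg : AEMeasurable g μ) : (∫⁻ a, g a ∂μ) ^ 2 ≤ μ Set.univ * ∫⁻ a, g a ^ 2 ∂μ := by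
  have := ENNReal.lintegral_mul_le_Lp_mul_Lq μ Real.HolderConjugate.two_two
    (f := fun _ => 1) (g := g) aemeasurable_const hg
  simp only [Pi.mul_apply, one_mul, ENNReal.one_rpow, lintegral_const] at this
  calc (∫⁻ a, g a ∂μ) ^ 2
      ≤ (μ Set.univ ^ (1 / 2 : ℝ) * (∫⁻ a, g a ^ (2 : ℝ) ∂μ) ^ (1 / 2 : ℝ)) ^ 2 := by gcongr
    _ = _ := by
      rw [mul_pow, ← ENNReal.rpow_natCast, ← ENNReal.rpow_natCast, ← ENNReal.rpow_mul,
        ← ENNReal.rpow_mul]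
      simp

/-- The difference is the integral of `tangDeriv e φ f` along the orbit of x. Cauchy–Schwarz in the
shear parameter gives one factor |h|; after Tonelli and invariance of the measure under every shear,
integrating over the parameter gives the other. -/
theorem nrm_shear_sub_le {f : Plane → ℂ} (hf : IsSC f) (hφ : ContDiff ℝ ∞ φ) (h : ℝ) :
    nrm (fun x => f (shear e φ h x) - f x) ≤ |h| * nrm (tangDeriv e φ f) := by
  set g := tangDeriv e φ f
  have hg : IsSC g := hf.tangDeriv hφ
  have hcont : Continuous fun p : Plane × ℝ => g (shear e φ p.2 p.1) := by
    have hc : Continuous fun p : Plane × ℝ => (e p.1) 0 :=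
      (contDiff_coord e 0).continuous.comp continuous_fst
    have := hφ.continuous
    refine hg.1.continuous.comp ?_
    unfold shear
    fun_prop
  set I := Set.uIoc 0 h
  have hI : volume I = ENNReal.ofReal |h| := by simp [I, Real.volume_uIoc]
  have hpt : ∀ x, ‖f (shear e φ h x) - f x‖ₑ ^ 2 ≤
      ENNReal.ofReal |h| * ∫⁻ t in I, ‖g (shear e φ t x)‖ₑ ^ 2 := by
    intro x
    have hc : Continuous fun t => g (shear e φ t x) := hcont.comp (by fun_prop : Continuous fun t => (x, t))
    have h1 : ∫ t in (0 : ℝ)..h, g (shear e φ t x) = f (shear e φ h x) - f x := by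
      rw [intervalIntegral.integral_eq_sub_of_hasDerivAt
        (fun t _ => hasDerivAt_shear_param hf.differentiable hφ x t) (hc.intervalIntegrable _ _)]
      simp [shear_zero]
    have h2 : ‖f (shear e φ h x) - f x‖ₑ ≤ ∫⁻ t in I, ‖g (shear e φ t x)‖ₑ := by
      rw [← h1, ← ofReal_norm, intervalIntegral.norm_intervalIntegral_eq, ofReal_norm]
      exact enorm_integral_le_lintegral_enorm _
    calc _ ≤ (∫⁻ t in I, ‖g (shear e φ t x)‖ₑ) ^ 2 := by gcongr
      _ ≤ _ := by
        refine (sq_lintegral_le _ hc.enorm.measurable.aemeasurable).trans ?_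
        rw [Measure.restrict_apply_univ, hI]
  have hsq : eLpNorm (fun x => f (shear e φ h x) - f x) 2 volume ^ 2 ≤
      (ENNReal.ofReal |h| * eLpNorm g 2 volume) ^ 2 := by
    rw [nrm_sq_eq_lintegral, mul_pow, nrm_sq_eq_lintegral]
    calc _ ≤ ∫⁻ x, ENNReal.ofReal |h| * ∫⁻ t in I, ‖g (shear e φ t x)‖ₑ ^ 2 :=
          lintegral_mono hpt
      _ = ENNReal.ofReal |h| * ∫⁻ x, ∫⁻ t in I, ‖g (shear e φ t x)‖ₑ ^ 2 :=
          lintegral_const_mul' _ _ ENNReal.ofReal_ne_top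
      _ = ENNReal.ofReal |h| * ∫⁻ t in I, ∫⁻ x, ‖g (shear e φ t x)‖ₑ ^ 2 := by
          rw [lintegral_lintegral_swap]
          exact (hcont.enorm.measurable.pow_const 2).aemeasurable
      _ = ENNReal.ofReal |h| * ∫⁻ t in I, ∫⁻ x, ‖g x‖ₑ ^ 2 := by
          congr 2
          ext t
          exact (measurePreserving_shear e hφ t).lintegral_comp
            (hg.1.continuous.enorm.measurable.pow_const 2)
      _ = _ := by
          rw [setLIntegral_const, hI]; ring
  have h3 : eLpNorm (fun x => f (shear e φ h x) - f x) 2 volume ≤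
      ENNReal.ofReal |h| * eLpNorm g 2 volume := by
    rwa [ENNReal.pow_le_pow_left_iff two_ne_zero] at hsq
  unfold nrm
  refine (ENNReal.toReal_mono (ENNReal.mul_ne_top ENNReal.ofReal_ne_top
    hg.isCC.memLp.eLpNorm_ne_top) h3).trans ?_
  rw [ENNReal.toReal_mul, ENNReal.toReal_ofReal (abs_nonneg h)]

theorem nrm_tangDeriv_le {f : Plane → ℂ} (hf : IsSC f) (hφ : ContDiff ℝ ∞ φ) {M : ℝ} (hM0 : 0 ≤ M)
    (hM : ∀ s, |deriv φ s| ≤ M) : nrm (tangDeriv e φ f) ≤ (1 + M) * gnrm f := by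
  have h0 := (hf.dirDeriv (frame e 0)).isCC
  have h1 := (hf.dirDeriv (frame e 1)).isCC
  have hp := (contDiff_deriv_coord (e := e) hφ).continuous
  refine (nrm_add_le h0 (h1.mul_left hp)).trans ?_
  have e0 := nrm_dirDeriv_le_gnrm (norm_frame e 0) hf
  have e1 := nrm_dirDeriv_le_gnrm (norm_frame e 1) hf
  have e2 := nrm_mul_le (m := fun x => ((deriv φ ((e x) 0) : ℝ) : ℂ)) h1 hM0 (fun x => by
    rw [Complex.norm_real]; exact hM _)
  have := mul_le_mul_of_nonneg_left e1 hM0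
  linarith

end Shear


/-! ### Test functions and difference quotients -/

/-- Smooth functions whose support is a compact subset of `Ω`. -/
def IsTestOn (Ω : Set Plane) (f : Plane → ℂ) : Prop := IsSC f ∧ tsupport f ⊆ Ω

section TestFunctions

variable {Ω : Set Plane}

theorem IsTestOn.mul_left {f m : Plane → ℂ} (hf : IsTestOn Ω f) (hm : ContDiff ℝ ∞ m) :
    IsTestOn Ω fun x => m x * f x :=
  ⟨hf.1.mul_left hm, (tsupport_mul_subset_right (f := m) (g := f)).trans hf.2⟩

theorem IsTestOn.sub {f g : Plane → ℂ} (hf : IsTestOn Ω f) (hg : IsTestOn Ω g) :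
    IsTestOn Ω fun x => f x - g x :=
  ⟨hf.1.sub hg.1, (tsupport_sub f g).trans (Set.union_subset hf.2 hg.2)⟩

theorem IsTestOn.conj {f : Plane → ℂ} (hf : IsTestOn Ω f) : IsTestOn Ω fun x => star (f x) := by
  refine ⟨hf.1.conj, subset_trans ?_ hf.2⟩
  exact closure_mono fun x hx => by simpa using hx

theorem IsTestOn.dirDeriv {f : Plane → ℂ} (hf : IsTestOn Ω f) (c : Plane) :
    IsTestOn Ω (dirDeriv c f) :=
  ⟨hf.1.dirDeriv c, (tsupport_dirDeriv_subset c f).trans hf.2⟩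

theorem gnrm_sub_le {f g : Plane → ℂ} (hf : IsSC f) (hg : IsSC g) :
    gnrm (fun x => f x - g x) ≤ gnrm f + gnrm g := by
  have h : ∀ c, nrm (dirDeriv c fun x => f x - g x) ≤ nrm (dirDeriv c f) + nrm (dirDeriv c g) := by
    intro c
    rw [show dirDeriv c (fun x => f x - g x) = fun x => dirDeriv c f x - dirDeriv c g x from
      funext (dirDeriv_sub hf.differentiable hg.differentiable c)]
    exact nrm_sub_le (hf.dirDeriv c).isCC (hg.dirDeriv c).isCC
  unfold gnrm
  linarith [h (stdDir 0), h (stdDir 1)]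

theorem gnrm_conj {f : Plane → ℂ} (hf : IsSC f) : gnrm (fun x => star (f x)) = gnrm f := by
  have h : ∀ c, nrm (dirDeriv c fun x => star (f x)) = nrm (dirDeriv c f) := fun c =>
    nrm_congr_norm fun x => by rw [dirDeriv_conj hf.differentiable, norm_star]
  unfold gnrm
  rw [h, h]

variable {e : Plane ≃ₗᵢ[ℝ] Plane} {φ : ℝ → ℝ}

/-- By the chain rule a shear adds a multiple of the derivative along `frame e 1`, with coefficient
at most |φ'(s + h) - φ'(s)| ≤ 2M. The outer factor 2 counts the two coordinate directions. -/
theorem gnrm_shear_le {f : Plane → ℂ} (hf : IsSC f) (hφ : ContDiff ℝ ∞ φ) {M : ℝ}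
    (hM : ∀ s, |deriv φ s| ≤ M) (h : ℝ) :
    gnrm (fun x => f (shear e φ h x)) ≤ 2 * (1 + 2 * M) * gnrm f := by
  have hM0 : 0 ≤ M := (abs_nonneg _).trans (hM 0)
  have key : ∀ c : Plane, ‖c‖ = 1 →
      nrm (dirDeriv c fun x => f (shear e φ h x)) ≤ (1 + 2 * M) * gnrm f := by
    intro c hc
    have h0 := ((hf.dirDeriv c).isCC).shear (e := e) hφ h
    have h1 := ((hf.dirDeriv (frame e 1)).isCC).shear (e := e) hφ h
    have hp := (contDiff_deriv_coord (e := e) hφ)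
    set m : Plane → ℂ := fun x =>
      ((deriv φ ((e x) 0 + h) - deriv φ ((e x) 0)) * (e c) 0 : ℝ) with hm
    have hmc : Continuous m := by
      have h2 := (contDiff_coord e 0).continuous
      have h3 : Continuous (deriv φ) := (contDiff_infty_iff_deriv.1 hφ).2.continuous
      fun_prop
    have hmb : ∀ x, ‖m x‖ ≤ 2 * M := by
      intro x
      rw [hm, Complex.norm_real, norm_mul]
      have h1 : ‖(e c) 0‖ ≤ 1 := by
        have := abs_le_one_of_norm e hc 0
        rwa [Complex.norm_real] at this
      have h2 : ‖deriv φ ((e x) 0 + h) - deriv φ ((e x) 0)‖ ≤ 2 * M := by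
        refine (norm_sub_le _ _).trans ?_
        have a := hM ((e x) 0 + h)
        have b := hM ((e x) 0)
        rw [Real.norm_eq_abs, Real.norm_eq_abs]
        linarith
      calc _ ≤ 2 * M * 1 := mul_le_mul h2 h1 (norm_nonneg _) (by positivity)
        _ = _ := mul_one _
    rw [show dirDeriv c (fun x => f (shear e φ h x)) = fun x => dirDeriv c f (shear e φ h x) +
      m x * dirDeriv (frame e 1) f (shear e φ h x) from
      funext (dirDeriv_shear hf.differentiable hφ h c)]
    refine (nrm_add_le h0 (h1.mul_left hmc)).trans ?_
    have e1 := nrm_mul_le h1 (by positivity) hmb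
    rw [nrm_shear (hf.dirDeriv _).1.continuous hφ] at e1 ⊢
    have e2 := nrm_dirDeriv_le_gnrm hc hf
    have e3 := nrm_dirDeriv_le_gnrm (norm_frame e 1) hf
    have := mul_le_mul_of_nonneg_left e3 (by positivity : 0 ≤ 2 * M)
    linarith
  have := key _ (norm_stdDir 0)
  have := key _ (norm_stdDir 1)
  rw [gnrm]
  linarith

/-- The energy identity behind the method of difference quotients. -/
theorem dirichlet_difference {v : Plane → ℂ} (hv : IsSC v) (hφ : ContDiff ℝ ∞ φ) (h : ℝ)
    {w : Plane → ℂ} (hw : w = fun x => v (shear e φ h x) - v x) :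
    dirichlet v (fun x => star (w (shear e φ (-h) x) - w x)) =
      ((nrm (dirDeriv (frame e 0) w) ^ 2 : ℝ) : ℂ) + ((nrm (dirDeriv (frame e 1) w) ^ 2 : ℝ) : ℂ)
      - (∫ x, (((deriv φ ((e x) 0 + h) - deriv φ ((e x) 0) : ℝ) : ℂ) *
          dirDeriv (frame e 1) v (shear e φ h x)) * star (dirDeriv (frame e 0) w x))
      - (∫ x, (((deriv φ ((e x) 0 + h) - deriv φ ((e x) 0) : ℝ) : ℂ) *
          dirDeriv (frame e 0) v (shear e φ h x)) * star (dirDeriv (frame e 1) w x)) := by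
  have hws : IsSC w := by rw [hw]; exact (hv.shear hφ h).sub hv
  have hp := (contDiff_infty_iff_deriv.1 hφ).2.continuous
  have hc := (contDiff_coord e 0).continuous
  set k : ℝ → Plane → ℂ := fun t x => ((deriv φ ((e x) 0 + t) - deriv φ ((e x) 0) : ℝ) : ℂ) with hk
  have hkc : ∀ t, Continuous (k t) := fun t => by rw [hk]; fun_prop
  set va := dirDeriv (frame e 0) v
  set vb := dirDeriv (frame e 1) v
  set wa := dirDeriv (frame e 0) w
  set wb := dirDeriv (frame e 1) w
  have hva : IsCC va := (hv.dirDeriv _).isCC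
  have hvb : IsCC vb := (hv.dirDeriv _).isCC
  have hwa : IsCC wa := (hws.dirDeriv _).isCC
  have hwb : IsCC wb := (hws.dirDeriv _).isCC
  have ewa : ∀ x, wa x = va (shear e φ h x) + k h x * vb (shear e φ h x) - va x := by
    intro x
    simp only [wa, hw]
    rw [dirDeriv_sub (hv.shear hφ h).differentiable hv.differentiable,
      dirDeriv_shear_zero hv.differentiable hφ]
  have ewb : ∀ x, wb x = vb (shear e φ h x) - vb x := by
    intro x
    simp only [wb, hw]
    rw [dirDeriv_sub (hv.shear hφ h).differentiable hv.differentiable,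
      dirDeriv_shear_one hv.differentiable hφ]
  have hkk : ∀ x, k (-h) (shear e φ h x) = - k h x := by
    intro x
    simp only [hk, shear_coord_zero]
    rw [show (e x) 0 + h + -h = (e x) 0 by ring]; push_cast; ring
  have hks : ∀ t x, star (k t x) = k t x := fun t x => by
    simp only [hk]; exact Complex.conj_ofReal _
  set I1 : Plane → ℂ := fun x => va x * star (wa (shear e φ (-h) x) +
    k (-h) x * wb (shear e φ (-h) x)) + vb x * star (wb (shear e φ (-h) x)) with hI1
  set I2 : Plane → ℂ := fun x => va x * star (wa x) + vb x * star (wb x) with hI2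
  have e1 : dirichlet v (fun x => star (w (shear e φ (-h) x) - w x)) = ∫ x, (I1 x - I2 x) := by
    rw [dirichlet_eq_frame e]
    congr 1
    ext x
    have hsd : Differentiable ℝ fun x => w (shear e φ (-h) x) := (hws.shear hφ _).differentiable
    rw [dirDeriv_conj (hsd.fun_sub hws.differentiable), dirDeriv_conj (hsd.fun_sub hws.differentiable),
      dirDeriv_sub hsd hws.differentiable, dirDeriv_sub hsd hws.differentiable,
      dirDeriv_shear_zero hws.differentiable hφ, dirDeriv_shear_one hws.differentiable hφ]
    simp only [hI1, hI2, star_sub, star_add]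
    ring
  have cwaT := (hwa.shear (e := e) hφ (-h))
  have cwbT := (hwb.shear (e := e) hφ (-h))
  have iI1 : Integrable I1 := by
    refine (hva.integrable_mul ?_).add (hvb.integrable_mul cwbT.1.star)
    exact (cwaT.1.add ((hkc _).mul cwbT.1)).star
  have iI2 : Integrable I2 := (hva.integrable_mul hwa.1.star).add (hvb.integrable_mul hwb.1.star)
  -- Only `I1` is transported by the shear. This moves the difference from the second factor onto
  -- the derivatives of v, producing those of w up to the terms with `k`, which come from the shear
  -- failing to commute with differentiation.
  rw [e1, integral_sub iI1 iI2, ← integral_shear (e := e) hφ h I1]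
  have cvaT := (hva.shear (e := e) hφ h)
  have cvbT := (hvb.shear (e := e) hφ h)
  have j1 := hwa.integrable_mul hwa.1.star
  have j2 := hwb.integrable_mul hwb.1.star
  have j3 := (cvbT.mul_left (hkc h)).integrable_mul hwa.1.star
  have j4 := (cvaT.mul_left (hkc h)).integrable_mul hwb.1.star
  rw [← integral_mul_conj hwa, ← integral_mul_conj hwb, ← integral_add j1 j2,
    ← integral_sub (f := fun x => wa x * star (wa x) + wb x * star (wb x)) (j1.add j2) j3,
    ← integral_sub (f := fun x => wa x * star (wa x) + wb x * star (wb x) -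
      k h x * vb (shear e φ h x) * star (wa x)) ((j1.add j2).sub j3) j4, ← integral_sub _ iI2]
  · congr 1
    ext x
    simp only [hI1, hI2, shear_neg_shear, hkk, star_add, star_mul', hks]
    have a1 := ewa x
    have a2 := ewb x
    rw [show va (shear e φ h x) = wa x - k h x * vb (shear e φ h x) + va x by rw [a1]; ring]
    rw [show vb (shear e φ h x) = wb x + vb x by rw [a2]; ring]
    ring
  · exact (measurePreserving_shear e hφ h).integrable_comp_of_integrable iI1

/-- Bounds for the graph function of a chart. -/
structure GraphBound (φ : ℝ → ℝ) (M : ℝ) : Prop where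
  smooth : ContDiff ℝ ∞ φ
  bound : ∀ s, |deriv φ s| ≤ M
  bound_deriv : ∀ s, |deriv (deriv φ) s| ≤ M

theorem GraphBound.nonneg {M : ℝ} (hφ : GraphBound φ M) : 0 ≤ M := (abs_nonneg _).trans (hφ.bound 0)

theorem abs_sub_le_of_deriv {f : ℝ → ℝ} {M : ℝ} (hf : Differentiable ℝ f)
    (h : ∀ s, |deriv f s| ≤ M) (s t : ℝ) : |f (s + t) - f s| ≤ M * |t| := by
  have := Convex.norm_image_sub_le_of_norm_deriv_le (𝕜 := ℝ) (f := f) (s := Set.univ) (C := M)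
    (fun x _ => hf x) (fun x _ => h x) convex_univ (Set.mem_univ s) (Set.mem_univ (s + t))
  simpa using this

theorem GraphBound.lip {M : ℝ} (hφ : GraphBound φ M) (s t : ℝ) : |φ (s + t) - φ s| ≤ M * |t| :=
  abs_sub_le_of_deriv (hφ.smooth.differentiable (by simp)) hφ.bound s t

theorem GraphBound.lip_deriv {M : ℝ} (hφ : GraphBound φ M) (s t : ℝ) :
    |deriv φ (s + t) - deriv φ s| ≤ M * |t| :=
  abs_sub_le_of_deriv ((contDiff_infty_iff_deriv.1 hφ.smooth).2.differentiable (by simp))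
    hφ.bound_deriv s t

/-- The test function `ψ` is a second difference of v, that is, a difference of w, so its L² norm is
O(|h|) times the gradient norm of w, while its gradient norm is comparable to that of w. The
commutator terms carry the factor M|h| because φ' is Lipschitz. The energy identity thus bounds the
square of the gradient norm of w by that norm times O(|h|) + O(ε). -/
theorem gnrm_difference_le {M : ℝ} (hφ : GraphBound φ M) {v : Plane → ℂ} (hv : IsSC v) (h : ℝ)
    {w : Plane → ℂ} (hw : w = fun x => v (shear e φ h x) - v x) {A ε : ℝ} (hA : 0 ≤ A) (hε : 0 ≤ ε)
    (hQ : ∀ ψ, ψ = (fun x => star (w (shear e φ (-h) x) - w x)) →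
      ‖dirichlet v ψ‖ ≤ A * nrm ψ + ε * gnrm ψ) :
    gnrm w ≤ 32 * (1 + M) * (|h| * (A + gnrm v) + ε) := by
  have hM0 := hφ.nonneg
  have hws : IsSC w := by rw [hw]; exact (hv.shear hφ.smooth h).sub hv
  have hp := (contDiff_infty_iff_deriv.1 hφ.smooth).2.continuous
  have hc := (contDiff_coord e 0).continuous
  set k : Plane → ℂ := fun x => ((deriv φ ((e x) 0 + h) - deriv φ ((e x) 0) : ℝ) : ℂ) with hk
  have hkc : Continuous k := by rw [hk]; fun_prop
  have hkb : ∀ x, ‖k x‖ ≤ M * |h| := fun x => by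
    rw [hk, Complex.norm_real]; exact hφ.lip_deriv _ _
  set ψ : Plane → ℂ := fun x => star (w (shear e φ (-h) x) - w x) with hψ
  have id := dirichlet_difference hv hφ.smooth h hw
  rw [← hψ] at id
  have q := hQ ψ rfl
  set na := nrm (dirDeriv (frame e 0) w)
  set nb := nrm (dirDeriv (frame e 1) w)
  have hna : 0 ≤ na := nrm_nonneg _
  have hnb : 0 ≤ nb := nrm_nonneg _
  have hgv := gnrm_nonneg v
  have cross : ∀ i j : Fin 2, ‖∫ x, (k x * dirDeriv (frame e i) v (shear e φ h x)) *
      star (dirDeriv (frame e j) w x)‖ ≤ M * |h| * gnrm v * nrm (dirDeriv (frame e j) w) := by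
    intro i j
    have c1 := ((hv.dirDeriv (frame e i)).isCC).shear (e := e) hφ.smooth h
    refine (norm_integral_mul_le (c1.mul_left hkc) (hws.dirDeriv _).isCC.conj).trans ?_
    rw [nrm_conj]
    refine mul_le_mul_of_nonneg_right ?_ (nrm_nonneg _)
    refine (nrm_mul_le c1 (by positivity) hkb).trans ?_
    rw [nrm_shear (hv.dirDeriv _).1.continuous hφ.smooth]
    exact mul_le_mul_of_nonneg_left (nrm_dirDeriv_le_gnrm (norm_frame e i) hv) (by positivity)
  have c10 := cross 1 0
  have c01 := cross 0 1
  have nψ : nrm ψ ≤ |h| * ((1 + M) * gnrm w) := by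
    rw [hψ, nrm_conj]
    refine (nrm_shear_sub_le hws hφ.smooth (-h)).trans ?_
    rw [abs_neg]
    exact mul_le_mul_of_nonneg_left (nrm_tangDeriv_le hws hφ.smooth hM0 hφ.bound) (abs_nonneg _)
  have gψ : gnrm ψ ≤ (3 + 4 * M) * gnrm w := by
    have hsT := hws.shear (e := e) hφ.smooth (-h)
    rw [hψ, gnrm_conj (hsT.sub hws)]
    refine (gnrm_sub_le hsT hws).trans ?_
    have := gnrm_shear_le (e := e) hws hφ.smooth hφ.bound (-h)
    linarith
  have hsq : na ^ 2 + nb ^ 2 ≤ A * nrm ψ + ε * gnrm ψ + M * |h| * gnrm v * (na + nb) := by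
    have e1 : ((na ^ 2 + nb ^ 2 : ℝ) : ℂ) = dirichlet v ψ
        + (∫ x, (k x * dirDeriv (frame e 1) v (shear e φ h x)) * star (dirDeriv (frame e 0) w x))
        + ∫ x, (k x * dirDeriv (frame e 0) v (shear e φ h x)) * star (dirDeriv (frame e 1) w x) := by
      rw [id]; simp only [hk]; push_cast; ring
    have e2 : ‖((na ^ 2 + nb ^ 2 : ℝ) : ℂ)‖ = na ^ 2 + nb ^ 2 := by
      rw [Complex.norm_real, Real.norm_of_nonneg (by positivity)]
    rw [← e2, e1]
    refine (norm_add₃_le).trans ?_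
    linarith
  have hgw : gnrm w ≤ 2 * (na + nb) := gnrm_le_frame e hws
  have hgw0 := gnrm_nonneg w
  set S := M * |h| * gnrm v + A * |h| * (1 + M) * 2 + ε * (3 + 4 * M) * 2
  have hS : 0 ≤ S := by positivity
  have hG : (na + nb) * (na + nb) ≤ 2 * S * (na + nb) := by
    have h1 : A * nrm ψ ≤ A * (|h| * ((1 + M) * (2 * (na + nb)))) := by
      refine mul_le_mul_of_nonneg_left (nψ.trans ?_) hA
      gcongr
    have h2 : ε * gnrm ψ ≤ ε * ((3 + 4 * M) * (2 * (na + nb))) := by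
      refine mul_le_mul_of_nonneg_left (gψ.trans ?_) hε
      gcongr
    have h3 : (na + nb) * (na + nb) ≤ 2 * (na ^ 2 + nb ^ 2) := by nlinarith [sq_nonneg (na - nb)]
    have h4 : na ^ 2 + nb ^ 2 ≤ S * (na + nb) := by
      refine hsq.trans ?_
      simp only [S]
      nlinarith
    linarith
  -- Cancels one factor na + nb; arguing by contradiction disposes of the case where it is zero.
  have hG' : na + nb ≤ 2 * S := by
    by_contra hcon
    push Not at hcon
    have : 0 < na + nb := lt_of_le_of_lt (by positivity) hcon
    have := mul_lt_mul_of_pos_right hcon this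
    linarith
  have hfin : 4 * S ≤ 32 * (1 + M) * (|h| * (A + gnrm v) + ε) := by
    simp only [S]
    have h1 : 0 ≤ |h| * gnrm v := by positivity
    have h2 : 0 ≤ A * |h| := by positivity
    have h3 : 0 ≤ M * (|h| * gnrm v) := by positivity
    have h4 : 0 ≤ M * (A * |h|) := by positivity
    have h5 : 0 ≤ M * ε := by positivity
    nlinarith
  linarith

end TestFunctions


/-! ### Localization -/

/-- A cutoff function together with a bound for its derivatives. -/
structure CutoffBound (ζ : Plane → ℂ) (Z : ℝ) : Prop where
  smooth : IsSC ζ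
  bound : ∀ x, ‖ζ x‖ ≤ Z
  bound_deriv : ∀ i x, ‖dirDeriv (stdDir i) ζ x‖ ≤ Z
  bound_deriv₂ : ∀ i x, ‖dirDeriv (stdDir i) (dirDeriv (stdDir i) ζ) x‖ ≤ Z

theorem CutoffBound.nonneg {ζ : Plane → ℂ} {Z : ℝ} (hζ : CutoffBound ζ Z) : 0 ≤ Z :=
  (norm_nonneg _).trans (hζ.bound 0)

theorem IsCC.exists_bound {f : Plane → ℂ} (hf : IsCC f) : ∃ C, ∀ x, ‖f x‖ ≤ C :=
  hf.1.bounded_above_of_compact_support hf.2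

theorem IsSC.exists_cutoffBound {ζ : Plane → ℂ} (hζ : IsSC ζ) : ∃ Z, CutoffBound ζ Z := by
  obtain ⟨a, ha⟩ := hζ.isCC.exists_bound
  choose b hb using fun i => (hζ.dirDeriv (stdDir i)).isCC.exists_bound
  choose c hc using fun i => ((hζ.dirDeriv (stdDir i)).dirDeriv (stdDir i)).isCC.exists_bound
  have hb0 : ∀ i, 0 ≤ b i := fun i => (norm_nonneg _).trans (hb i 0)
  have hc0 : ∀ i, 0 ≤ c i := fun i => (norm_nonneg _).trans (hc i 0)
  have ha0 : 0 ≤ a := (norm_nonneg _).trans (ha 0)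
  have hbs : ∀ i, b i ≤ ∑ j, b j := fun i =>
    Finset.single_le_sum (fun j _ => hb0 j) (Finset.mem_univ i)
  have hcs : ∀ i, c i ≤ ∑ j, c j := fun i =>
    Finset.single_le_sum (fun j _ => hc0 j) (Finset.mem_univ i)
  have hB : 0 ≤ ∑ j, b j := Finset.sum_nonneg fun j _ => hb0 j
  have hC : 0 ≤ ∑ j, c j := Finset.sum_nonneg fun j _ => hc0 j
  refine ⟨a + ∑ j, b j + ∑ j, c j, hζ, fun x => (ha x).trans ?_,
    fun i x => (hb i x).trans ?_, fun i x => (hc i x).trans ?_⟩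
  · linarith
  · linarith [hbs i]
  · linarith [hcs i]

variable {Ω : Set Plane} {e : Plane ≃ₗᵢ[ℝ] Plane} {φ : ℝ → ℝ}

/-- The commutator of the cutoff with the Dirichlet form is u∇ζ·∇ψ - ψ∇u·∇ζ. Integrating its first
term by parts leaves only terms without derivatives of ψ, namely -(uΔζ + 2∇ζ·∇u)ψ, which are bounded
by the L² norm of ψ. -/
theorem dirichlet_localize {ζ u ψ : Plane → ℂ} (hζ : IsSC ζ) (hu : IsSC u) (hψ : IsSC ψ) :
    dirichlet (fun x => ζ x * u x) ψ = dirichlet u (fun x => ζ x * ψ x) -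
      ∑ i, ∫ x, (dirDeriv (stdDir i) (dirDeriv (stdDir i) ζ) x * u x
        + 2 * (dirDeriv (stdDir i) ζ x * dirDeriv (stdDir i) u x)) * ψ x := by
  have key : ∀ c, ∫ x, dirDeriv c (fun x => ζ x * u x) x * dirDeriv c ψ x =
      (∫ x, dirDeriv c u x * dirDeriv c (fun x => ζ x * ψ x) x) -
      ∫ x, (dirDeriv c (dirDeriv c ζ) x * u x + 2 * (dirDeriv c ζ x * dirDeriv c u x)) * ψ x := by
    intro c
    have hz := hζ.dirDeriv c
    have hzz := hz.dirDeriv c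
    have hdu := hu.dirDeriv c
    have hdψ := hψ.dirDeriv c
    have s1 : IsSC fun x => ζ x * ψ x := hψ.mul_left hζ.1
    have s2 : IsSC fun x => ζ x * u x := hu.mul_left hζ.1
    have i1 := (s2.dirDeriv c).isCC.integrable_mul hdψ.1.continuous
    have i2 := hdu.isCC.integrable_mul (s1.dirDeriv c).1.continuous
    have i3 := ((hu.mul_left hzz.1).add ((hdu.mul_left hz.1).mul_left
      (m := fun _ => 2) contDiff_const)).isCC.integrable_mul hψ.1.continuous
    have ibp := integral_dirDeriv_mul (hu.mul_left hz.1) hψ.1 c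
    rw [← integral_sub i2 i3]
    have i4 : Integrable fun x => dirDeriv c ζ x * u x * dirDeriv c ψ x :=
      (hu.mul_left hz.1).isCC.integrable_mul hdψ.1.continuous
    have i5 : Integrable fun x => dirDeriv c (fun x => dirDeriv c ζ x * u x) x * ψ x :=
      ((hu.mul_left hz.1).dirDeriv c).isCC.integrable_mul hψ.1.continuous
    -- The integral of a total derivative. Subtracting it makes the claimed equality of integrals
    -- hold pointwise.
    have : ∫ x, (dirDeriv c ζ x * u x * dirDeriv c ψ x +
        dirDeriv c (fun x => dirDeriv c ζ x * u x) x * ψ x) = 0 := by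
      rw [integral_add i4 i5, ibp]; ring
    rw [← sub_zero (∫ x, dirDeriv c (fun x => ζ x * u x) x * dirDeriv c ψ x), ← this,
      ← integral_sub (g := fun x => dirDeriv c ζ x * u x * dirDeriv c ψ x +
        dirDeriv c (fun x => dirDeriv c ζ x * u x) x * ψ x) i1 (i4.add i5)]
    congr 1
    ext x
    rw [dirDeriv_mul hζ.differentiable hu.differentiable,
      dirDeriv_mul hζ.differentiable hψ.differentiable,
      dirDeriv_mul hz.differentiable hu.differentiable]
    ring
  have split : ∀ f g : Plane → ℂ, IsSC f → IsSC g → dirichlet f g =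
      ∑ i, ∫ x, dirDeriv (stdDir i) f x * dirDeriv (stdDir i) g x := by
    intro f g hf hg
    unfold dirichlet
    rw [Fin.sum_univ_two, integral_add]
    · exact (hf.dirDeriv _).isCC.integrable_mul (hg.dirDeriv _).1.continuous
    · exact (hf.dirDeriv _).isCC.integrable_mul (hg.dirDeriv _).1.continuous
  rw [split _ _ (hu.mul_left hζ.1) hψ, split _ _ hu (hψ.mul_left hζ.1), ← Finset.sum_sub_distrib]
  exact Finset.sum_congr rfl fun i _ => key _

theorem gnrm_cutoff_le {ζ u : Plane → ℂ} {Z : ℝ} (hζ : CutoffBound ζ Z) (hu : IsSC u) :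
    gnrm (fun x => ζ x * u x) ≤ Z * gnrm u + 2 * Z * nrm u := by
  have key : ∀ i, nrm (dirDeriv (stdDir i) fun x => ζ x * u x) ≤
      Z * nrm (dirDeriv (stdDir i) u) + Z * nrm u := by
    intro i
    rw [show dirDeriv (stdDir i) (fun x => ζ x * u x) = fun x =>
      dirDeriv (stdDir i) ζ x * u x + ζ x * dirDeriv (stdDir i) u x from
      funext (dirDeriv_mul hζ.smooth.differentiable hu.differentiable _)]
    have hz := hζ.smooth.dirDeriv (stdDir i)
    have hd := hu.dirDeriv (stdDir i)
    refine (nrm_add_le (hu.isCC.mul_left hz.1.continuous)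
      (hd.isCC.mul_left hζ.smooth.1.continuous)).trans ?_
    have a := nrm_mul_le hu.isCC hζ.nonneg (hζ.bound_deriv i)
    have b := nrm_mul_le hd.isCC hζ.nonneg hζ.bound
    linarith
  have := key 0
  have := key 1
  unfold gnrm
  linarith

theorem norm_dirichlet_localize_le {ζ u ψ : Plane → ℂ} {Z A ε : ℝ} (hζ : CutoffBound ζ Z)
    (hA : 0 ≤ A) (hε : 0 ≤ ε) (hu : IsSC u) (hψ : IsSC ψ)
    (h : ‖dirichlet u (fun x => ζ x * ψ x)‖ ≤
      A * nrm (fun x => ζ x * ψ x) + ε * gnrm (fun x => ζ x * ψ x)) :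
    ‖dirichlet (fun x => ζ x * u x) ψ‖ ≤
      Z * (A + 2 * ε + 2 * (nrm u + gnrm u)) * nrm ψ + Z * ε * gnrm ψ := by
  have hZ := hζ.nonneg
  have b1 := nrm_mul_le hψ.isCC hZ hζ.bound
  have b2 := gnrm_cutoff_le hζ hψ
  have b3 := mul_le_mul_of_nonneg_left b1 hA
  have b4 := mul_le_mul_of_nonneg_left b2 hε
  have key : ∀ i, ‖∫ x, (dirDeriv (stdDir i) (dirDeriv (stdDir i) ζ) x * u x
        + 2 * (dirDeriv (stdDir i) ζ x * dirDeriv (stdDir i) u x)) * ψ x‖ ≤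
        (Z * nrm u + 2 * (Z * nrm (dirDeriv (stdDir i) u))) * nrm ψ := by
    intro i
    have hz := hζ.smooth.dirDeriv (stdDir i)
    have hzz := hz.dirDeriv (stdDir i)
    have hd := hu.dirDeriv (stdDir i)
    have c1 := hu.isCC.mul_left hzz.1.continuous
    have c2 := hd.isCC.mul_left hz.1.continuous
    have c3 := c2.mul_left (m := fun _ => 2) continuous_const
    refine (norm_integral_mul_le (c1.add c3) hψ.isCC).trans ?_
    refine mul_le_mul_of_nonneg_right ?_ (nrm_nonneg _)
    refine (nrm_add_le c1 c3).trans (add_le_add ?_ ?_)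
    · exact nrm_mul_le hu.isCC hZ (hζ.bound_deriv₂ i)
    · refine (nrm_mul_le c2 zero_le_two (m := fun _ => 2) (by simp)).trans ?_
      exact mul_le_mul_of_nonneg_left (nrm_mul_le hd.isCC hZ (hζ.bound_deriv i)) zero_le_two
  rw [dirichlet_localize hζ.smooth hu hψ, Fin.sum_univ_two]
  refine (norm_sub_le _ _).trans ((add_le_add_right (norm_add_le _ _) _).trans ?_)
  have k0 := key 0
  have k1 := key 1
  unfold gnrm at *
  nlinarith

/-- `u` is a limit in `L²` of test functions which are bounded in `H¹` by `B`, and whose Laplacians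
are bounded in `L²` by `A` up to errors which are small in `H⁻¹`. -/
structure ApproxSol (Ω : Set Plane) (u : Plane → ℂ) (A B : ℝ) : Prop where
  memLp : MemLp u 2 volume
  approx : ∀ η : ℝ, 0 < η → ∃ u' : Plane → ℂ, IsTestOn Ω u' ∧ nrm (fun x => u x - u' x) ≤ η ∧
    nrm u' + gnrm u' ≤ B ∧ ∀ ψ, IsTestOn Ω ψ → ‖dirichlet u' ψ‖ ≤ A * nrm ψ + η * gnrm ψ

/-- Passage to the limit: an estimate for the smooth approximants with an error linear in η holds
for `u` without the error. -/
theorem ApproxSol.norm_integral_le {u : Plane → ℂ} {A B : ℝ} (hu : ApproxSol Ω u A B)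
    {g : Plane → ℂ} (hg : IsCC g) {C K : ℝ}
    (h : ∀ η u', 0 < η → η ≤ 1 → IsTestOn Ω u' → nrm u' + gnrm u' ≤ B →
      (∀ ψ, IsTestOn Ω ψ → ‖dirichlet u' ψ‖ ≤ A * nrm ψ + η * gnrm ψ) →
      ‖∫ x, u' x * g x‖ ≤ C + K * η) : ‖∫ x, u x * g x‖ ≤ C := by
  -- Collects the error Kη of the hypothesis and the error η · nrm g from replacing u by u'. The
  -- absolute value is there because K may be negative, the 1 to make N positive.
  set N := |K| + nrm g + 1
  have hN : 0 < N := by have := nrm_nonneg g; positivity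
  refine le_of_forall_pos_le_add fun ε hε => ?_
  have hη : 0 < min 1 (ε / N) := lt_min one_pos (by positivity)
  obtain ⟨u', h1, h2, h3, h4⟩ := hu.approx _ hη
  set η := min 1 (ε / N)
  have h5 := h η u' hη (min_le_left _ _) h1 h3 h4
  have hd : MemLp (fun x => u x - u' x) 2 volume := hu.memLp.sub h1.1.isCC.memLp
  have h6 : ‖∫ x, (u x - u' x) * g x‖ ≤ η * nrm g :=
    (norm_integral_mul_le_of_memLp hd hg.memLp).trans
      (mul_le_mul_of_nonneg_right h2 (nrm_nonneg g))
  have h7 : ∫ x, u x * g x = (∫ x, u' x * g x) + ∫ x, (u x - u' x) * g x := by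
    rw [← integral_add (g := fun x => (u x - u' x) * g x) (h1.1.isCC.integrable_mul hg.1)
      (hd.integrable_mul hg.memLp)]
    congr 1; ext x; ring
  have h8 : N * η ≤ ε := by
    calc N * η ≤ N * (ε / N) := by gcongr; exact min_le_right _ _
      _ = ε := by field_simp
  rw [h7]
  refine (norm_add_le _ _).trans ?_
  have h9 : K * η ≤ |K| * η := by gcongr; exact le_abs_self K
  have h10 : N * η = |K| * η + nrm g * η + η := by simp only [N]; ring
  linarith

/-- In the ball of radius `r` about `x₀`, the set `Ω` lies above the graph of `φ`. -/
structure GraphChart (Ω : Set Plane) (x₀ : Plane) (r : ℝ) (e : Plane ≃ₗᵢ[ℝ] Plane) (φ : ℝ → ℝ)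
    (M : ℝ) : Prop where
  graph : GraphBound φ M
  mem_iff : ∀ x ∈ Metric.ball x₀ r, (x ∈ Ω ↔ φ ((e x) 0) < (e x) 1)

/-- The height (e x) 1 - φ((e x) 0) above the graph is invariant under shears, so inside the ball
membership in Ω is preserved; a small shear keeps the support inside the ball. -/
theorem GraphChart.isTestOn_shear {x₀ : Plane} {r M : ℝ} (hc : GraphChart Ω x₀ r e φ M)
    {K : Set Plane} (hK : IsCompact K) (hKr : K ⊆ Metric.ball x₀ r) :
    ∃ δ > 0, ∀ h : ℝ, |h| < δ → ∀ v, IsTestOn Ω v → tsupport v ⊆ K →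
      IsTestOn Ω fun x => v (shear e φ h x) := by
  obtain ⟨d, hd, hdr⟩ := hK.exists_thickening_subset_open Metric.isOpen_ball hKr
  have hM := hc.graph.nonneg
  -- A shear by h displaces points by at most (1 + M)|h|, and the d-neighbourhood of K lies in the
  -- ball.
  refine ⟨d / (1 + M), by positivity, fun h hh v hv hvK => ⟨hv.1.shear hc.graph.smooth h, ?_⟩⟩
  have hpre := tsupport_comp_eq_preimage v (shearHomeo e hc.graph.smooth h)
  change tsupport (fun x => v (shear e φ h x)) = _ at hpre
  rw [hpre]
  intro x hx
  change shear e φ h x ∈ tsupport v at hx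
  have hxK := hvK hx
  have hxΩ := (hc.mem_iff _ (hKr hxK)).1 (hv.2 hx)
  have hxb : x ∈ Metric.ball x₀ r := by
    refine hdr (Metric.mem_thickening_iff.2 ⟨_, hxK, ?_⟩)
    rw [dist_comm, dist_eq_norm]
    refine (norm_shear_sub_le hc.graph.lip h x).trans_lt ?_
    rwa [lt_div_iff₀' (by positivity)] at hh
  rw [hc.mem_iff x hxb]
  rw [shear_coord_zero, shear_coord_one] at hxΩ
  linarith

/-- Invariance of the measure moves the difference from the derivative of θ onto v = ζu', and
integration by parts moves the derivative as well. What remains is a first derivative of the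
difference w paired with θ, and `gnrm_difference_le` bounds it by O(|h|) plus an error linear in η.
-/
theorem GraphChart.norm_integral_shear_sub_le {x₀ : Plane} {r M : ℝ}
    (hc : GraphChart Ω x₀ r e φ M) {ζ : Plane → ℂ} {Z : ℝ} (hζ : CutoffBound ζ Z)
    (hζr : tsupport ζ ⊆ Metric.ball x₀ r) :
    ∃ δ > 0, ∀ h : ℝ, |h| < δ → ∀ (u : Plane → ℂ) (A B : ℝ), 0 ≤ A → ApproxSol Ω u A B →
      ∀ θ, IsTestOn Ω θ → ∀ c : Plane, ‖c‖ = 1 →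
      ‖∫ x, u x * (ζ x * (dirDeriv c θ (shear e φ (-h) x) - dirDeriv c θ x))‖ ≤
        128 * (1 + M) * Z * |h| * (A + B) * nrm θ := by
  obtain ⟨δ, hδ, hT⟩ := hc.isTestOn_shear (K := tsupport ζ) hζ.smooth.2 hζr
  have hM := hc.graph.nonneg
  have hZ := hζ.nonneg
  have hφ := hc.graph.smooth
  refine ⟨δ, hδ, fun h hh u A B hA hu θ hθ c hcn => ?_⟩
  set g := dirDeriv c θ with hg
  have hgs : IsSC g := hθ.1.dirDeriv c
  have hgT := hgs.shear (e := e) hφ (-h)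
  have hnθ := nrm_nonneg θ
  refine hu.norm_integral_le ((hgT.sub hgs).isCC.mul_left hζ.smooth.1.continuous)
    (K := 32 * (1 + M) * (2 * Z * |h| + Z) * nrm θ) ?_
  intro η u' hη _ hu' huB hQ
  set v : Plane → ℂ := fun x => ζ x * u' x with hv
  have hvs : IsSC v := hu'.1.mul_left hζ.smooth.1
  have hvt : IsTestOn Ω v := hu'.mul_left hζ.smooth.1
  have hvK : tsupport v ⊆ tsupport ζ := tsupport_mul_subset_left
  set w : Plane → ℂ := fun x => v (shear e φ h x) - v x with hw
  have hws : IsSC w := (hvs.shear hφ h).sub hvs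
  have hgw := gnrm_difference_le hc.graph hvs h hw (A := Z * (A + 2 * η + 2 * (nrm u' + gnrm u')))
    (ε := Z * η) (by have := nrm_nonneg u'; have := gnrm_nonneg u'; positivity) (by positivity) (by
      rintro ψ rfl
      have ht : IsTestOn Ω (fun x => star (w (shear e φ (-h) x) - w x)) := by
        refine IsTestOn.conj ?_
        -- Written out, the second difference involves only v and its shears by ±h, all of which are
        -- test functions in Ω.
        have e1 : (fun x => w (shear e φ (-h) x) - w x) = fun x =>
            (v x - v (shear e φ (-h) x)) - (v (shear e φ h x) - v x) := by
          ext x; simp only [hw, shear_shear_neg]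
        rw [e1]
        exact (hvt.sub (hT (-h) (by rwa [abs_neg]) v hvt hvK)).sub ((hT h hh v hvt hvK).sub hvt)
      exact norm_dirichlet_localize_le hζ hA hη.le hu'.1 ht.1 (hQ _ (ht.mul_left hζ.smooth.1)))
  have e2 : ∫ x, u' x * (ζ x * (g (shear e φ (-h) x) - g x)) = -∫ x, dirDeriv c w x * θ x := by
    rw [integral_dirDeriv_mul hws hθ.1.1 c, neg_neg]
    have i1 := hvs.isCC.integrable_mul hgT.1.continuous
    have i2 := hvs.isCC.integrable_mul hgs.1.continuous
    have i3 := (hvs.shear (e := e) hφ h).isCC.integrable_mul hgs.1.continuous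
    have e3 := integral_shear (e := e) hφ h (fun x => v x * g (shear e φ (-h) x))
    simp only [shear_neg_shear] at e3
    calc _ = ∫ x, (v x * g (shear e φ (-h) x) - v x * g x) := by
          congr 1; ext x; simp only [hv]; ring
      _ = _ := by
          rw [integral_sub i1 i2, ← e3, ← integral_sub i3 i2]
          congr 1; ext x; simp only [hw, hg]; ring
  rw [e2, norm_neg]
  refine (norm_integral_mul_le (hws.dirDeriv c).isCC hθ.1.isCC).trans ?_
  have e4 := nrm_dirDeriv_le_gnrm hcn hws
  have e5 : gnrm v ≤ 2 * Z * B := by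
    refine (gnrm_cutoff_le hζ hu'.1).trans ?_
    have := mul_le_mul_of_nonneg_left huB hZ
    have := mul_nonneg hZ (gnrm_nonneg u')
    linarith
  have e6 : |h| * (Z * (A + 2 * η + 2 * (nrm u' + gnrm u')) + gnrm v) + Z * η ≤
      |h| * (Z * (A + 2 * η + 2 * B) + 2 * Z * B) + Z * η := by gcongr
  have e7 : gnrm w ≤ 32 * (1 + M) *
      (|h| * (Z * (A + 2 * η + 2 * B) + 2 * Z * B) + Z * η) :=
    hgw.trans (mul_le_mul_of_nonneg_left e6 (by positivity))
  have e8 := mul_le_mul_of_nonneg_right (e4.trans e7) hnθ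
  refine e8.trans ?_
  have e9 : 0 ≤ (1 + M) * (|h| * (Z * A)) * nrm θ := by positivity
  nlinarith

/-- Dominated convergence: by the mean value inequality along the orbit, the quotients are bounded
by the supremum of `tangDeriv e φ g`. -/
theorem tendsto_shear_quotient {u g : Plane → ℂ} (hu : Integrable u volume) (hg : IsSC g)
    (hφ : ContDiff ℝ ∞ φ) :
    Tendsto (fun h : ℝ => ∫ x, u x * (((h⁻¹ : ℝ) : ℂ) * (g (shear e φ h x) - g x))) (𝓝[≠] 0)
      (𝓝 (∫ x, u x * tangDeriv e φ g x)) := by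
  have hV : IsSC (tangDeriv e φ g) := hg.tangDeriv hφ
  obtain ⟨C, hC⟩ := hV.isCC.exists_bound
  refine tendsto_integral_filter_of_dominated_convergence (fun x => ‖u x‖ * C) ?_ ?_ ?_ ?_
  · refine Eventually.of_forall fun h => hu.aestronglyMeasurable.mul ?_
    exact (continuous_const.mul ((hg.shear (e := e) hφ h).sub hg).1.continuous).aestronglyMeasurable
  · filter_upwards [self_mem_nhdsWithin] with h hh
    refine Eventually.of_forall fun x => ?_
    rw [norm_mul]
    refine mul_le_mul_of_nonneg_left ?_ (norm_nonneg _)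
    have hmv := Convex.norm_image_sub_le_of_norm_hasDerivWithin_le (𝕜 := ℝ) (s := Set.univ)
      (f := fun h => g (shear e φ h x))
      (fun t _ => (hasDerivAt_shear_param hg.differentiable hφ x t).hasDerivWithinAt)
      (fun t _ => hC _) convex_univ (Set.mem_univ 0) (Set.mem_univ h)
    simp only [shear_zero, sub_zero] at hmv
    have hh0 : 0 < |h| := abs_pos.2 hh
    rw [norm_mul, Complex.norm_real, norm_inv, Real.norm_eq_abs]
    rw [Real.norm_eq_abs] at hmv
    calc |h|⁻¹ * _ ≤ |h|⁻¹ * (C * |h|) := by gcongr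
      _ = C := by field_simp
  · exact hu.norm.mul_const C
  · refine Eventually.of_forall fun x => Tendsto.const_mul _ ?_
    have hd := hasDerivAt_shear_param (e := e) hg.differentiable hφ x 0
    rw [hasDerivAt_iff_tendsto_slope] at hd
    rw [shear_zero] at hd
    refine hd.congr fun h => ?_
    rw [slope_def_module, shear_zero, sub_zero, Complex.real_smul]

/-- The difference bound is linear in |h| with a constant that does not depend on h, so it survives
division by h and the limit h → 0. -/
theorem GraphChart.norm_integral_tangDeriv_le {x₀ : Plane} {r M : ℝ}
    (hc : GraphChart Ω x₀ r e φ M) {ζ : Plane → ℂ} {Z : ℝ} (hζ : CutoffBound ζ Z)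
    (hζr : tsupport ζ ⊆ Metric.ball x₀ r) {u : Plane → ℂ} {A B : ℝ} (hA : 0 ≤ A)
    (hu : ApproxSol Ω u A B) {θ : Plane → ℂ} (hθ : IsTestOn Ω θ) {c : Plane} (hcn : ‖c‖ = 1) :
    ‖∫ x, (ζ x * u x) * tangDeriv e φ (dirDeriv c θ) x‖ ≤
      128 * (1 + M) * Z * (A + B) * nrm θ := by
  obtain ⟨δ, hδ, h⟩ := hc.norm_integral_shear_sub_le hζ hζr
  have hζu : Integrable (fun x => ζ x * u x) volume := by
    have := hu.memLp.integrable_mul hζ.smooth.isCC.memLp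
    exact this.congr (Eventually.of_forall fun x => mul_comm _ _)
  have ht := (tendsto_shear_quotient (e := e) hζu (hθ.1.dirDeriv c) hc.graph.smooth).norm
  refine le_of_tendsto ht ?_
  have hmem : Metric.ball (0 : ℝ) δ ∈ 𝓝[≠] (0 : ℝ) :=
    mem_nhdsWithin_of_mem_nhds (Metric.ball_mem_nhds 0 hδ)
  filter_upwards [self_mem_nhdsWithin, hmem] with t ht0 htδ
  rw [mem_ball_zero_iff, Real.norm_eq_abs] at htδ
  have h1 := h (-t) (by rwa [abs_neg]) u A B hA hu θ hθ c hcn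
  rw [neg_neg, abs_neg] at h1
  have hh0 : 0 < |t| := abs_pos.2 ht0
  have e1 : ∫ x, ζ x * u x * (((t⁻¹ : ℝ) : ℂ) * (dirDeriv c θ (shear e φ t x) - dirDeriv c θ x)) =
      ((t⁻¹ : ℝ) : ℂ) * ∫ x, u x * (ζ x * (dirDeriv c θ (shear e φ t x) - dirDeriv c θ x)) := by
    rw [← integral_const_mul]
    congr 1; ext x; ring
  rw [e1, norm_mul, Complex.norm_real, norm_inv, Real.norm_eq_abs]
  calc _ ≤ |t|⁻¹ * (128 * (1 + M) * Z * |t| * (A + B) * nrm θ) := by gcongr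
    _ = _ := by field_simp


/-! ### Second derivatives in a chart -/

section SecondDerivatives

variable {Ω : Set Plane} {e : Plane ≃ₗᵢ[ℝ] Plane} {φ : ℝ → ℝ}

theorem dirDeriv_comm {f : Plane → ℂ} (hf : ContDiff ℝ ∞ f) (c d x : Plane) :
    dirDeriv c (dirDeriv d f) x = dirDeriv d (dirDeriv c f) x := by
  have h1 : Differentiable ℝ (fderiv ℝ f) :=
    (hf.fderiv_right (m := ∞) (by simp)).differentiable (by simp)
  have h2 : ∀ c d, dirDeriv c (dirDeriv d f) x = fderiv ℝ (fderiv ℝ f) x c d := by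
    intro c d
    unfold dirDeriv
    rw [fderiv_clm_apply (h1 x) (differentiableAt_const d)]
    simp
  rw [h2, h2]
  exact (hf.contDiffAt.isSymmSndFDerivAt (by
    rw [minSmoothness_of_isRCLikeNormedField]; exact WithTop.coe_le_coe.2 (le_top : (2 : ℕ∞) ≤ ⊤))) c d

theorem ApproxSol.norm_integral_dirDeriv_le {ζ : Plane → ℂ} {Z : ℝ} (hζ : CutoffBound ζ Z)
    {u : Plane → ℂ} {A B : ℝ} (hu : ApproxSol Ω u A B) {θ : Plane → ℂ} (hθ : IsTestOn Ω θ)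
    {c : Plane} (hcn : ‖c‖ = 1) :
    ‖∫ x, (ζ x * u x) * dirDeriv c θ x‖ ≤ 2 * Z * B * nrm θ := by
  have hZ := hζ.nonneg
  have h := hu.norm_integral_le (g := fun x => ζ x * dirDeriv c θ x) (C := 2 * Z * B * nrm θ)
    (K := 0) ((hθ.1.dirDeriv c).isCC.mul_left hζ.smooth.1.continuous) ?_
  · convert h using 4 with x; ring
  intro η u' _ _ hu' huB _
  have hvs : IsSC fun x => ζ x * u' x := hu'.1.mul_left hζ.smooth.1
  have e1 : ∫ x, u' x * (ζ x * dirDeriv c θ x) = -∫ x, dirDeriv c (fun x => ζ x * u' x) x * θ x := by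
    rw [integral_dirDeriv_mul hvs hθ.1.1, neg_neg]
    congr 1; ext x; ring
  rw [e1, norm_neg, zero_mul, add_zero]
  refine (norm_integral_mul_le (hvs.dirDeriv c).isCC hθ.1.isCC).trans ?_
  refine mul_le_mul_of_nonneg_right ?_ (nrm_nonneg θ)
  refine (nrm_dirDeriv_le_gnrm hcn hvs).trans ((gnrm_cutoff_le hζ hu'.1).trans ?_)
  have := mul_le_mul_of_nonneg_left huB hZ
  have := mul_nonneg hZ (gnrm_nonneg u')
  linarith

/-- After one integration by parts the pairing is minus the Dirichlet form of the cut-off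
approximant with θ, so the localized weak equation applies directly. -/
theorem ApproxSol.norm_integral_laplacian_le {ζ : Plane → ℂ} {Z : ℝ} (hζ : CutoffBound ζ Z)
    {u : Plane → ℂ} {A B : ℝ} (hA : 0 ≤ A) (hu : ApproxSol Ω u A B) {θ : Plane → ℂ}
    (hθ : IsTestOn Ω θ) (e : Plane ≃ₗᵢ[ℝ] Plane) :
    ‖∫ x, (ζ x * u x) * (dirDeriv (frame e 0) (dirDeriv (frame e 0) θ) x +
      dirDeriv (frame e 1) (dirDeriv (frame e 1) θ) x)‖ ≤ 2 * Z * (A + B) * nrm θ := by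
  have hZ := hζ.nonneg
  have hs : ∀ i, IsSC (dirDeriv (frame e i) (dirDeriv (frame e i) θ)) := fun i =>
    (hθ.1.dirDeriv _).dirDeriv _
  have h := hu.norm_integral_le (g := fun x => ζ x * (dirDeriv (frame e 0) (dirDeriv (frame e 0) θ) x +
      dirDeriv (frame e 1) (dirDeriv (frame e 1) θ) x)) (C := 2 * Z * (A + B) * nrm θ)
    (K := 2 * Z * nrm θ + Z * gnrm θ) (((hs 0).add (hs 1)).isCC.mul_left hζ.smooth.1.continuous) ?_
  · convert h using 4 with x; ring
  intro η u' hη _ hu' huB hQ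
  have hvs : IsSC fun x => ζ x * u' x := hu'.1.mul_left hζ.smooth.1
  have e1 : ∫ x, u' x * (ζ x * (dirDeriv (frame e 0) (dirDeriv (frame e 0) θ) x +
      dirDeriv (frame e 1) (dirDeriv (frame e 1) θ) x)) =
      - dirichlet (fun x => ζ x * u' x) θ := by
    rw [dirichlet_eq_frame e]
    have h0 := integral_dirDeriv_mul hvs (hθ.1.dirDeriv (frame e 0)).1 (frame e 0)
    have h1 := integral_dirDeriv_mul hvs (hθ.1.dirDeriv (frame e 1)).1 (frame e 1)
    rw [integral_add, h0, h1, neg_add, neg_neg, neg_neg, ← integral_add]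
    · congr 1; ext x; ring
    · exact hvs.isCC.integrable_mul (hs 0).1.continuous
    · exact hvs.isCC.integrable_mul (hs 1).1.continuous
    · exact (hvs.dirDeriv _).isCC.integrable_mul (hθ.1.dirDeriv _).1.continuous
    · exact (hvs.dirDeriv _).isCC.integrable_mul (hθ.1.dirDeriv _).1.continuous
  rw [e1, norm_neg]
  refine (norm_dirichlet_localize_le hζ hA hη.le hu'.1 hθ.1
    (hQ _ (hθ.mul_left hζ.smooth.1))).trans ?_
  have hθ0 := nrm_nonneg θ
  have h1 : Z * (A + 2 * η + 2 * (nrm u' + gnrm u')) * nrm θ ≤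
      Z * (A + 2 * η + 2 * B) * nrm θ := by gcongr
  have h2 : 0 ≤ Z * A * nrm θ := by positivity
  linarith

theorem dirDeriv_coord_fun {m : ℝ → ℝ} (hm : Differentiable ℝ m) (c x : Plane) :
    dirDeriv c (fun x => ((m ((e x) 0) : ℝ) : ℂ)) x = ((deriv m ((e x) 0) * (e c) 0 : ℝ) : ℂ) := by
  unfold dirDeriv
  have h := (Complex.ofRealCLM.hasFDerivAt.comp x
    ((hm ((e x) 0)).hasDerivAt.comp_hasFDerivAt x (hasFDerivAt_coord (e := e) 0 x))).fderiv
  change (fderiv ℝ (⇑Complex.ofRealCLM ∘ (m ∘ fun x => (e x) 0)) x) _ = _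
  rw [h]
  rfl

theorem contDiff_coord_fun {m : ℝ → ℝ} (hm : ContDiff ℝ ∞ m) :
    ContDiff ℝ ∞ fun x : Plane => ((m ((e x) 0) : ℝ) : ℂ) :=
  Complex.ofRealCLM.contDiff.comp (hm.comp (contDiff_coord e 0))

/-- Bounds for the derivatives along the boundary and for the Laplacian give bounds for all second
derivatives. -/
theorem norm_integral_second_le {M : ℝ} (hφ : GraphBound φ M) {U : Plane → ℂ}
    (hU : MemLp U 2 volume) {L : ℝ} (hL : 0 ≤ L)
    (h0 : ∀ θ, IsTestOn Ω θ → ∀ c : Plane, ‖c‖ = 1 → ‖∫ x, U x * dirDeriv c θ x‖ ≤ L * nrm θ)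
    (hV : ∀ θ, IsTestOn Ω θ → ∀ c : Plane, ‖c‖ = 1 →
      ‖∫ x, U x * tangDeriv e φ (dirDeriv c θ) x‖ ≤ L * nrm θ)
    (hΔ : ∀ θ, IsTestOn Ω θ → ‖∫ x, U x * (dirDeriv (frame e 0) (dirDeriv (frame e 0) θ) x +
      dirDeriv (frame e 1) (dirDeriv (frame e 1) θ) x)‖ ≤ L * nrm θ)
    {θ : Plane → ℂ} (hθ : IsTestOn Ω θ) {c d : Plane} (hc : ‖c‖ = 1) (hd : ‖d‖ = 1) :
    ‖∫ x, U x * dirDeriv c (dirDeriv d θ) x‖ ≤ 7 * (1 + M) ^ 2 * L * nrm θ := by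
  have hM := hφ.nonneg
  have hint : ∀ {g}, IsSC g → Integrable (fun x => U x * g x) volume := fun hg =>
    hU.integrable_mul hg.isCC.memLp
  have hadd : ∀ {f g}, IsSC f → IsSC g → ∫ x, U x * (f x + g x) =
      (∫ x, U x * f x) + ∫ x, U x * g x := fun hf hg => by
    rw [← integral_add (hint hf) (hint hg)]
    simp only [mul_add]
  have hsub : ∀ {f g}, IsSC f → IsSC g → ∫ x, U x * (f x - g x) =
      (∫ x, U x * f x) - ∫ x, U x * g x := fun hf hg => by
    rw [← integral_sub (hint hf) (hint hg)]
    simp only [mul_sub]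
  set p : ℝ → ℝ := deriv φ with hp
  have hps : ContDiff ℝ ∞ p := (contDiff_infty_iff_deriv.1 hφ.smooth).2
  have hps' : ContDiff ℝ ∞ (deriv p) := (contDiff_infty_iff_deriv.1 hps).2
  set a := frame e 0 with ha
  set b := frame e 1 with hb
  have hea : (e a) 0 = 1 := by simp [ha, frame_coord]
  have heb : (e b) 0 = 0 := by simp [hb, frame_coord]
  have na : ‖a‖ = 1 := norm_frame e 0
  have nb : ‖b‖ = 1 := norm_frame e 1
  have da : ∀ {m : ℝ → ℝ}, ContDiff ℝ ∞ m → ∀ {g : Plane → ℂ}, IsSC g → ∀ x,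
      dirDeriv a (fun x => ((m ((e x) 0) : ℝ) : ℂ) * g x) x =
        ((deriv m ((e x) 0) : ℝ) : ℂ) * g x + ((m ((e x) 0) : ℝ) : ℂ) * dirDeriv a g x := by
    intro m hm g hg x
    rw [dirDeriv_mul ((contDiff_coord_fun hm).differentiable (by simp)) hg.differentiable,
      dirDeriv_coord_fun (hm.differentiable (by simp)), hea, mul_one]
  have db : ∀ {m : ℝ → ℝ}, ContDiff ℝ ∞ m → ∀ {g : Plane → ℂ}, IsSC g → ∀ x,
      dirDeriv b (fun x => ((m ((e x) 0) : ℝ) : ℂ) * g x) x =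
        ((m ((e x) 0) : ℝ) : ℂ) * dirDeriv b g x := by
    intro m hm g hg x
    rw [dirDeriv_mul ((contDiff_coord_fun hm).differentiable (by simp)) hg.differentiable,
      dirDeriv_coord_fun (hm.differentiable (by simp)), heb]
    simp
  have nm : ∀ {m : ℝ → ℝ} {K : ℝ} (g : Plane → ℂ), IsSC g → 0 ≤ K → (∀ s, |m s| ≤ K) →
      nrm (fun x => ((m ((e x) 0) : ℝ) : ℂ) * g x) ≤ K * nrm g := by
    intro m K g hg hK hm
    exact nrm_mul_le hg.isCC hK fun x => by rw [Complex.norm_real]; exact hm _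
  have bb : ∀ θ, IsTestOn Ω θ →
      ‖∫ x, U x * dirDeriv b (dirDeriv b θ) x‖ ≤ 2 * (1 + M) * L * nrm θ := by
    intro θ hθ
    -- With the tangential field V = a + p b and p constant along b, one has (1 + p²) b b χ = (a a +
    -- b b)χ - V a χ + V b(pχ) - b(p'χ). All terms on the right are controlled by hypothesis. Taking
    -- χ = θ/(1 + p²) turns the left side into b b θ.
    set q : ℝ → ℝ := fun s => (1 + p s ^ 2)⁻¹ with hq
    have hqs : ContDiff ℝ ∞ q := by
      refine ContDiff.inv (contDiff_const.add (hps.pow 2)) fun s => ?_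
      positivity
    have hq1 : ∀ s, |q s| ≤ 1 := by
      intro s
      have h1 : 1 ≤ 1 + p s ^ 2 := by nlinarith [sq_nonneg (p s)]
      rw [hq, abs_of_pos (by positivity)]
      exact inv_le_one_of_one_le₀ h1
    set χ : Plane → ℂ := fun x => ((q ((e x) 0) : ℝ) : ℂ) * θ x with hχ
    have tχ : IsTestOn Ω χ := hθ.mul_left (contDiff_coord_fun hqs)
    have nχ : nrm χ ≤ nrm θ := by simpa using nm θ hθ.1 zero_le_one hq1
    have tpχ : IsTestOn Ω fun x => ((p ((e x) 0) : ℝ) : ℂ) * χ x :=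
      tχ.mul_left (contDiff_coord_fun hps)
    have tpχ' : IsTestOn Ω fun x => ((deriv p ((e x) 0) : ℝ) : ℂ) * χ x :=
      tχ.mul_left (contDiff_coord_fun hps')
    have sbχ := tχ.1.dirDeriv b
    have saχ := tχ.1.dirDeriv a
    have point : ∀ x, dirDeriv b (dirDeriv b θ) x =
        (dirDeriv a (dirDeriv a χ) x + dirDeriv b (dirDeriv b χ) x)
        - tangDeriv e φ (dirDeriv a χ) x
        + tangDeriv e φ (dirDeriv b fun x => ((p ((e x) 0) : ℝ) : ℂ) * χ x) x
        - dirDeriv b (fun x => ((deriv p ((e x) 0) : ℝ) : ℂ) * χ x) x := by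
      intro x
      have e1 : ∀ x, dirDeriv b θ x = ((1 + p ((e x) 0) ^ 2 : ℝ) : ℂ) * dirDeriv b χ x := by
        intro x
        have hθχ : θ = fun x => ((1 + p ((e x) 0) ^ 2 : ℝ) : ℂ) * χ x := by
          ext x
          have h1 : (1 + p ((e x) 0) ^ 2 : ℝ) ≠ 0 := by positivity
          simp only [hχ, hq]
          rw [← mul_assoc, ← Complex.ofReal_mul, mul_inv_cancel₀ h1, Complex.ofReal_one, one_mul]
        conv_lhs => rw [hθχ]
        exact db (m := fun s => 1 + p s ^ 2) (contDiff_const.add (hps.pow 2)) tχ.1 x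
      have e2 : dirDeriv b (dirDeriv b θ) x =
          ((1 + p ((e x) 0) ^ 2 : ℝ) : ℂ) * dirDeriv b (dirDeriv b χ) x := by
        rw [funext e1]
        exact db (m := fun s => 1 + p s ^ 2) (contDiff_const.add (hps.pow 2)) sbχ x
      have e3 : dirDeriv b (fun x => ((p ((e x) 0) : ℝ) : ℂ) * χ x) =
          fun x => ((p ((e x) 0) : ℝ) : ℂ) * dirDeriv b χ x := funext (db hps tχ.1)
      rw [e2, db hps' tχ.1 x, e3]
      unfold tangDeriv
      rw [← ha, ← hb, da hps sbχ x, db hps sbχ x, dirDeriv_comm tχ.1.1 b a x]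
      push_cast
      ring
    have n1 := hΔ χ tχ
    have n2 := hV χ tχ a na
    have n3 := hV _ tpχ b nb
    have n4 := h0 _ tpχ' b nb
    have m1 := nm χ tχ.1 hM hφ.bound
    have m2 := nm χ tχ.1 hM hφ.bound_deriv
    simp only [point]
    have s1 := (saχ.dirDeriv a).add (sbχ.dirDeriv b)
    have s2 := saχ.tangDeriv (e := e) hφ.smooth
    have s3 := (tpχ.1.dirDeriv b).tangDeriv (e := e) hφ.smooth
    have s4 := tpχ'.1.dirDeriv b
    have j1 := hsub ((s1.sub s2).add s3) s4
    have j2 := hadd (s1.sub s2) s3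
    have j3 := hsub s1 s2
    refine (congrArg norm j1).le.trans ((norm_sub_le _ _).trans ?_)
    have k2 := (congrArg norm j2).le.trans (norm_add_le _ _)
    have k3 := (congrArg norm j3).le.trans (norm_sub_le _ _)
    have t1 : L * nrm χ ≤ L * nrm θ := by gcongr
    have t2 : M * nrm χ ≤ M * nrm θ := by gcongr
    have t3 : L * nrm (fun x => ((p ((e x) 0) : ℝ) : ℂ) * χ x) ≤ L * (M * nrm θ) := by
      gcongr; exact m1.trans t2
    have t4 : L * nrm (fun x => ((deriv p ((e x) 0) : ℝ) : ℂ) * χ x) ≤ L * (M * nrm θ) := by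
      gcongr; exact m2.trans t2
    linarith
  have ab : ∀ θ, IsTestOn Ω θ →
      ‖∫ x, U x * dirDeriv a (dirDeriv b θ) x‖ ≤ (1 + 2 * (1 + M) * M) * L * nrm θ := by
    intro θ hθ
    have tp : IsTestOn Ω fun x => ((p ((e x) 0) : ℝ) : ℂ) * θ x :=
      hθ.mul_left (contDiff_coord_fun hps)
    have sb := hθ.1.dirDeriv b
    -- The mixed derivative follows from a = V - p b, with p moved inside the b-derivatives.
    have point : ∀ x, dirDeriv a (dirDeriv b θ) x = tangDeriv e φ (dirDeriv b θ) x
        - dirDeriv b (dirDeriv b fun x => ((p ((e x) 0) : ℝ) : ℂ) * θ x) x := by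
      intro x
      rw [funext (db hps hθ.1), db hps sb x]
      unfold tangDeriv
      ring
    have n1 := hV θ hθ b nb
    have n2 := bb _ tp
    have m1 := nm θ hθ.1 hM hφ.bound
    simp only [point, mul_sub]
    rw [integral_sub (hint (sb.tangDeriv hφ.smooth)) (hint ((tp.1.dirDeriv b).dirDeriv b))]
    refine (norm_sub_le _ _).trans ?_
    have t1 : 2 * (1 + M) * L * nrm (fun x => ((p ((e x) 0) : ℝ) : ℂ) * θ x) ≤
      2 * (1 + M) * L * (M * nrm θ) := by gcongr
    linarith
  have aa : ∀ θ, IsTestOn Ω θ →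
      ‖∫ x, U x * dirDeriv a (dirDeriv a θ) x‖ ≤ (1 + 2 * (1 + M)) * L * nrm θ := by
    intro θ hθ
    have sa := (hθ.1.dirDeriv a).dirDeriv a
    have sb := (hθ.1.dirDeriv b).dirDeriv b
    have n1 := hΔ θ hθ
    have n2 := bb θ hθ
    have e1 : ∫ x, U x * dirDeriv a (dirDeriv a θ) x =
        (∫ x, U x * (dirDeriv a (dirDeriv a θ) x + dirDeriv b (dirDeriv b θ) x)) -
        ∫ x, U x * dirDeriv b (dirDeriv b θ) x := by
      rw [← integral_sub (hint (sa.add sb)) (hint sb)]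
      congr 1; ext x; ring
    rw [e1]
    refine (norm_sub_le _ _).trans ?_
    linarith
  set c0 : ℂ := (((e c) 0 : ℝ) : ℂ) with hc0
  set c1 : ℂ := (((e c) 1 : ℝ) : ℂ) with hc1
  set d0 : ℂ := (((e d) 0 : ℝ) : ℂ) with hd0
  set d1 : ℂ := (((e d) 1 : ℝ) : ℂ) with hd1
  have nc0 : ‖c0‖ ≤ 1 := abs_le_one_of_norm e hc 0
  have nc1 : ‖c1‖ ≤ 1 := abs_le_one_of_norm e hc 1
  have nd0 : ‖d0‖ ≤ 1 := abs_le_one_of_norm e hd 0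
  have nd1 : ‖d1‖ ≤ 1 := abs_le_one_of_norm e hd 1
  have point : ∀ x, U x * dirDeriv c (dirDeriv d θ) x =
      (c0 * d0) * (U x * dirDeriv a (dirDeriv a θ) x)
      + (c0 * d1 + c1 * d0) * (U x * dirDeriv a (dirDeriv b θ) x)
      + (c1 * d1) * (U x * dirDeriv b (dirDeriv b θ) x) := by
    intro x
    rw [dirDeriv_eq_frame e c, dirDeriv_comm hθ.1.1, dirDeriv_comm hθ.1.1 (frame e 1) d,
      dirDeriv_eq_frame e d, dirDeriv_eq_frame e d (dirDeriv (frame e 1) θ),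
      dirDeriv_comm hθ.1.1 (frame e 1) (frame e 0)]
    simp only [hc0, hc1, hd0, hd1, ha, hb]
    ring
  have iaa := hint ((hθ.1.dirDeriv a).dirDeriv a)
  have iab := hint ((hθ.1.dirDeriv b).dirDeriv a)
  have ibb := hint ((hθ.1.dirDeriv b).dirDeriv b)
  simp only [point]
  rw [integral_add (f := fun x => (c0 * d0) * (U x * dirDeriv a (dirDeriv a θ) x)
      + (c0 * d1 + c1 * d0) * (U x * dirDeriv a (dirDeriv b θ) x))
      ((iaa.const_mul _).add (iab.const_mul _)) (ibb.const_mul _),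
    integral_add (iaa.const_mul _) (iab.const_mul _), integral_const_mul, integral_const_mul,
    integral_const_mul]
  refine norm_add₃_le.trans ?_
  rw [norm_mul (c0 * d0), norm_mul (c0 * d1 + c1 * d0), norm_mul (c1 * d1)]
  have k1 : ‖c0 * d0‖ ≤ 1 := by rw [norm_mul]; exact mul_le_one₀ nc0 (norm_nonneg _) nd0
  have k3 : ‖c1 * d1‖ ≤ 1 := by rw [norm_mul]; exact mul_le_one₀ nc1 (norm_nonneg _) nd1
  have k2 : ‖c0 * d1 + c1 * d0‖ ≤ 2 := by
    refine (norm_add_le _ _).trans ?_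
    rw [norm_mul, norm_mul]
    have := mul_le_one₀ nc0 (norm_nonneg _) nd1
    have := mul_le_one₀ nc1 (norm_nonneg _) nd0
    linarith
  have g1 := mul_le_mul k1 (aa θ hθ) (norm_nonneg _) zero_le_one
  have g2 := mul_le_mul k2 (ab θ hθ) (norm_nonneg _) zero_le_two
  have g3 := mul_le_mul k3 (bb θ hθ) (norm_nonneg _) zero_le_one
  have hLn : 0 ≤ L * nrm θ := mul_nonneg hL (nrm_nonneg θ)
  have : 0 ≤ M * (L * nrm θ) := by positivity
  have : 0 ≤ M * (M * (L * nrm θ)) := by positivity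
  -- The bounds for a a, twice a b, and b b add up to 7 + 8M + 4M² ≤ 7(1 + M)².
  nlinarith

theorem GraphChart.norm_integral_second_le {x₀ : Plane} {r M : ℝ}
    (hc : GraphChart Ω x₀ r e φ M) {ζ : Plane → ℂ} (hζ : IsSC ζ)
    (hζr : tsupport ζ ⊆ Metric.ball x₀ r) : ∃ C, 0 ≤ C ∧
    ∀ (u : Plane → ℂ) (A B : ℝ), 0 ≤ A → 0 ≤ B → ApproxSol Ω u A B →
      ∀ θ, IsTestOn Ω θ → ∀ c d : Plane, ‖c‖ = 1 → ‖d‖ = 1 →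
      ‖∫ x, (ζ x * u x) * dirDeriv c (dirDeriv d θ) x‖ ≤ C * (A + B) * nrm θ := by
  obtain ⟨Z, hZ⟩ := hζ.exists_cutoffBound
  have hM := hc.graph.nonneg
  have hZ0 := hZ.nonneg
  refine ⟨7 * (1 + M) ^ 2 * (128 * (1 + M) * Z), by positivity, ?_⟩
  intro u A B hA hB hu θ hθ c d hcn hdn
  have hU : MemLp (fun x => ζ x * u x) 2 volume := by
    obtain ⟨K, hK⟩ := hζ.isCC.exists_bound
    exact hu.memLp.of_le_mul (c := K) (hζ.1.continuous.aestronglyMeasurable.mul hu.memLp.1)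
      (Eventually.of_forall fun x => by
        rw [norm_mul]; exact mul_le_mul_of_nonneg_right (hK x) (norm_nonneg _))
  have hk : 2 * Z ≤ 128 * (1 + M) * Z := by nlinarith [mul_nonneg hM hZ0]
  have := _root_.norm_integral_second_le (e := e) (Ω := Ω) hc.graph hU
    (L := 128 * (1 + M) * Z * (A + B)) (by positivity) ?_ ?_ ?_ hθ hcn hdn
  · refine this.trans (le_of_eq ?_); ring
  · intro θ hθ c hcn
    refine (hu.norm_integral_dirDeriv_le hZ hθ hcn).trans ?_
    refine mul_le_mul_of_nonneg_right ?_ (nrm_nonneg θ)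
    have h1 : 2 * Z * B ≤ 2 * Z * (A + B) := by gcongr; linarith
    exact h1.trans (by gcongr)
  · intro θ hθ c hcn
    exact hc.norm_integral_tangDeriv_le hZ hζr hA hu hθ hcn
  · intro θ hθ
    refine (hu.norm_integral_laplacian_le hZ hA hθ e).trans ?_
    exact mul_le_mul_of_nonneg_right (by gcongr) (nrm_nonneg θ)

end SecondDerivatives

/-! ### Charts of a smooth domain and regularity up to the boundary -/

namespace SmoothDomain

variable (D : SmoothDomain)

theorem graphBound_of_hasCompactSupport {φ : ℝ → ℝ} (hφ : ContDiff ℝ ∞ φ)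
    (hs : HasCompactSupport φ) : ∃ M, GraphBound φ M := by
  have h1 : ContDiff ℝ ∞ (deriv φ) := (contDiff_infty_iff_deriv.1 hφ).2
  have h2 : ContDiff ℝ ∞ (deriv (deriv φ)) := (contDiff_infty_iff_deriv.1 h1).2
  obtain ⟨a, ha⟩ := h1.continuous.bounded_above_of_compact_support hs.deriv
  obtain ⟨b, hb⟩ := h2.continuous.bounded_above_of_compact_support hs.deriv.deriv
  exact ⟨max a b, hφ, fun s => (ha s).trans (le_max_left _ _),
    fun s => (hb s).trans (le_max_right _ _)⟩

/-- Interior points are included so that interior and boundary regularity need no separate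
treatment, and the derivatives of the graph function are bounded on the whole line, as the shear
estimates require. -/
theorem exists_graphChart {x₀ : Plane} (hx : x₀ ∈ closure D.carrier) :
    ∃ r e φ M, 0 < r ∧ GraphChart D.carrier x₀ r e φ M := by
  have hcoord : ∀ (e : Plane ≃ₗᵢ[ℝ] Plane) (r : ℝ) (i : Fin 2) x, x ∈ Metric.ball x₀ r →
      |(e x) i| < ‖x₀‖ + r := by
    intro e r i x hx
    have h1 := abs_coord_le (e x) i
    rw [LinearIsometryEquiv.norm_map] at h1
    rw [mem_ball_iff_norm] at hx
    have h2 : ‖x‖ ≤ ‖x₀‖ + ‖x - x₀‖ := by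
      calc ‖x‖ = ‖x₀ + (x - x₀)‖ := by congr 1; abel
        _ ≤ _ := norm_add_le _ _
    linarith
  by_cases hxD : x₀ ∈ D.carrier
  · obtain ⟨r, hr, hb⟩ := Metric.isOpen_iff.1 D.isOpen x₀ hxD
    -- At an interior point the graph is a horizontal line lying below the whole ball, so the graph
    -- condition is always true there.
    refine ⟨r, LinearIsometryEquiv.refl ℝ Plane, fun _ => -(‖x₀‖ + r), 0, hr,
      ⟨contDiff_const, by simp, by simp⟩, fun x hx => ?_⟩
    have := (abs_lt.1 (hcoord (LinearIsometryEquiv.refl ℝ Plane) r 1 x hx)).1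
    exact ⟨fun _ => this, fun _ => hb hx⟩
  · have hfr : x₀ ∈ frontier D.carrier := by
      rw [D.isOpen.frontier_eq]; exact ⟨hx, hxD⟩
    obtain ⟨r, e, φ, hr, hφ, hmem⟩ := D.smooth_boundary x₀ hfr
    have hR : 0 < ‖x₀‖ + r := by positivity
    -- On the ball the first coordinate is less than ‖x₀‖ + r in absolute value. A bump equal to 1
    -- there makes the graph function compactly supported without changing the chart.
    let χ : ContDiffBump (0 : ℝ) := ⟨‖x₀‖ + r, ‖x₀‖ + r + 1, hR, by linarith⟩
    obtain ⟨M, hM⟩ := graphBound_of_hasCompactSupport (φ := fun s => χ s * φ s)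
      (χ.contDiff.mul hφ) χ.hasCompactSupport.mul_right
    refine ⟨r, e, _, M, hr, hM, fun x hx => ?_⟩
    have h1 : χ ((e x) 0) = 1 := by
      refine χ.one_of_mem_closedBall ?_
      rw [mem_closedBall_zero_iff]
      exact (hcoord e r 0 x hx).le
    rw [h1, one_mul]
    exact hmem x hx

open scoped Manifold in
/-- The second derivatives of solutions of the Dirichlet problem are square integrable. -/
theorem exists_second_deriv_bound : ∃ C, 0 ≤ C ∧
    ∀ (u : Plane → ℂ) (A B : ℝ), 0 ≤ A → 0 ≤ B → ApproxSol D.carrier u A B →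
      ∀ θ, IsTestOn D.carrier θ → ∀ c d : Plane, ‖c‖ = 1 → ‖d‖ = 1 →
      ‖∫ x, u x * dirDeriv c (dirDeriv d θ) x‖ ≤ C * (A + B) * nrm θ := by
  have hK : IsCompact (closure D.carrier) := D.isBounded.isCompact_closure
  choose r e φ M hr hch using fun x : closure D.carrier => D.exists_graphChart x.2
  obtain ⟨t, ht⟩ := hK.elim_finite_subcover (fun x : closure D.carrier => Metric.ball (x : Plane) (r x))
    (fun x => Metric.isOpen_ball) (fun x hx => Set.mem_iUnion.2 ⟨⟨x, hx⟩, Metric.mem_ball_self (hr _)⟩)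
  -- The partition sums to one on the closure of D, hence on the support of θ, so u may be replaced
  -- under the integral by the sum of the ζ_i u, each living in a single chart.
  obtain ⟨f, hf⟩ := SmoothPartitionOfUnity.exists_isSubordinate 𝓘(ℝ, Plane) (s := closure D.carrier)
    isClosed_closure (fun x : t => Metric.ball (x.1 : Plane) (r x.1)) (fun x => Metric.isOpen_ball)
    (by
      intro x hx
      obtain ⟨i, hi, hxi⟩ := Set.mem_iUnion₂.1 (ht hx)
      exact Set.mem_iUnion.2 ⟨⟨i, hi⟩, hxi⟩)
  set ζ : t → Plane → ℂ := fun i x => ((f i x : ℝ) : ℂ) with hζ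
  have hsupp : ∀ i, tsupport (ζ i) ⊆ tsupport (f i) := by
    intro i
    refine closure_mono fun x hx => ?_
    simpa [hζ] using hx
  have hζb : ∀ i, tsupport (ζ i) ⊆ Metric.ball (i.1 : Plane) (r i.1) := fun i =>
    (hsupp i).trans (hf i)
  have hζs : ∀ i, IsSC (ζ i) := by
    intro i
    refine ⟨Complex.ofRealCLM.contDiff.comp (f i).contMDiff.contDiff, ?_⟩
    exact Metric.isCompact_of_isClosed_isBounded (isClosed_tsupport _)
      (Metric.isBounded_ball.subset (hζb i))
  choose C hC0 hC using fun i : t => (hch i.1).norm_integral_second_le (hζs i) (hζb i)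
  refine ⟨∑ i, C i, Finset.sum_nonneg fun i _ => hC0 i, ?_⟩
  intro u A B hA hB hu θ hθ c d hcn hdn
  have hg := (hθ.dirDeriv d).dirDeriv c
  have e1 : ∫ x, u x * dirDeriv c (dirDeriv d θ) x =
      ∑ i, ∫ x, (ζ i x * u x) * dirDeriv c (dirDeriv d θ) x := by
    rw [← integral_finsetSum]
    · congr 1
      ext x
      by_cases hx : x ∈ tsupport (dirDeriv c (dirDeriv d θ))
      · have h1 := f.sum_eq_one (subset_closure (hg.2 hx))
        rw [finsum_eq_sum_of_fintype] at h1
        have h2 : ∑ i, ζ i x = 1 := by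
          simp only [hζ]; exact_mod_cast h1
        rw [← Finset.sum_mul, ← Finset.sum_mul, h2, one_mul]
      · rw [image_eq_zero_of_notMem_tsupport hx]; simp
    · intro i _
      have := hu.memLp.integrable_mul (hg.1.isCC.mul_left (hζs i).1.continuous).memLp
      refine this.congr (Eventually.of_forall fun x => ?_)
      simp only [Pi.mul_apply]; ring
  rw [e1, Finset.sum_mul, Finset.sum_mul]
  exact (norm_sum_le _ _).trans (Finset.sum_le_sum fun i _ => hC i u A B hA hB hu θ hθ c d hcn hdn)

end SmoothDomain


/-! ### The space `H¹₀` -/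

/-- Riesz representation of a functional which is bounded with respect to a seminorm induced by a
linear map into a Hilbert space. -/
theorem exists_riesz_of_le {T H : Type*} [AddCommGroup T] [Module ℂ T] [NormedAddCommGroup H]
    [InnerProductSpace ℂ H] [CompleteSpace H] (q : T →ₗ[ℂ] H) (ℓ : T →ₗ[ℂ] ℂ) {C : ℝ} (hC : 0 ≤ C)
    (h : ∀ t, ‖ℓ t‖ ≤ C * ‖q t‖) : ∃ V : H, ‖V‖ ≤ C ∧ ∀ t, ℓ t = inner ℂ V (q t) := by
  -- A linear section of q transports the functional to the range of q, from which Hahn–Banach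
  -- extends it with the same norm.
  obtain ⟨s, hs⟩ := q.rangeRestrict.exists_rightInverse_of_surjective q.range_rangeRestrict
  have hs' : ∀ y, q (s y) = y := fun y => by
    have := LinearMap.congr_fun hs y
    exact congrArg Subtype.val this
  have hb : ∀ y : LinearMap.range q, ‖(ℓ ∘ₗ s) y‖ ≤ C * ‖y‖ := fun y => by
    have := h (s y)
    rw [hs'] at this
    exact this
  let f : StrongDual ℂ (LinearMap.range q) := (ℓ ∘ₗ s).mkContinuous C hb
  obtain ⟨g, hg, hgn⟩ := exists_extension_norm_eq (LinearMap.range q) f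
  refine ⟨(InnerProductSpace.toDual ℂ H).symm g, ?_, fun t => ?_⟩
  · rw [LinearIsometryEquiv.norm_map, hgn]
    exact LinearMap.mkContinuous_norm_le _ hC _
  · rw [InnerProductSpace.toDual_symm_apply]
    have h1 := hg ⟨q t, LinearMap.mem_range_self q t⟩
    rw [h1]
    change ℓ t = ℓ (s ⟨q t, _⟩)
    -- The bound forces `ℓ` to vanish on the kernel of q, so the choice of section is immaterial.
    have h2 := h (t - s ⟨q t, LinearMap.mem_range_self q t⟩)
    rw [map_sub, map_sub, hs', sub_self, norm_zero, mul_zero, norm_le_zero_iff, sub_eq_zero] at h2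
    exact h2

namespace SmoothDomain

variable {D : SmoothDomain}

theorem isTest_iff {φ : Plane → ℂ} : D.IsTest φ ↔ IsTestOn D.carrier φ := and_assoc.symm

theorem IsTest.isTestOn {φ : Plane → ℂ} (h : D.IsTest φ) : IsTestOn D.carrier φ := isTest_iff.1 h

theorem partialDeriv_eq (i : Fin 2) (φ : Plane → ℂ) : partialDeriv i φ = dirDeriv (stdDir i) φ := rfl

theorem IsTest.partialDeriv {φ : Plane → ℂ} (h : D.IsTest φ) (i : Fin 2) :
    D.IsTest (partialDeriv i φ) := isTest_iff.2 (h.isTestOn.dirDeriv _)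

theorem IsTest.conj {φ : Plane → ℂ} (h : D.IsTest φ) : D.IsTest fun x => star (φ x) :=
  isTest_iff.2 h.isTestOn.conj

theorem measurableSet_carrier : MeasurableSet D.carrier := D.isOpen.measurableSet

theorem indicator_of_tsupport {f : Plane → ℂ} (h : tsupport f ⊆ D.carrier) :
    D.carrier.indicator f = f :=
  Set.indicator_eq_self.2 ((subset_tsupport f).trans h)

theorem eLpNorm_of_tsupport {f : Plane → ℂ} (h : tsupport f ⊆ D.carrier) :
    eLpNorm f 2 D.μ = eLpNorm f 2 volume := by
  rw [← eLpNorm_indicator_eq_eLpNorm_restrict measurableSet_carrier, indicator_of_tsupport h]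

theorem IsTest.norm_toLp {f : Plane → ℂ} (hf : D.IsTest f) : ‖hf.memLp.toLp f‖ = nrm f := by
  rw [Lp.norm_toLp, eLpNorm_of_tsupport hf.2.2]; rfl

theorem integral_of_tsupport {f : Plane → ℂ} (h : tsupport f ⊆ D.carrier) (u : Plane → ℂ) :
    ∫ x, u x * f x ∂D.μ = ∫ x, u x * f x := by
  rw [← integral_indicator measurableSet_carrier]
  congr 1
  ext x
  by_cases hx : x ∈ D.carrier
  · rw [Set.indicator_of_mem hx]
  · rw [Set.indicator_of_notMem hx, image_eq_zero_of_notMem_tsupport fun hx' => hx (h hx'), mul_zero]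

/-- The pairing with a square integrable function, as an inner product. -/
theorem integral_eq_inner (a : D.L2) {ψ : Plane → ℂ} (hψ : MemLp ψ 2 D.μ) :
    ∫ x, a x * ψ x ∂D.μ = inner ℂ ((hψ.star : MemLp (fun x => star (ψ x)) 2 D.μ).toLp _) a := by
  rw [L2.inner_def]
  refine integral_congr_ae ?_
  filter_upwards [(hψ.star : MemLp (fun x => star (ψ x)) 2 D.μ).coeFn_toLp] with x hx
  rw [hx]
  simp [mul_comm]

variable (D) in
/-- Test functions as a space. -/
def testSpace : Submodule ℂ (Plane → ℂ) where
  carrier := {φ | D.IsTest φ}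
  add_mem' := by
    intro f g hf hg
    exact isTest_iff.2 ⟨hf.isTestOn.1.add hg.isTestOn.1,
      (tsupport_add f g).trans (Set.union_subset hf.2.2 hg.2.2)⟩
  zero_mem' := ⟨contDiff_const, HasCompactSupport.zero, by simp [tsupport]⟩
  smul_mem' := by
    intro c f hf
    exact isTest_iff.2 (hf.isTestOn.mul_left (m := fun _ => c) contDiff_const)

variable (D) in
/-- Test functions as elements of `L²`. -/
def testToL2 : D.testSpace →ₗ[ℂ] D.L2 where
  toFun φ := φ.2.memLp.toLp φ.1
  map_add' _ _ := rfl
  map_smul' _ _ := rfl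

variable (D) in
/-- Partial derivatives of test functions. -/
def testPartial (i : Fin 2) : D.testSpace →ₗ[ℂ] D.testSpace where
  toFun φ := ⟨partialDeriv i φ.1, φ.2.partialDeriv i⟩
  map_add' f g := by
    ext x
    exact dirDeriv_add f.2.isTestOn.1.differentiable g.2.isTestOn.1.differentiable _ x
  map_smul' c f := by
    ext x
    have := fderiv_const_smul (f.2.isTestOn.1.differentiable x) c
    change (fderiv ℝ (c • f.1) x) _ = _
    rw [this]
    rfl

theorem norm_testToL2 (φ : D.testSpace) : ‖D.testToL2 φ‖ = nrm φ.1 := φ.2.norm_toLp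

theorem integral_mul_test (a : D.L2) (φ : D.testSpace) :
    ∫ x, a x * φ.1 x ∂D.μ = inner ℂ (D.testToL2 ⟨_, φ.2.conj⟩) a :=
  integral_eq_inner a φ.2.memLp

/-- An element of `L²` is determined by its integrals against test functions. -/
theorem eq_zero_of_integral_test (a : D.L2) (h : ∀ φ, D.IsTest φ → ∫ x, a x * φ x ∂D.μ = 0) :
    a = 0 := by
  have hloc : LocallyIntegrableOn (fun x => a x) D.carrier volume := by
    have h1 : IntegrableOn (fun x => a x) D.carrier volume :=
      (Lp.memLp a).integrable (by norm_num)
    exact h1.locallyIntegrableOn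
  have h2 := D.isOpen.ae_eq_zero_of_integral_contDiff_smul_eq_zero hloc ?_
  · rw [Lp.eq_zero_iff_ae_eq_zero]
    exact (ae_restrict_iff' measurableSet_carrier).2 h2
  · intro g hg hgs hgD
    have ht : D.IsTest fun x => ((g x : ℝ) : ℂ) := by
      have hsub : tsupport (fun x => ((g x : ℝ) : ℂ)) ⊆ tsupport g :=
        closure_mono fun x hx => by simpa using hx
      refine ⟨Complex.ofRealCLM.contDiff.comp hg, ?_, hsub.trans hgD⟩
      exact hgs.comp_left (g := fun z : ℝ => (z : ℂ)) (by simp)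
    have h3 := h _ ht
    rw [integral_of_tsupport ht.2.2] at h3
    rw [← h3]
    congr 1
    ext x
    rw [Complex.real_smul, mul_comm]

variable (D) in
/-- Functions together with two candidates for their first derivatives. -/
abbrev JetSpace : Type := PiLp 2 (fun _ : Option (Fin 2) => D.L2)

variable (D) in
/-- The first jet of a test function. -/
def testJet : D.testSpace →ₗ[ℂ] D.JetSpace :=
  (PiLp.continuousLinearEquiv 2 ℂ (fun _ : Option (Fin 2) => D.L2)).symm.toLinearMap ∘ₗ
    LinearMap.pi fun k => D.testToL2 ∘ₗ (k.elim LinearMap.id D.testPartial)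

theorem testJet_none (φ : D.testSpace) : (D.testJet φ) none = D.testToL2 φ := rfl

theorem testJet_some (φ : D.testSpace) (i : Fin 2) :
    (D.testJet φ) (some i) = D.testToL2 (D.testPartial i φ) := rfl

variable (D) in
/-- The Sobolev space `H¹₀(D)`. -/
def H10 : Submodule ℂ D.JetSpace := (LinearMap.range D.testJet).topologicalClosure

instance : CompleteSpace D.H10 :=
  (Submodule.isClosed_topologicalClosure _).completeSpace_coe

theorem testJet_mem (φ : D.testSpace) : D.testJet φ ∈ D.H10 :=
  Submodule.le_topologicalClosure _ (LinearMap.mem_range_self _ φ)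

/-- Density principle: inequalities and identities between continuous quantities need checking only
on jets of test functions. -/
theorem H10.induction {p : D.JetSpace → Prop} (hp : IsClosed {U | p U})
    (h : ∀ φ : D.testSpace, p (D.testJet φ)) (U : D.H10) : p U.1 := by
  have h1 : (D.H10 : Set D.JetSpace) ⊆ {U | p U} := by
    rw [H10, Submodule.topologicalClosure_coe]
    refine closure_minimal ?_ hp
    rintro _ ⟨φ, rfl⟩
    exact h φ
  exact h1 U.2

theorem H10.exists_approx (U : D.H10) {ε : ℝ} (hε : 0 < ε) :
    ∃ φ : D.testSpace, ‖U.1 - D.testJet φ‖ < ε := by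
  have h1 : U.1 ∈ closure (LinearMap.range D.testJet : Set D.JetSpace) := U.2
  obtain ⟨_, ⟨φ, rfl⟩, hφ⟩ := Metric.mem_closure_iff.1 h1 ε hε
  exact ⟨φ, by rwa [dist_eq_norm] at hφ⟩

theorem norm_jet_le (U : D.JetSpace) : ‖U‖ ≤ ‖U none‖ + ∑ i, ‖U (some i)‖ := by
  have h : ‖U‖ ^ 2 = ‖U none‖ ^ 2 + ∑ i, ‖U (some i)‖ ^ 2 := by
    rw [PiLp.norm_sq_eq_of_L2, Fintype.sum_option]
  rw [Fin.sum_univ_two] at *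
  have h0 := norm_nonneg (U none)
  have h1 := norm_nonneg (U (some 0))
  have h2 := norm_nonneg (U (some 1))
  refine le_of_sq_le_sq ?_ (by positivity)
  rw [h]
  nlinarith [mul_nonneg h0 h1, mul_nonneg h0 h2, mul_nonneg h1 h2]

variable (D) in
/-- The gradient. -/
def gradMap : D.JetSpace →L[ℂ] PiLp 2 (fun _ : Fin 2 => D.L2) :=
  ((PiLp.continuousLinearEquiv 2 ℂ (fun _ : Fin 2 => D.L2)).symm :
    (Fin 2 → D.L2) →L[ℂ] PiLp 2 (fun _ : Fin 2 => D.L2)).comp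
    (ContinuousLinearMap.pi fun i => PiLp.proj 2 (fun _ : Option (Fin 2) => D.L2) (some i))

theorem gradMap_apply (U : D.JetSpace) (i : Fin 2) : (D.gradMap U) i = U (some i) := rfl

variable (D) in
/-- The underlying function. -/
def valMap : D.JetSpace →L[ℂ] D.L2 := PiLp.proj 2 (fun _ : Option (Fin 2) => D.L2) none

theorem valMap_apply (U : D.JetSpace) : D.valMap U = U none := rfl

theorem inner_gradMap (U V : D.JetSpace) :
    inner ℂ (D.gradMap U) (D.gradMap V) = ∑ i, inner ℂ (U (some i)) (V (some i)) := by
  rw [PiLp.inner_apply]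
  rfl

theorem norm_gradMap_testJet_le (φ : D.testSpace) : ‖D.gradMap (D.testJet φ)‖ ≤ gnrm φ.1 := by
  have h : ‖D.gradMap (D.testJet φ)‖ ^ 2 = nrm (dirDeriv (stdDir 0) φ.1) ^ 2 +
      nrm (dirDeriv (stdDir 1) φ.1) ^ 2 := by
    rw [PiLp.norm_sq_eq_of_L2, Fin.sum_univ_two, gradMap_apply, gradMap_apply, testJet_some,
      testJet_some, norm_testToL2, norm_testToL2]
    rfl
  refine le_of_sq_le_sq ?_ (gnrm_nonneg _)
  rw [h, gnrm]
  nlinarith [mul_nonneg (nrm_nonneg (dirDeriv (stdDir 0) φ.1)) (nrm_nonneg (dirDeriv (stdDir 1) φ.1))]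

theorem gnrm_le_norm_gradMap (φ : D.testSpace) : gnrm φ.1 ≤ 2 * ‖D.gradMap (D.testJet φ)‖ := by
  have h : ∀ i, nrm (dirDeriv (stdDir i) φ.1) ≤ ‖D.gradMap (D.testJet φ)‖ := by
    intro i
    have := PiLp.norm_apply_le (D.gradMap (D.testJet φ)) i
    rwa [gradMap_apply, testJet_some, norm_testToL2] at this
  unfold gnrm
  linarith [h 0, h 1]

variable (D) in
/-- The Poincaré inequality for test functions. -/
theorem exists_nrm_le_gnrm : ∃ C, 0 < C ∧ ∀ φ, D.IsTest φ → nrm φ ≤ C * gnrm φ := by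
  obtain ⟨R, hR, hD⟩ := D.isBounded.exists_pos_norm_le
  refine ⟨2 * R + 1, by positivity, fun φ hφ => ?_⟩
  have hs := hφ.isTestOn.1
  set e := LinearIsometryEquiv.refl ℝ Plane
  have h0 : ContDiff ℝ ∞ (fun _ : ℝ => (0 : ℝ)) := contDiff_const
  have h1 := nrm_shear_sub_le (e := e) hs h0 (2 * R + 1)
  have h2 := nrm_tangDeriv_le (e := e) hs h0 le_rfl (by simp)
  rw [abs_of_pos (by positivity)] at h1
  -- With zero graph function the shear is a translation. Its length 2R + 1 exceeds the diameter of
  -- D, so the shifted φ vanishes on D and the difference there is -φ.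
  have h3 : nrm φ ≤ 1 * nrm fun x => φ (shear e (fun _ => 0) (2 * R + 1) x) - φ x := by
    refine nrm_le_mul_of_le ((hs.shear h0 _).sub hs).isCC zero_le_one fun x => ?_
    rw [one_mul]
    by_cases hx : φ x = 0
    · rw [hx, norm_zero]; exact norm_nonneg _
    · have hxD : x ∈ D.carrier := hφ.2.2 (subset_tsupport φ hx)
      have : φ (shear e (fun _ => 0) (2 * R + 1) x) = 0 := by
        refine image_eq_zero_of_notMem_tsupport fun hy => ?_
        have hyD := hD _ (hφ.2.2 hy)
        have e1 : shear e (fun _ => 0) (2 * R + 1) x - x = (2 * R + 1) • frame e 0 := by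
          simp [shear]
        have e2 : ‖shear e (fun _ => 0) (2 * R + 1) x - x‖ = 2 * R + 1 := by
          rw [e1, norm_smul, norm_frame, mul_one, Real.norm_of_nonneg (by positivity)]
        have := norm_sub_le (shear e (fun _ => 0) (2 * R + 1) x) x
        linarith [hD x hxD]
      rw [this, zero_sub, norm_neg]
  have h4 : (2 * R + 1) * nrm (tangDeriv e (fun _ => 0) φ) ≤ (2 * R + 1) * gnrm φ := by
    gcongr; linarith
  linarith

variable (D) in
theorem exists_poincare : ∃ C, 0 < C ∧ ∀ U : D.H10, ‖D.valMap U.1‖ ≤ C * ‖D.gradMap U.1‖ := by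
  obtain ⟨C, hC, h⟩ := D.exists_nrm_le_gnrm
  refine ⟨2 * C, by positivity, H10.induction (p := fun U => ‖D.valMap U‖ ≤ 2 * C * ‖D.gradMap U‖)
    (isClosed_le (by fun_prop) (by fun_prop)) fun φ => ?_⟩
  rw [valMap_apply, testJet_none, norm_testToL2]
  have := mul_le_mul_of_nonneg_left (gnrm_le_norm_gradMap φ) hC.le
  linarith [h φ.1 φ.2]

theorem H10.isWeakDeriv (U : D.H10) (i : Fin 2) : D.IsWeakDeriv i (U.1 none) (U.1 (some i)) := by
  intro φ hφ
  refine H10.induction (p := fun U => ∫ x, U none x * SmoothDomain.partialDeriv i φ x ∂D.μ =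
    -∫ x, U (some i) x * φ x ∂D.μ) ?_ (fun ψ => ?_) U
  · have c1 : Continuous fun U : D.JetSpace => U none := by fun_prop
    have c2 : Continuous fun U : D.JetSpace => U (some i) := by fun_prop
    simp only [integral_eq_inner _ hφ.memLp, integral_eq_inner _ (hφ.memLp_partialDeriv i)]
    exact isClosed_eq (continuous_const.inner c1) (continuous_const.inner c2).neg
  · have e1 : ∫ x, (D.testJet ψ) none x * SmoothDomain.partialDeriv i φ x ∂D.μ =
        ∫ x, ψ.1 x * SmoothDomain.partialDeriv i φ x ∂D.μ := by
      refine integral_congr_ae ?_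
      filter_upwards [ψ.2.memLp.coeFn_toLp] with x hx
      rw [testJet_none]
      change (ψ.2.memLp.toLp ψ.1 : Plane → ℂ) x * _ = _
      rw [hx]
    have e2 : ∫ x, (D.testJet ψ) (some i) x * φ x ∂D.μ =
        ∫ x, SmoothDomain.partialDeriv i ψ.1 x * φ x ∂D.μ := by
      refine integral_congr_ae ?_
      filter_upwards [(ψ.2.partialDeriv i).memLp.coeFn_toLp] with x hx
      rw [testJet_some]
      change ((ψ.2.partialDeriv i).memLp.toLp (SmoothDomain.partialDeriv i ψ.1) : Plane → ℂ) x * _ = _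
      rw [hx]
    rw [e1, e2, integral_of_tsupport (hφ.partialDeriv i).2.2, integral_of_tsupport hφ.2.2]
    have := integral_dirDeriv_mul ψ.2.isTestOn.1 hφ.1 (stdDir i)
    rw [partialDeriv_eq, partialDeriv_eq, this, neg_neg]

/-- Weak derivatives exist as soon as the distributional derivative is bounded in `L²`. -/
theorem exists_isWeakDeriv (g : D.L2) (j : Fin 2) {C : ℝ} (hC : 0 ≤ C)
    (h : ∀ φ, D.IsTest φ → ‖∫ x, g x * partialDeriv j φ x ∂D.μ‖ ≤ C * nrm φ) :
    ∃ V : D.L2, ‖V‖ ≤ C ∧ D.IsWeakDeriv j g V := by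
  let ℓ : D.testSpace →ₗ[ℂ] ℂ :=
    { toFun := fun φ => ∫ x, g x * (D.testPartial j φ).1 x ∂D.μ
      map_add' := fun φ ψ => by
        rw [map_add, ← integral_add (D.integrable_mul g (D.testPartial j φ).2.memLp)
          (D.integrable_mul g (D.testPartial j ψ).2.memLp)]
        simp only [Submodule.coe_add, Pi.add_apply, mul_add]
      map_smul' := fun c φ => by
        rw [map_smul, RingHom.id_apply, smul_eq_mul, ← integral_const_mul]
        congr 1
        ext x
        simp only [Submodule.coe_smul, Pi.smul_apply, smul_eq_mul]
        ring }
  obtain ⟨V, hV, hVℓ⟩ := exists_riesz_of_le D.testToL2 ℓ hC fun φ => by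
    rw [norm_testToL2]; exact h φ.1 φ.2
  -- Riesz represents by the sesquilinear product, whereas weak derivatives use the bilinear pairing
  -- with a minus sign; hence -conj V.
  have hstar : MemLp (fun x => -star (V x)) 2 D.μ := (Lp.memLp V).star.neg
  refine ⟨hstar.toLp _, ?_, fun φ hφ => ?_⟩
  · rw [Lp.norm_toLp]
    have : eLpNorm (fun x => -star (V x)) 2 D.μ = eLpNorm V 2 D.μ :=
      eLpNorm_congr_norm_ae (Eventually.of_forall fun x => by rw [norm_neg, norm_star])
    rw [this]
    exact hV
  · have h1 := hVℓ ⟨φ, hφ⟩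
    change ∫ x, g x * SmoothDomain.partialDeriv j φ x ∂D.μ = _ at h1
    rw [h1, L2.inner_def, ← integral_neg]
    refine integral_congr_ae ?_
    filter_upwards [hstar.coeFn_toLp, hφ.memLp.coeFn_toLp] with x h2 h3
    rw [h2]
    change inner ℂ (V x) ((hφ.memLp.toLp φ : Plane → ℂ) x) = _
    rw [h3]
    simp [mul_comm]

end SmoothDomain


namespace SmoothDomain

variable {D : SmoothDomain}

/-! ### Operations on `H²` as continuous linear maps -/

variable (D) in
/-- The underlying function of an element of `H²`. -/
def toL2L : D.H2 →L[ℂ] D.L2 :=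
  (PiLp.proj 2 (fun _ : Jet => D.L2) (.inl ())).comp D.H2.subtypeL

theorem toL2L_apply (U : D.H2) : D.toL2L U = toL2 U := rfl

variable (D) in
/-- The first derivatives of an element of `H²`. -/
def gradL (i : Fin 2) : D.H2 →L[ℂ] D.L2 :=
  (PiLp.proj 2 (fun _ : Jet => D.L2) (.inr (.inl i))).comp D.H2.subtypeL

variable (D) in
/-- The Laplacian on `H²`. -/
def lapL : D.H2 →L[ℂ] D.L2 :=
  ∑ i : Fin 2, (PiLp.proj 2 (fun _ : Jet => D.L2) (.inr (.inr (i, i)))).comp D.H2.subtypeL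

theorem lapL_apply (U : D.H2) : D.lapL U = lap U := by
  simp [lapL, lap]

variable (D) in
/-- The first jet of an element of `H²`. -/
def jetL : D.H2 →L[ℂ] D.JetSpace :=
  ((PiLp.continuousLinearEquiv 2 ℂ (fun _ : Option (Fin 2) => D.L2)).symm :
    (Option (Fin 2) → D.L2) →L[ℂ] D.JetSpace).comp
    (ContinuousLinearMap.pi fun k => k.elim D.toL2L D.gradL)

theorem jetL_none (U : D.H2) : D.jetL U none = toL2 U := rfl

theorem jetL_some (U : D.H2) (i : Fin 2) : D.jetL U (some i) = grad U i := rfl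

theorem integral_mul_const_eq_inner (a : D.L2) (p : ℂ) :
    inner ℂ a (D.const p) = p * star (∫ x, a x ∂D.μ) := by
  rw [L2.inner_def, Complex.star_def, ← integral_conj, ← integral_const_mul]
  refine integral_congr_ae ?_
  filter_upwards [Lp.coeFn_const (p := 2) (μ := D.μ) p] with x hx
  have hx' : (D.const p : Plane → ℂ) x = p := hx
  rw [hx']
  simp

theorem integral_const_mul_test (p : ℂ) (ψ : Plane → ℂ) :
    ∫ x, (D.const p : Plane → ℂ) x * ψ x ∂D.μ = p * ∫ x, ψ x ∂D.μ := by
  rw [← integral_const_mul]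
  refine integral_congr_ae ?_
  filter_upwards [Lp.coeFn_const (p := 2) (μ := D.μ) p] with x hx
  have hx' : (D.const p : Plane → ℂ) x = p := hx
  rw [hx']

theorem const_eq_smul (p : ℂ) : D.const p = p • D.const 1 := by
  apply Lp.ext
  filter_upwards [Lp.coeFn_const (p := 2) (μ := D.μ) p, Lp.coeFn_const (p := 2) (μ := D.μ) (1 : ℂ),
    Lp.coeFn_smul p (D.const 1)] with x h1 h2 h3
  have h1' : (D.const p : Plane → ℂ) x = p := h1
  have h2' : (D.const 1 : Plane → ℂ) x = 1 := h2
  rw [h3, Pi.smul_apply, h1', h2', smul_eq_mul, mul_one]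

theorem const_sub (p q : ℂ) : D.const (p - q) = D.const p - D.const q := by
  rw [const_eq_smul, const_eq_smul p, const_eq_smul q, sub_smul]

variable (D) in
/-- The flux. -/
def fluxL : D.H2 →L[ℂ] ℂ := (innerSL ℂ (D.const 1)).comp D.toL2L

theorem fluxL_apply (U : D.H2) : D.fluxL U = flux U := by
  change inner ℂ (D.const 1) (toL2 U) = _
  rw [← inner_conj_symm, integral_mul_const_eq_inner]
  simp [flux]

/-! ### Weak derivatives and the boundary condition -/

/-- Weak derivatives are unique, because test functions separate L². -/
theorem eq_of_toL2_eq {U V : D.H2} (h : toL2 U = toL2 V) : U = V := by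
  have key : ∀ (i : Fin 2) (a b b' : D.L2), D.IsWeakDeriv i a b → D.IsWeakDeriv i a b' → b = b' := by
    intro i a b b' hb hb'
    rw [← sub_eq_zero]
    refine eq_zero_of_integral_test _ fun φ hφ => ?_
    have h1 := hb φ hφ
    have h2 := hb' φ hφ
    rw [h1] at h2
    have h3 : ∫ x, (b - b' : D.L2) x * φ x ∂D.μ =
        ∫ x, b x * φ x ∂D.μ - ∫ x, b' x * φ x ∂D.μ := by
      rw [← integral_sub (D.integrable_mul b hφ.memLp) (D.integrable_mul b' hφ.memLp)]
      refine integral_congr_ae ?_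
      filter_upwards [Lp.coeFn_sub b b'] with x hx
      rw [hx, Pi.sub_apply, sub_mul]
    rw [h3]
    linear_combination -h2
  have h1 : ∀ i, grad U i = grad V i := fun i =>
    key i (toL2 U) _ _ (U.2.1 i) (by rw [h]; exact V.2.1 i)
  have h2 : ∀ i j, U.1 (.inr (.inr (i, j))) = V.1 (.inr (.inr (i, j))) := fun i j =>
    key j (grad U i) _ _ (U.2.2 i j) (by rw [h1]; exact V.2.2 i j)
  apply Subtype.ext
  ext1 k
  rcases k with ⟨⟩ | i | ⟨i, j⟩
  · exact h
  · exact h1 i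
  · exact h2 i j

theorem eLpNorm_sub_test (a : D.L2) {φ : Plane → ℂ} (hφ : MemLp φ 2 D.μ) :
    eLpNorm (fun x => a x - φ x) 2 D.μ = ENNReal.ofReal ‖a - hφ.toLp φ‖ := by
  rw [Lp.norm_def, ENNReal.ofReal_toReal (Lp.eLpNorm_ne_top _)]
  refine eLpNorm_congr_ae ?_
  filter_upwards [Lp.coeFn_sub a (hφ.toLp φ), hφ.coeFn_toLp] with x h1 h2
  rw [h1, Pi.sub_apply, h2]

/-- Turns the boundary condition into membership in a closed subspace, so that it passes to linear
combinations and limits. -/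
theorem vanishesOnBoundary_iff {U : D.H2} : VanishesOnBoundary U ↔ D.jetL U ∈ D.H10 := by
  constructor
  · intro h
    change D.jetL U ∈ closure (LinearMap.range D.testJet : Set D.JetSpace)
    rw [Metric.mem_closure_iff]
    intro ε hε
    obtain ⟨φ, hφ, h0, h1⟩ := h (ENNReal.ofReal (ε / 4)) (by simpa using hε)
    refine ⟨D.testJet ⟨φ, hφ⟩, LinearMap.mem_range_self _ _, ?_⟩
    rw [eLpNorm_sub_test _ hφ.memLp, ENNReal.ofReal_le_ofReal_iff (by positivity)] at h0
    have h1' : ∀ i, ‖grad U i - (hφ.memLp_partialDeriv i).toLp _‖ ≤ ε / 4 := by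
      intro i
      have := h1 i
      rwa [eLpNorm_sub_test _ (hφ.memLp_partialDeriv i),
        ENNReal.ofReal_le_ofReal_iff (by positivity)] at this
    rw [dist_eq_norm]
    refine (norm_jet_le _).trans_lt ?_
    rw [Fin.sum_univ_two]
    have a0 : ‖(D.jetL U - D.testJet ⟨φ, hφ⟩) none‖ ≤ ε / 4 := h0
    have a1 : ‖(D.jetL U - D.testJet ⟨φ, hφ⟩) (some 0)‖ ≤ ε / 4 := h1' 0
    have a2 : ‖(D.jetL U - D.testJet ⟨φ, hφ⟩) (some 1)‖ ≤ ε / 4 := h1' 1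
    linarith
  · intro h ε hε
    obtain ⟨δ, hδ, hδε⟩ : ∃ δ : ℝ, 0 < δ ∧ ENNReal.ofReal δ ≤ ε := by
      by_cases ht : ε = ⊤
      · exact ⟨1, one_pos, by simp [ht]⟩
      · exact ⟨ε.toReal, ENNReal.toReal_pos hε.ne' ht, ENNReal.ofReal_toReal_le⟩
    obtain ⟨φ, hφ⟩ := H10.exists_approx ⟨_, h⟩ hδ
    refine ⟨φ.1, φ.2, ?_, fun i => ?_⟩
    · rw [eLpNorm_sub_test _ φ.2.memLp]
      refine le_trans (ENNReal.ofReal_le_ofReal ?_) hδε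
      exact (PiLp.norm_apply_le (D.jetL U - D.testJet φ) none).trans hφ.le
    · rw [eLpNorm_sub_test _ (φ.2.memLp_partialDeriv i)]
      refine le_trans (ENNReal.ofReal_le_ofReal ?_) hδε
      exact (PiLp.norm_apply_le (D.jetL U - D.testJet φ) (some i)).trans hφ.le

theorem integral_sum_mul (a : Fin 2 → D.L2) {ψ : Plane → ℂ} (hψ : MemLp ψ 2 D.μ) :
    ∫ x, (∑ i, a i : D.L2) x * ψ x ∂D.μ = ∑ i, ∫ x, a i x * ψ x ∂D.μ := by
  simp only [integral_eq_inner _ hψ, inner_sum]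

theorem integral_lap_mul (U : D.H2) {ψ : Plane → ℂ} (hψ : D.IsTest ψ) :
    ∫ x, lap U x * ψ x ∂D.μ = -∑ i, ∫ x, grad U i x * partialDeriv i ψ x ∂D.μ := by
  rw [lap, integral_sum_mul _ hψ.memLp, ← Finset.sum_neg_distrib]
  refine Finset.sum_congr rfl fun i _ => ?_
  have : ∫ x, grad U i x * SmoothDomain.partialDeriv i ψ x ∂D.μ = _ := U.2.2 i i ψ hψ
  rw [this, neg_neg]

theorem partialDeriv_conj {ψ : Plane → ℂ} (hψ : D.IsTest ψ) (i : Fin 2) :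
    partialDeriv i (fun x => star (ψ x)) = fun x => star (partialDeriv i ψ x) :=
  funext fun x => dirDeriv_conj hψ.isTestOn.1.differentiable _ x

theorem inner_testToL2 (φ : D.testSpace) (a : D.L2) :
    inner ℂ (D.testToL2 φ) a = ∫ x, a x * star (φ.1 x) ∂D.μ := by
  rw [integral_eq_inner a φ.2.conj.memLp]
  congr 1
  apply Lp.ext
  filter_upwards [φ.2.memLp.coeFn_toLp, (φ.2.conj.memLp.star : MemLp (fun x => star (star (φ.1 x))) 2
    D.μ).coeFn_toLp] with x h1 h2
  rw [h2]
  exact h1.trans (star_star (φ.1 x)).symm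

/-- Green's formula. -/
theorem inner_lap (U : D.H2) (v : D.H10) :
    inner ℂ (v.1 none) (lap U) = -inner ℂ (D.gradMap v.1) (D.gradMap (D.jetL U)) := by
  refine H10.induction (p := fun v => inner ℂ (v none) (lap U) =
    -inner ℂ (D.gradMap v) (D.gradMap (D.jetL U))) ?_ (fun ψ => ?_) v
  · exact isClosed_eq (by fun_prop) (by fun_prop)
  · rw [testJet_none, inner_testToL2, integral_lap_mul U ψ.2.conj, inner_gradMap]
    congr 1
    refine Finset.sum_congr rfl fun i _ => ?_
    rw [testJet_some, inner_testToL2, jetL_some, partialDeriv_conj ψ.2]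
    rfl

theorem dirichlet_eq_inner (φ ψ : D.testSpace) :
    dirichlet φ.1 ψ.1 = inner ℂ (D.gradMap (D.testJet ⟨_, ψ.2.conj⟩)) (D.gradMap (D.testJet φ)) := by
  rw [inner_gradMap, dirichlet, integral_add, Fin.sum_univ_two]
  · have key : ∀ i, ∫ x, dirDeriv (stdDir i) φ.1 x * dirDeriv (stdDir i) ψ.1 x =
        inner ℂ ((D.testJet ⟨_, ψ.2.conj⟩) (some i)) ((D.testJet φ) (some i)) := by
      intro i
      rw [testJet_some, inner_testToL2, testJet_some]
      refine Eq.trans (integral_of_tsupport (D := D) (f := dirDeriv (stdDir i) ψ.1)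
        (IsTest.partialDeriv ψ.2 i).2.2 _).symm ?_
      refine integral_congr_ae ?_
      filter_upwards [(φ.2.partialDeriv i).memLp.coeFn_toLp] with x hx
      change _ = ((φ.2.partialDeriv i).memLp.toLp _ : Plane → ℂ) x *
        star (SmoothDomain.partialDeriv i (fun x => star (ψ.1 x)) x)
      rw [hx, partialDeriv_conj ψ.2, star_star]
      rfl
    rw [key, key]
  · exact (φ.2.isTestOn.1.dirDeriv _).isCC.integrable_mul (ψ.2.isTestOn.1.dirDeriv _).1.continuous
  · exact (φ.2.isTestOn.1.dirDeriv _).isCC.integrable_mul (ψ.2.isTestOn.1.dirDeriv _).1.continuous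

/-! ### Regularity of weak solutions -/

/-- If a test function φ is η-close to u in the jet norm, its Dirichlet form with ψ equals the
pairing of F with ψ minus a pairing of gradients, and that last term is at most η times the gradient
norm. In the bound 3‖u‖ + δ the function and its two derivatives each contribute at most ‖u‖ + δ/3.
Conjugated test functions appear because `dirichlet` is bilinear. -/
theorem approxSol_of_weak (F : D.L2) (u : D.H10)
    (hu : ∀ v : D.H10, inner ℂ (D.gradMap v.1) (D.gradMap u.1) = inner ℂ (D.valMap v.1) F)
    {δ : ℝ} (hδ : 0 < δ) :
    ApproxSol D.carrier (D.carrier.indicator (u.1 none)) ‖F‖ (3 * ‖u‖ + δ) := by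
  refine ⟨(memLp_indicator_iff_restrict measurableSet_carrier).2 (Lp.memLp _), fun η hη => ?_⟩
  obtain ⟨φ, hφ⟩ := H10.exists_approx u (lt_min hη (by positivity : 0 < δ / 3))
  have h1 := hφ.le.trans (min_le_left _ _)
  have h2 := hφ.le.trans (min_le_right _ _)
  refine ⟨φ.1, φ.2.isTestOn, ?_, ?_, fun ψ hψ => ?_⟩
  · have e1 : (fun x => D.carrier.indicator (u.1 none) x - φ.1 x) =
        D.carrier.indicator (fun x => u.1 none x - φ.1 x) := by
      ext x
      by_cases hx : x ∈ D.carrier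
      · rw [Set.indicator_of_mem hx, Set.indicator_of_mem hx]
      · rw [Set.indicator_of_notMem hx, Set.indicator_of_notMem hx,
          image_eq_zero_of_notMem_tsupport fun hx' => hx (φ.2.2.2 hx'), sub_zero]
    rw [nrm, e1, eLpNorm_indicator_eq_eLpNorm_restrict measurableSet_carrier]
    change (eLpNorm _ 2 D.μ).toReal ≤ η
    rw [eLpNorm_sub_test _ φ.2.memLp, ENNReal.toReal_ofReal (norm_nonneg _)]
    exact (PiLp.norm_apply_le (u.1 - D.testJet φ) none).trans h1
  · have a0 := PiLp.norm_apply_le (D.testJet φ) none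
    have a1 := PiLp.norm_apply_le (D.testJet φ) (some 0)
    have a2 := PiLp.norm_apply_le (D.testJet φ) (some 1)
    rw [testJet_none, norm_testToL2] at a0
    rw [testJet_some, norm_testToL2] at a1 a2
    have a3 : ‖D.testJet φ‖ ≤ ‖u.1‖ + ‖u.1 - D.testJet φ‖ := by
      calc ‖D.testJet φ‖ = ‖u.1 - (u.1 - D.testJet φ)‖ := by congr 1; abel
        _ ≤ _ := norm_sub_le _ _
    have a1' : nrm (dirDeriv (stdDir 0) φ.1) ≤ ‖D.testJet φ‖ := a1
    have a2' : nrm (dirDeriv (stdDir 1) φ.1) ≤ ‖D.testJet φ‖ := a2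
    have a4 : ‖u.1‖ = ‖u‖ := rfl
    unfold gnrm
    linarith
  · set χ : D.testSpace := ⟨_, (isTest_iff.2 hψ).conj⟩
    have e1 : dirichlet φ.1 ψ = inner ℂ (D.gradMap (D.testJet χ)) (D.gradMap (D.testJet φ)) :=
      dirichlet_eq_inner φ ⟨ψ, isTest_iff.2 hψ⟩
    have e2 := hu ⟨_, testJet_mem χ⟩
    have e3 : inner ℂ (D.gradMap (D.testJet χ)) (D.gradMap (D.testJet φ)) =
        inner ℂ (D.valMap (D.testJet χ)) F -
          inner ℂ (D.gradMap (D.testJet χ)) (D.gradMap (u.1 - D.testJet φ)) := by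
      rw [← e2, map_sub, inner_sub_right]
      ring
    have n1 : ‖D.valMap (D.testJet χ)‖ = nrm ψ := by
      rw [valMap_apply, testJet_none, norm_testToL2]
      exact nrm_conj ψ
    have n2 : ‖D.gradMap (D.testJet χ)‖ ≤ gnrm ψ :=
      (norm_gradMap_testJet_le χ).trans (gnrm_conj hψ.1).le
    have n3 : ‖D.gradMap (u.1 - D.testJet φ)‖ ≤ η := by
      refine le_trans ?_ h1
      have h : ‖D.gradMap (u.1 - D.testJet φ)‖ ^ 2 ≤ ‖u.1 - D.testJet φ‖ ^ 2 := by
        rw [PiLp.norm_sq_eq_of_L2, PiLp.norm_sq_eq_of_L2, Fintype.sum_option]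
        exact le_add_of_nonneg_left (by positivity)
      exact le_of_sq_le_sq h (norm_nonneg _)
    rw [e1, e3]
    refine (norm_sub_le _ _).trans (add_le_add ?_ ?_)
    · refine (norm_inner_le_norm _ _).trans (le_of_eq ?_)
      rw [n1, mul_comm]
    · refine (norm_inner_le_norm _ _).trans ?_
      rw [mul_comm η]
      exact mul_le_mul n2 n3 (norm_nonneg _) (gnrm_nonneg _)

theorem norm_H10_le {P : ℝ} (hP : ∀ U : D.H10, ‖D.valMap U.1‖ ≤ P * ‖D.gradMap U.1‖) (u : D.H10) :
    ‖u‖ ≤ (P + 2) * ‖D.gradMap u.1‖ := by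
  have h1 : ‖u‖ ≤ _ := norm_jet_le u.1
  rw [Fin.sum_univ_two] at h1
  have h2 := hP u
  rw [valMap_apply] at h2
  have h3 := PiLp.norm_apply_le (D.gradMap u.1) 0
  have h4 := PiLp.norm_apply_le (D.gradMap u.1) 1
  rw [gradMap_apply] at h3 h4
  linarith

variable (D) in
/-- `H²` regularity for the Dirichlet problem. -/
theorem exists_regularity : ∃ C, 0 ≤ C ∧ ∀ (F : D.L2) (u : D.H10),
    (∀ v : D.H10, inner ℂ (D.gradMap v.1) (D.gradMap u.1) = inner ℂ (D.valMap v.1) F) →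
    ∃ U : D.H2, D.jetL U = u.1 ∧ lap U = -F ∧ ‖U‖ ≤ C * ‖F‖ := by
  obtain ⟨C, hC, hreg⟩ := D.exists_second_deriv_bound
  obtain ⟨P, hP, hPoin⟩ := D.exists_poincare
  set Q := (P + 2) * P with hQ
  -- A common bound, per unit of ‖F‖, for all seven jet components. The factor 3 in the final
  -- constant is an upper bound for √7.
  set K := C * (1 + 3 * Q) + Q with hK
  refine ⟨3 * K, by positivity, fun F u hu => ?_⟩
  have hgrad : ‖D.gradMap u.1‖ ≤ P * ‖F‖ := by
    have h1 := hu u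
    have h2 : ‖D.gradMap u.1‖ ^ 2 ≤ P * ‖D.gradMap u.1‖ * ‖F‖ := by
      have h3 : ‖inner ℂ (D.gradMap u.1) (D.gradMap u.1)‖ = ‖D.gradMap u.1‖ ^ 2 := by
        rw [inner_self_eq_norm_sq_to_K]
        simp
      rw [← h3, h1]
      exact (norm_inner_le_norm _ _).trans (mul_le_mul_of_nonneg_right (hPoin u) (norm_nonneg _))
    by_contra hcon
    push Not at hcon
    have : 0 < ‖D.gradMap u.1‖ := lt_of_le_of_lt (by positivity) hcon
    nlinarith
  have hun : ‖u‖ ≤ Q * ‖F‖ := by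
    refine (norm_H10_le hPoin u).trans ?_
    rw [hQ, mul_assoc]
    gcongr
  have hbound : ∀ i j : Fin 2, ∀ φ, D.IsTest φ →
      ‖∫ x, u.1 (some i) x * partialDeriv j φ x ∂D.μ‖ ≤ C * (1 + 3 * Q) * ‖F‖ * nrm φ := by
    intro i j φ hφ
    have h1 : ∫ x, u.1 (some i) x * SmoothDomain.partialDeriv j φ x ∂D.μ =
        -∫ x, u.1 none x * SmoothDomain.partialDeriv i (SmoothDomain.partialDeriv j φ) x ∂D.μ := by
      rw [H10.isWeakDeriv u i _ (hφ.partialDeriv j), neg_neg]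
    have h2 : ∫ x, u.1 none x * SmoothDomain.partialDeriv i (SmoothDomain.partialDeriv j φ) x ∂D.μ =
        ∫ x, D.carrier.indicator (u.1 none) x * dirDeriv (stdDir i) (dirDeriv (stdDir j) φ) x := by
      refine Eq.trans ?_ (integral_of_tsupport (D := D) (f := dirDeriv (stdDir i)
        (dirDeriv (stdDir j) φ)) ((hφ.partialDeriv j).partialDeriv i).2.2 _)
      refine setIntegral_congr_fun measurableSet_carrier fun x hx => ?_
      simp only [Set.indicator_of_mem hx]
      rfl
    rw [h1, norm_neg, h2]
    have h3 : ∀ δ : ℝ, 0 < δ →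
        ‖∫ x, D.carrier.indicator (u.1 none) x * dirDeriv (stdDir i) (dirDeriv (stdDir j) φ) x‖ ≤
          C * (‖F‖ + (3 * ‖u‖ + δ)) * nrm φ := fun δ hδ =>
      hreg _ _ _ (norm_nonneg F) (by positivity) (approxSol_of_weak F u hu hδ) φ hφ.isTestOn _ _
        (norm_stdDir i) (norm_stdDir j)
    -- Lets the slack δ tend to 0: it is present only to make room for the approximants and would
    -- spoil a bound homogeneous in F.
    have h4 : ‖∫ x, D.carrier.indicator (u.1 none) x *
        dirDeriv (stdDir i) (dirDeriv (stdDir j) φ) x‖ ≤ C * (‖F‖ + (3 * ‖u‖ + 0)) * nrm φ := by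
      have hc : Continuous fun δ : ℝ => C * (‖F‖ + (3 * ‖u‖ + δ)) * nrm φ := by fun_prop
      refine ge_of_tendsto (hc.continuousWithinAt (s := Set.Ioi 0) (x := 0)) ?_
      filter_upwards [self_mem_nhdsWithin] with δ hδ
      exact h3 δ hδ
    refine h4.trans ?_
    refine mul_le_mul_of_nonneg_right ?_ (nrm_nonneg φ)
    rw [mul_assoc]
    refine mul_le_mul_of_nonneg_left ?_ hC
    linarith
  choose V hVn hV using fun i j : Fin 2 =>
    exists_isWeakDeriv (u.1 (some i)) j (by positivity) (hbound i j)
  let W : PiLp 2 (fun _ : Jet => D.L2) := WithLp.toLp 2 fun k =>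
    match k with
    | .inl _ => u.1 none
    | .inr (.inl i) => u.1 (some i)
    | .inr (.inr (i, j)) => V i j
  have hW : W ∈ D.H2 := ⟨fun i => H10.isWeakDeriv u i, fun i j => hV i j⟩
  refine ⟨⟨W, hW⟩, ?_, ?_, ?_⟩
  · ext1 k
    rcases k with _ | i <;> rfl
  -- The strong equation is the weak one read against test functions, which separate L².
  · rw [eq_neg_iff_add_eq_zero]
    refine eq_zero_of_integral_test _ fun φ hφ => ?_
    set χ : D.testSpace := ⟨_, hφ.conj⟩ with hχ
    have h1 : ∫ x, (lap (⟨W, hW⟩ : D.H2) + F : D.L2) x * φ x ∂D.μ =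
        ∫ x, lap (⟨W, hW⟩ : D.H2) x * φ x ∂D.μ + ∫ x, F x * φ x ∂D.μ := by
      simp only [integral_eq_inner _ hφ.memLp, inner_add_right]
    have h2 := integral_lap_mul (⟨W, hW⟩ : D.H2) hφ
    have h3 := hu ⟨_, testJet_mem χ⟩
    simp only at h3
    rw [valMap_apply, testJet_none, inner_testToL2, inner_gradMap] at h3
    rw [h1, h2, neg_add_eq_zero]
    have h4 : ∀ x, star (χ.1 x) = φ x := fun x => star_star _
    simp only [h4] at h3
    rw [← h3]
    refine Finset.sum_congr rfl fun i _ => ?_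
    rw [testJet_some, inner_testToL2]
    congr 1
    ext x
    congr 1
    change _ = star (SmoothDomain.partialDeriv i (fun x => star (φ x)) x)
    rw [partialDeriv_conj hφ, star_star]
  · have hKn : 0 ≤ K * ‖F‖ := by positivity
    have hcomp : ∀ k, ‖W k‖ ≤ K * ‖F‖ := by
      have hq : Q * ‖F‖ ≤ K * ‖F‖ := by
        gcongr
        rw [hK]
        exact le_add_of_nonneg_left (by positivity)
      rintro (_ | i | ⟨i, j⟩)
      · exact ((PiLp.norm_apply_le u.1 none).trans hun).trans hq
      · exact ((PiLp.norm_apply_le u.1 (some i)).trans hun).trans hq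
      · refine (hVn i j).trans ?_
        gcongr
        rw [hK]
        exact le_add_of_nonneg_right (by positivity)
    have h1 : ‖W‖ ^ 2 ≤ (3 * (K * ‖F‖)) ^ 2 := by
      rw [PiLp.norm_sq_eq_of_L2]
      calc ∑ k, ‖W k‖ ^ 2 ≤ ∑ _k : Jet, (K * ‖F‖) ^ 2 :=
            Finset.sum_le_sum fun k _ => by gcongr; exact hcomp k
        _ = 7 * (K * ‖F‖) ^ 2 := by simp
        _ ≤ _ := by nlinarith [sq_nonneg (K * ‖F‖)]
    have h2 : ‖W‖ ≤ 3 * (K * ‖F‖) := le_of_sq_le_sq h1 (by positivity)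
    calc ‖(⟨W, hW⟩ : D.H2)‖ = ‖W‖ := rfl
      _ ≤ _ := by linarith

end SmoothDomain


namespace SmoothDomain

variable {D : SmoothDomain}

/-! ### The resolvent equation -/

theorem re_add_I_mul (a b : ℝ) : ((a : ℂ) + Complex.I * (b : ℂ)).re = a := by simp

theorem im_add_I_mul (a b : ℝ) : ((a : ℂ) + Complex.I * (b : ℂ)).im = b := by simp

/-- `U` solves `i ξ U - ν Δ U = p` with the homogeneous Dirichlet condition. -/
def IsModeSolution (ν ξ : ℝ) (U : D.H2) (p : ℂ) : Prop :=
  VanishesOnBoundary U ∧ (Complex.I * (ξ : ℂ)) • toL2 U - (ν : ℂ) • lap U = D.const p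

variable (D) in
-- By Green's formula U is itself a weak solution with right-hand side -ΔU. The H² function supplied
-- by regularity has the same underlying L² function, so it is U and inherits the bound.
theorem exists_norm_le_lap :
    ∃ C, 0 ≤ C ∧ ∀ U : D.H2, VanishesOnBoundary U → ‖U‖ ≤ C * ‖lap U‖ := by
  obtain ⟨C, hC, h⟩ := D.exists_regularity
  refine ⟨C, hC, fun U hU => ?_⟩
  obtain ⟨V, hV, -, hVn⟩ := h (-lap U) ⟨D.jetL U, vanishesOnBoundary_iff.1 hU⟩ fun v => by
    rw [inner_neg_right, valMap_apply, inner_lap, neg_neg]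
  have hUV : U = V := eq_of_toL2_eq (by rw [← jetL_none U, ← jetL_none V, hV])
  rw [norm_neg] at hVn
  rwa [← hUV] at hVn

/-- Lax–Milgram: the form ν(∇v,∇u) + iξ(v,u) on `H10` is coercive because the ξ-term is imaginary on
the diagonal. The weak solution then satisfies -Δu = ν⁻¹(1 - iξu), to which the regularity theorem
applies. -/
theorem exists_mode {ν : ℝ} (hν : 0 < ν) (ξ : ℝ) : ∃ U : D.H2, IsModeSolution ν ξ U 1 := by
  obtain ⟨P, hP, hPoin⟩ := D.exists_poincare
  obtain ⟨C, -, hreg⟩ := D.exists_regularity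
  let G : D.H10 →L[ℂ] PiLp 2 (fun _ : Fin 2 => D.L2) := D.gradMap.comp D.H10.subtypeL
  let ι : D.H10 →L[ℂ] D.L2 := D.valMap.comp D.H10.subtypeL
  let B : D.H10 →L[ℂ] D.H10 := G.adjoint.comp ((ν : ℂ) • G) +
    ι.adjoint.comp ((Complex.I * (ξ : ℂ)) • ι)
  have hB : ∀ v u : D.H10, inner ℂ v (B u) = (ν : ℂ) * inner ℂ (G v) (G u) +
      (Complex.I * (ξ : ℂ)) * inner ℂ (ι v) (ι u) := by
    intro v u
    change inner ℂ v (G.adjoint ((ν : ℂ) • G u) + ι.adjoint ((Complex.I * (ξ : ℂ)) • ι u)) = _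
    rw [inner_add_right, ContinuousLinearMap.adjoint_inner_right,
      ContinuousLinearMap.adjoint_inner_right, inner_smul_right, inner_smul_right]
  have hunit : IsUnit B := by
    have hc : 0 < ν / (P + 2) ^ 2 := by positivity
    refine ContinuousLinearMap.isUnit_of_forall_le_norm_inner_map B (c := ⟨_, hc.le⟩) hc
      fun u => ?_
    rw [← norm_inner_symm, hB, inner_self_eq_norm_sq_to_K, inner_self_eq_norm_sq_to_K]
    refine le_trans ?_ (Complex.abs_re_le_norm _)
    have e : ((ν : ℂ) * ((‖G u‖ : ℝ) : ℂ) ^ 2 +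
        (Complex.I * (ξ : ℂ)) * ((‖ι u‖ : ℝ) : ℂ) ^ 2).re = ν * ‖G u‖ ^ 2 := by
      rw [← re_add_I_mul (ν * ‖G u‖ ^ 2) (ξ * ‖ι u‖ ^ 2)]
      push_cast
      ring_nf
    refine le_trans ?_ (le_of_eq (congrArg abs e.symm))
    rw [abs_of_nonneg (by positivity)]
    have h1 : ‖u‖ ^ 2 ≤ ((P + 2) * ‖G u‖) ^ 2 := by
      gcongr
      exact norm_H10_le hPoin u
    change ‖u‖ ^ 2 * (ν / (P + 2) ^ 2) ≤ _
    rw [mul_div_assoc', div_le_iff₀ (by positivity)]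
    nlinarith
  obtain ⟨u, hu⟩ : ∃ u, B u = ι.adjoint (D.const 1) := by
    obtain ⟨b, hb⟩ := hunit.exists_right_inv
    exact ⟨b (ι.adjoint (D.const 1)), congrArg (fun T : D.H10 →L[ℂ] D.H10 => T _) hb⟩
  have hν' : (ν : ℂ) ≠ 0 := by exact_mod_cast hν.ne'
  obtain ⟨U, hU, hlap, -⟩ := hreg
    ((ν : ℂ)⁻¹ • (D.const 1 - (Complex.I * (ξ : ℂ)) • ι u)) u fun v => by
      have h := hB v u
      rw [hu, ContinuousLinearMap.adjoint_inner_right] at h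
      rw [inner_smul_right, inner_sub_right, inner_smul_right]
      change inner ℂ (G v) (G u) = (ν : ℂ)⁻¹ * (inner ℂ (ι v) _ - _ * inner ℂ (ι v) (ι u))
      rw [h]
      field_simp
      ring
  refine ⟨U, vanishesOnBoundary_iff.2 (hU ▸ u.2), ?_⟩
  have h1 : toL2 U = ι u := by rw [← jetL_none, hU]; rfl
  rw [hlap, h1, smul_neg, smul_smul, mul_inv_cancel₀ hν', one_smul]
  abel

/-- The energy identity. -/
theorem IsModeSolution.energy {ν ξ : ℝ} {U : D.H2} {p : ℂ} (h : IsModeSolution ν ξ U p) :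
    p * star (flux U) = ((ν * ‖D.gradMap (D.jetL U)‖ ^ 2 : ℝ) : ℂ) +
      Complex.I * ((ξ * ‖toL2 U‖ ^ 2 : ℝ) : ℂ) := by
  have h1 := integral_mul_const_eq_inner (toL2 U) p
  have h2 := inner_lap U ⟨D.jetL U, vanishesOnBoundary_iff.1 h.1⟩
  simp only [jetL_none] at h2
  rw [← h.2, inner_sub_right, inner_smul_right, inner_smul_right, h2, inner_self_eq_norm_sq_to_K,
    inner_self_eq_norm_sq_to_K] at h1
  change _ = p * star (flux U) at h1
  rw [← h1]
  push_cast
  simp only [Complex.coe_algebraMap]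
  ring

variable (D) in
theorem exists_test_integral_eq_one : ∃ θ, D.IsTest θ ∧ ∫ x, θ x = 1 := by
  obtain ⟨x₀, hx₀⟩ := D.isConnected.nonempty
  obtain ⟨r, hr, hrD⟩ := Metric.isOpen_iff.1 D.isOpen x₀ hx₀
  let b : ContDiffBump x₀ := ⟨r / 4, r / 2, by positivity, by linarith⟩
  have hsub : tsupport (fun x => ((b.normed volume x : ℝ) : ℂ)) ⊆ tsupport (b.normed volume) :=
    closure_mono fun x hx => by simpa using hx
  refine ⟨fun x => ((b.normed volume x : ℝ) : ℂ),
    ⟨Complex.ofRealCLM.contDiff.comp b.contDiff_normed,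
      b.hasCompactSupport_normed.comp_left (g := fun z : ℝ => (z : ℂ)) (by simp), ?_⟩, ?_⟩
  · refine (hsub.trans ?_).trans hrD
    rw [b.tsupport_normed_eq]
    exact Metric.closedBall_subset_ball (by change r / 2 < r; linarith)
  · rw [integral_complex_ofReal, b.integral_normed]
    simp

theorem norm_integral_mul_test_le (a : D.L2) {ψ : Plane → ℂ} (hψ : D.IsTest ψ) :
    ‖∫ x, a x * ψ x ∂D.μ‖ ≤ ‖a‖ * nrm ψ := by
  have h := norm_inner_le_norm (𝕜 := ℂ) (D.testToL2 ⟨_, hψ.conj⟩) a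
  rw [← integral_mul_test a ⟨ψ, hψ⟩, norm_testToL2] at h
  refine h.trans (le_of_eq ?_)
  rw [mul_comm]
  congr 1
  exact nrm_conj ψ

variable (D) in
-- Testing the equation against a fixed θ of integral one isolates p. Both derivatives of the
-- Laplacian move onto θ, so only the L² norm of U enters and T depends on θ alone.
theorem exists_norm_pressure_le : ∃ T, 0 < T ∧ ∀ (ν ξ : ℝ) (U : D.H2) (p : ℂ), 0 < ν →
    IsModeSolution ν ξ U p → ‖p‖ ≤ T * (ν + |ξ|) * ‖toL2 U‖ := by
  obtain ⟨θ, hθ, hθ1⟩ := D.exists_test_integral_eq_one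
  obtain ⟨S, hS⟩ : ∃ S, S = ∑ i, nrm (SmoothDomain.partialDeriv i (SmoothDomain.partialDeriv i θ)) :=
    ⟨_, rfl⟩
  have hS0 : 0 ≤ S := hS ▸ Finset.sum_nonneg fun i _ => nrm_nonneg _
  have hθ0 := nrm_nonneg θ
  refine ⟨nrm θ + S + 1, by linarith, fun ν ξ U p hν h => ?_⟩
  have h1 : p = (Complex.I * (ξ : ℂ)) * ∫ x, toL2 U x * θ x ∂D.μ -
      (ν : ℂ) * ∫ x, lap U x * θ x ∂D.μ := by
    have e := integral_const_mul_test (D := D) p θ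
    have e1 := integral_of_tsupport hθ.2.2 (D := D) (fun _ => 1)
    simp only [one_mul] at e1
    rw [e1, hθ1, mul_one, ← h.2] at e
    rw [← e]
    simp only [integral_eq_inner _ hθ.memLp, inner_sub_right, inner_smul_right]
  have h2 : ‖∫ x, lap U x * θ x ∂D.μ‖ ≤ ‖toL2 U‖ * S := by
    rw [integral_lap_mul U hθ, norm_neg, hS, Finset.mul_sum]
    refine (norm_sum_le _ _).trans (Finset.sum_le_sum fun i _ => ?_)
    have h3 : ∫ x, toL2 U x * SmoothDomain.partialDeriv i (SmoothDomain.partialDeriv i θ) x ∂D.μ =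
        -∫ x, grad U i x * SmoothDomain.partialDeriv i θ x ∂D.μ := U.2.1 i _ (hθ.partialDeriv i)
    rw [← norm_neg, ← h3]
    exact norm_integral_mul_test_le _ ((hθ.partialDeriv i).partialDeriv i)
  have h3 := norm_integral_mul_test_le (toL2 U) hθ
  calc ‖p‖ ≤ |ξ| * (‖toL2 U‖ * nrm θ) + ν * (‖toL2 U‖ * S) := by
        rw [h1]
        refine (norm_sub_le _ _).trans ?_
        rw [norm_mul, norm_mul, norm_mul, Complex.norm_I, one_mul, Complex.norm_real,
          Complex.norm_real, Real.norm_eq_abs, Real.norm_of_nonneg hν.le]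
        gcongr
    _ ≤ (nrm θ + S + 1) * (ν + |ξ|) * ‖toL2 U‖ := by
        have : 0 ≤ ν * nrm θ + |ξ| * S + (ν + |ξ|) := by positivity
        nlinarith [mul_nonneg this (norm_nonneg (toL2 U))]

variable (D) in
/-- Bounds for the modes in terms of their flux. -/
theorem exists_mode_bound : ∃ c, 0 < c ∧ ∀ (ν ξ : ℝ) (U : D.H2) (p : ℂ), 0 < ν →
    IsModeSolution ν ξ U p →
    ‖toL2 U‖ ≤ c * ‖flux U‖ ∧ ‖p‖ + |ξ| * ‖toL2 U‖ ≤ c * (ν + |ξ|) * ‖flux U‖ ∧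
      ‖lap U‖ ≤ c * (1 + |ξ| / ν) * ‖flux U‖ := by
  obtain ⟨T, hT, hp⟩ := D.exists_norm_pressure_le
  obtain ⟨P, hP, hPoin⟩ := D.exists_poincare
  set K := (1 + P ^ 2) * T with hK
  set N := ‖D.const 1‖ with hN
  have hN0 : 0 ≤ N := norm_nonneg _
  have hK0 : 0 < K := by positivity
  refine ⟨K + T * K + T * K * N, by positivity, fun ν ξ U p hν h => ?_⟩
  have hp := hp ν ξ U p hν h
  set a := ‖toL2 U‖
  have ha : 0 ≤ a := norm_nonneg _
  set F := ‖flux U‖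
  have hF : 0 ≤ F := norm_nonneg _
  set g := ‖D.gradMap (D.jetL U)‖
  have hg : a ≤ P * g := hPoin ⟨D.jetL U, vanishesOnBoundary_iff.1 h.1⟩
  have he := h.energy
  have hen : ‖p * star (flux U)‖ = ‖p‖ * F := by rw [norm_mul, norm_star]
  have e1 : ν * g ^ 2 ≤ ‖p‖ * F := by
    rw [← hen]
    refine le_trans (le_of_eq ?_) (Complex.re_le_norm _)
    rw [he, re_add_I_mul]
  have e2 : |ξ| * a ^ 2 ≤ ‖p‖ * F := by
    rw [← hen]
    refine le_trans (le_of_eq ?_) (Complex.abs_im_le_norm _)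
    have : (p * star (flux U)).im = ξ * a ^ 2 := by
      rw [he, im_add_I_mul]
    rw [this, abs_mul, abs_of_nonneg (sq_nonneg a)]
  have hx : 0 < ν + |ξ| := by positivity
  -- The real part of the energy identity, with Poincaré, controls νa²; the imaginary part controls
  -- |ξ|a².
  have e3 : (ν + |ξ|) * a ^ 2 ≤ (1 + P ^ 2) * (‖p‖ * F) := by
    have : ν * a ^ 2 ≤ P ^ 2 * (ν * g ^ 2) := by
      have : a ^ 2 ≤ (P * g) ^ 2 := by gcongr
      nlinarith
    nlinarith [mul_le_mul_of_nonneg_left e1 (sq_nonneg P)]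
  -- Inserting ‖p‖ ≤ T(ν + |ξ|)a into `e3`, the factor (ν + |ξ|)a cancels from both sides. This is
  -- why K depends neither on ν nor on ξ.
  have ha' : a ≤ K * F := by
    by_contra hcon
    push Not at hcon
    have ha0 : 0 < a := lt_of_le_of_lt (by positivity) hcon
    have e4 : (ν + |ξ|) * a ^ 2 ≤ (ν + |ξ|) * (a * (K * F)) := by
      refine e3.trans ?_
      have := mul_le_mul_of_nonneg_left (mul_le_mul_of_nonneg_right hp hF)
        (by positivity : 0 ≤ 1 + P ^ 2)
      refine this.trans (le_of_eq ?_)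
      rw [hK]; ring
    have := le_of_mul_le_mul_left e4 hx
    nlinarith
  have hp' : ‖p‖ ≤ T * K * (ν + |ξ|) * F := by
    refine hp.trans ?_
    calc T * (ν + |ξ|) * a ≤ T * (ν + |ξ|) * (K * F) := by gcongr
      _ = _ := by ring
  have hl : ν * ‖lap U‖ ≤ |ξ| * a + ‖p‖ * N := by
    have e5 : (ν : ℂ) • lap U = (Complex.I * (ξ : ℂ)) • toL2 U - D.const p := by
      rw [← h.2]; abel
    have e6 : ‖(ν : ℂ) • lap U‖ = ν * ‖lap U‖ := by
      rw [norm_smul, Complex.norm_real, Real.norm_of_nonneg hν.le]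
    rw [← e6, e5]
    refine (norm_sub_le _ _).trans (le_of_eq ?_)
    rw [const_eq_smul, norm_smul, norm_smul, norm_mul, Complex.norm_I, one_mul, Complex.norm_real,
      Real.norm_eq_abs]
  refine ⟨ha'.trans ?_, ?_, ?_⟩
  · gcongr
    have : 0 ≤ T * K + T * K * N := by positivity
    linarith
  · have : |ξ| * a ≤ K * (ν + |ξ|) * F := by
      calc |ξ| * a ≤ (ν + |ξ|) * (K * F) := by gcongr; linarith
        _ = _ := by ring
    have h0 : 0 ≤ T * K * N * (ν + |ξ|) * F := by positivity
    linarith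
  · have e7 : ν * ‖lap U‖ ≤ ν * ((K + T * K + T * K * N) * (1 + |ξ| / ν) * F) := by
      have e8 : ν * ((K + T * K + T * K * N) * (1 + |ξ| / ν) * F) =
          (K + T * K + T * K * N) * (ν + |ξ|) * F := by field_simp
      rw [e8]
      have e9 : |ξ| * a ≤ K * (ν + |ξ|) * F := by
        calc |ξ| * a ≤ (ν + |ξ|) * (K * F) := by gcongr; linarith
          _ = _ := by ring
      have e10 := mul_le_mul_of_nonneg_right hp' hN0
      have h0 : 0 ≤ T * K * (ν + |ξ|) * F := by positivity
      linarith
    exact le_of_mul_le_mul_left e7 hν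

theorem const_injective {p q : ℂ} (h : D.const p = D.const q) : p = q := by
  obtain ⟨θ, hθ, hθ1⟩ := D.exists_test_integral_eq_one
  have e1 := integral_of_tsupport hθ.2.2 (D := D) (fun _ => 1)
  simp only [one_mul] at e1
  have hp := integral_const_mul_test (D := D) p θ
  have hq := integral_const_mul_test (D := D) q θ
  rw [e1, hθ1, mul_one] at hp hq
  rw [← hp, ← hq, h]

/-- A mode is determined by its flux. -/
theorem IsModeSolution.eq_zero {ν ξ : ℝ} (hν : 0 < ν) {U : D.H2} {p : ℂ}
    (h : IsModeSolution ν ξ U p) (hf : flux U = 0) : U = 0 ∧ p = 0 := by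
  obtain ⟨c, -, hc⟩ := D.exists_mode_bound
  obtain ⟨h1, h2, -⟩ := hc ν ξ U p hν h
  rw [hf, norm_zero, mul_zero] at h1 h2
  have h3 : toL2 U = 0 := norm_le_zero_iff.1 h1
  refine ⟨eq_of_toL2_eq h3, ?_⟩
  rw [h3, norm_zero, mul_zero, add_zero] at h2
  exact norm_le_zero_iff.1 h2

theorem IsModeSolution.smul {ν ξ : ℝ} {U : D.H2} {p : ℂ} (h : IsModeSolution ν ξ U p) (a : ℂ) :
    IsModeSolution ν ξ (a • U) (a * p) := by
  refine ⟨vanishesOnBoundary_iff.2 ?_, ?_⟩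
  · rw [map_smul]
    exact D.H10.smul_mem _ (vanishesOnBoundary_iff.1 h.1)
  · rw [← toL2L_apply, ← lapL_apply, map_smul, map_smul, toL2L_apply, lapL_apply, const_eq_smul (a * p),
      mul_smul a p, ← const_eq_smul, ← h.2, smul_sub, smul_comm a, smul_comm a (ν : ℂ)]

theorem IsModeSolution.sub {ν ξ : ℝ} {U V : D.H2} {p q : ℂ} (h : IsModeSolution ν ξ U p)
    (h' : IsModeSolution ν ξ V q) : IsModeSolution ν ξ (U - V) (p - q) := by
  refine ⟨vanishesOnBoundary_iff.2 ?_, ?_⟩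
  · rw [map_sub]
    exact D.H10.sub_mem (vanishesOnBoundary_iff.1 h.1) (vanishesOnBoundary_iff.1 h'.1)
  · rw [← toL2L_apply, ← lapL_apply, map_sub, map_sub, toL2L_apply, lapL_apply, toL2L_apply,
      lapL_apply, const_sub, ← h.2, ← h'.2, smul_sub, smul_sub]
    abel

/-- The resolvent problem with prescribed flux is solvable. -/
theorem exists_mode_of_flux {ν : ℝ} (hν : 0 < ν) (ξ : ℝ) (a : ℂ) :
    ∃ (U : D.H2) (p : ℂ), IsModeSolution ν ξ U p ∧ flux U = a := by
  obtain ⟨U, hU⟩ := exists_mode (D := D) hν ξ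
  -- Zero flux would force the pressure, here equal to 1, to vanish.
  have hf : flux U ≠ 0 := fun h => one_ne_zero (hU.eq_zero hν h).2
  refine ⟨(a / flux U) • U, _, hU.smul _, ?_⟩
  rw [← fluxL_apply, map_smul, fluxL_apply, smul_eq_mul, div_mul_cancel₀ _ hf]

end SmoothDomain


/-! ### Termwise differentiation, closed subspaces and conjugate coefficients -/

theorem hasDerivAt_trigSeries {X : Type*} [NormedAddCommGroup X] [NormedSpace ℂ X] [CompleteSpace X]
    {c : ℝ → X} (hc : Summable fun ξ => ‖c ξ‖) (hc' : Summable fun ξ => |ξ| * ‖c ξ‖) (t : ℝ) :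
    HasDerivAt (trigSeries c) (trigSeries (fun ξ => (Complex.I * (ξ : ℂ)) • c ξ) t) t := by
  refine hasDerivAt_tsum (g := fun ξ t => bohrChar ξ t • c ξ)
    (g' := fun ξ t => bohrChar ξ t • (Complex.I * (ξ : ℂ)) • c ξ) (y₀ := t) hc' (fun ξ s => ?_)
    (fun ξ s => ?_) (summable_trigSeries hc t) t
  · have := (hasDerivAt_bohrChar ξ s).smul_const (c ξ)
    rwa [mul_comm, mul_smul] at this
  · rw [norm_bohrChar_smul, norm_smul, norm_mul, Complex.norm_I, one_mul, Complex.norm_real,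
      Real.norm_eq_abs]

theorem hasSum_mem_of_isClosed {X : Type*} [NormedAddCommGroup X] [NormedSpace ℂ X]
    {S : Submodule ℂ X} (hS : IsClosed (S : Set X)) {ι : Type*} {f : ι → X} {a : X}
    (h : HasSum f a) (hf : ∀ i, f i ∈ S) : a ∈ S :=
  hS.mem_of_tendsto h (Eventually.of_forall fun _ => S.sum_mem fun i _ => hf i)

theorem HasBohrCoeff.star {f : ℝ → ℂ} {ξ : ℝ} {a : ℂ} (h : HasBohrCoeff f ξ a) :
    HasBohrCoeff (fun t => star (f t)) (-ξ) (star a) := by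
  unfold HasBohrCoeff at *
  refine ((continuous_star.tendsto a).comp h).congr fun R => ?_
  have e : ∫ t in (-R)..R, bohrChar (- -ξ) t • Star.star (f t) =
      Star.star (∫ t in (-R)..R, bohrChar (-ξ) t • f t) := by
    simp only [intervalIntegral, Complex.star_def, map_sub, ← integral_conj, smul_eq_mul, map_mul,
      bohrChar_neg, Complex.conj_conj]
  rw [e, Function.comp, star_smul]
  simp

namespace SmoothDomain

variable {D : SmoothDomain}

variable (D) in
/-- Constant functions. -/
def constL : ℂ →L[ℂ] D.L2 := ContinuousLinearMap.toSpanSingleton ℂ (D.const 1)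

theorem constL_apply (p : ℂ) : D.constL p = D.const p := by
  rw [const_eq_smul]; rfl

/-! ### Superposition of modes -/

section Superposition

variable {ν : ℝ} {U : ℝ → D.H2} {p : ℝ → ℂ}

theorem vanishesOnBoundary_trigSeries (hU : Summable fun ξ => ‖U ξ‖)
    (h : ∀ ξ, VanishesOnBoundary (U ξ)) (t : ℝ) : VanishesOnBoundary (trigSeries U t) := by
  rw [vanishesOnBoundary_iff]
  have hs := (summable_trigSeries hU t).hasSum.mapL D.jetL
  refine hasSum_mem_of_isClosed (Submodule.isClosed_topologicalClosure _) hs fun ξ => ?_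
  rw [map_smul]
  exact D.H10.smul_mem _ (vanishesOnBoundary_iff.1 (h ξ))

theorem summable_toL2 (hU : Summable fun ξ => ‖U ξ‖) : Summable fun ξ => ‖toL2 (U ξ)‖ :=
  hU.of_nonneg_of_le (fun _ => norm_nonneg _)
    fun ξ => PiLp.norm_apply_le (p := 2) (U ξ).1 (Sum.inl ())

theorem summable_deriv (hU' : Summable fun ξ => |ξ| * ‖toL2 (U ξ)‖) :
    Summable fun ξ : ℝ => ‖(Complex.I * (ξ : ℂ)) • toL2 (U ξ)‖ := by
  simpa only [norm_smul, norm_mul, Complex.norm_I, one_mul, Complex.norm_real,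
    Real.norm_eq_abs] using hU'

theorem trigSeries_equation (hU : Summable fun ξ => ‖U ξ‖)
    (hU' : Summable fun ξ => |ξ| * ‖toL2 (U ξ)‖) (hp : Summable fun ξ => ‖p ξ‖)
    (h : ∀ ξ, IsModeSolution ν ξ (U ξ) (p ξ)) (t : ℝ) :
    trigSeries (fun ξ => (Complex.I * (ξ : ℂ)) • toL2 (U ξ)) t - (ν : ℂ) • lap (trigSeries U t) =
      D.const (trigSeries p t) := by
  have h1 := (summable_trigSeries (summable_deriv hU') t).hasSum
  have h2 := ((summable_trigSeries hU t).hasSum.mapL D.lapL).const_smul (ν : ℂ)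
  have h3 : HasSum (fun ξ => D.constL (bohrChar ξ t • p ξ)) (D.constL (trigSeries p t)) :=
    (summable_trigSeries hp t).hasSum.mapL D.constL
  have h4 := h1.sub h2
  rw [← lapL_apply, ← constL_apply]
  refine h4.unique ?_
  convert h3 using 1
  ext1 ξ
  rw [map_smul, map_smul, lapL_apply, constL_apply, ← (h ξ).2, smul_comm (ν : ℂ), ← smul_sub]

theorem flux_trigSeries (hU : Summable fun ξ => ‖U ξ‖) (t : ℝ) :
    flux (trigSeries U t) = ∑' ξ, flux (U ξ) * bohrChar ξ t := by
  rw [← fluxL_apply, map_trigSeries hU, trigSeries]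
  simp only [fluxL_apply, smul_eq_mul, mul_comm]

theorem isBohrSolution_trigSeries (hU : Summable fun ξ => ‖U ξ‖)
    (hU' : Summable fun ξ => |ξ| * ‖toL2 (U ξ)‖) (hp : Summable fun ξ => ‖p ξ‖)
    (h : ∀ ξ, IsModeSolution ν ξ (U ξ) (p ξ)) :
    IsBohrSolution D ν (fun t => ∑' ξ, flux (U ξ) * bohrChar ξ t) (trigSeries U)
      (trigSeries p) := by
  refine ⟨isBohrAP_trigSeries hU, isBohrAP_trigSeries hp,
    trigSeries fun ξ => (Complex.I * (ξ : ℂ)) • toL2 (U ξ),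
    isBohrAP_trigSeries (summable_deriv hU'), fun t => ⟨?_,
      vanishesOnBoundary_trigSeries hU (fun ξ => (h ξ).1) t, trigSeries_equation hU hU' hp h t,
      flux_trigSeries hU t⟩⟩
  have e : (fun s => toL2 (trigSeries U s)) = trigSeries fun ξ => toL2 (U ξ) :=
    funext fun s => map_trigSeries hU D.toL2L s
  rw [e]
  exact hasDerivAt_trigSeries (summable_toL2 hU) hU' t

/-- The differential equation holds at every time, so its defect is the zero function. Only the flux
needs comparing through coefficients, since nothing is assumed here about the pointwise values of f.
-/
theorem isBesicovitchSolution_trigSeries {f : ℝ → ℂ} (hf : LocallyIntegrable f volume)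
    (hff : ∀ ξ, HasBohrCoeff f ξ (flux (U ξ))) (hU : Summable fun ξ => ‖U ξ‖)
    (hU' : Summable fun ξ => |ξ| * ‖toL2 (U ξ)‖) (hp : Summable fun ξ => ‖p ξ‖)
    (h : ∀ ξ, IsModeSolution ν ξ (U ξ) (p ξ)) :
    IsBesicovitchSolution D ν f (trigSeries U) (trigSeries p) := by
  have hloc := (isBesicovitch_trigSeries hU).locallyIntegrable
  refine ⟨isBesicovitch_trigSeries hU, isBesicovitch_trigSeries hp, fun ξ a ha => ?_,
    ⟨_, isBesicovitch_trigSeries (summable_deriv hU'), fun ξ a ha => ?_, fun ξ => ?_⟩, fun ξ => ?_⟩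
  · rw [ha.unique (hasBohrCoeff_trigSeries hU ξ)]
    exact (h ξ).1
  · rw [ha.unique (hasBohrCoeff_trigSeries hU ξ)]
    exact hasBohrCoeff_trigSeries (summable_deriv hU') ξ
  · simp only [trigSeries_equation hU hU' hp h, sub_self]
    exact hasBohrCoeff_zero ξ
  · have h1 := (hasBohrCoeff_trigSeries hU ξ).map hloc D.fluxL
    simp only [fluxL_apply] at h1
    have h2 : Continuous fun t => flux (trigSeries U t) := by
      simp only [← fluxL_apply]
      exact D.fluxL.continuous.comp (continuous_trigSeries hU)
    simpa using h1.sub (hff ξ) h2.locallyIntegrable hf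

end Superposition

/-! ### Uniqueness -/

theorem LocallyIntegrable.map_clm {X Y : Type*} [NormedAddCommGroup X] [NormedSpace ℂ X]
    [NormedAddCommGroup Y] [NormedSpace ℂ Y] {f : ℝ → X} (hf : LocallyIntegrable f volume)
    (L : X →L[ℂ] Y) : LocallyIntegrable (fun t => L (f t)) volume := fun t => by
  obtain ⟨s, hs, h⟩ := hf t
  exact ⟨s, hs, L.integrable_comp h⟩

/-- The Fourier coefficients of a Besicovitch solution are modes. -/
theorem IsBesicovitchSolution.exists_mode {ν : ℝ} {f : ℝ → ℂ} {w : ℝ → D.H2} {π : ℝ → ℂ}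
    (h : IsBesicovitchSolution D ν f w π) (hf : LocallyIntegrable f volume) {ξ : ℝ} {a : ℂ}
    (ha : HasBohrCoeff f ξ a) :
    ∃ U p, HasBohrCoeff w ξ U ∧ HasBohrCoeff π ξ p ∧ IsModeSolution ν ξ U p ∧ flux U = a := by
  obtain ⟨hw, hπ, hb, ⟨wt, hwt, hwtc, heq⟩, hfl⟩ := h
  obtain ⟨U, hU⟩ := hw.exists_coeff ξ
  obtain ⟨p, hp⟩ := hπ.exists_coeff ξ
  have lw := hw.locallyIntegrable
  have llap := LocallyIntegrable.map_clm lw D.lapL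
  have lflux := LocallyIntegrable.map_clm lw D.fluxL
  have lconst := LocallyIntegrable.map_clm hπ.locallyIntegrable D.constL
  refine ⟨U, p, hU, hp, ⟨hb ξ U hU, ?_⟩, ?_⟩
  · have h1 := (hU.map lw D.lapL).const_smul (ν : ℂ)
    have h2 := (hwtc ξ U hU).sub h1 hwt.locallyIntegrable (llap.smul (ν : ℂ))
    have h3 := h2.sub (hp.map hπ.locallyIntegrable D.constL)
      (hwt.locallyIntegrable.sub (llap.smul (ν : ℂ))) lconst
    simp only [lapL_apply, constL_apply] at h3
    exact sub_eq_zero.1 (h3.unique (heq ξ))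
  · have h1 := (hU.map lw D.fluxL).sub ha lflux hf
    simp only [fluxL_apply] at h1
    exact sub_eq_zero.1 (h1.unique (hfl ξ))

/-- At each frequency both solutions have modes of the same flux, and the difference of two such
modes is a mode of zero flux. -/
theorem IsBesicovitchSolution.apEquiv {ν : ℝ} (hν : 0 < ν) {f fhat : ℝ → ℂ}
    (hf : LocallyIntegrable f volume) (hfhat : ∀ ξ, HasBohrCoeff f ξ (fhat ξ)) {w w' : ℝ → D.H2}
    {π π' : ℝ → ℂ} (h : IsBesicovitchSolution D ν f w π)
    (h' : IsBesicovitchSolution D ν f w' π') : ApEquiv w' w ∧ ApEquiv π' π := by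
  have key : ∀ ξ, ∃ U p, HasBohrCoeff w ξ U ∧ HasBohrCoeff π ξ p ∧ HasBohrCoeff w' ξ U ∧
      HasBohrCoeff π' ξ p := by
    intro ξ
    obtain ⟨U, p, hU, hp, hm, hfl⟩ := h.exists_mode hf (hfhat ξ)
    obtain ⟨U', p', hU', hp', hm', hfl'⟩ := h'.exists_mode hf (hfhat ξ)
    obtain ⟨h1, h2⟩ := (hm.sub hm').eq_zero hν (by
      rw [← fluxL_apply, map_sub, fluxL_apply, fluxL_apply, hfl, hfl', sub_self])
    exact ⟨U, p, hU, hp, sub_eq_zero.1 h1 ▸ hU', sub_eq_zero.1 h2 ▸ hp'⟩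
  refine ⟨fun ξ => ?_, fun ξ => ?_⟩
  · obtain ⟨U, p, h1, -, h2, -⟩ := key ξ
    simpa using h2.sub h1 h'.1.locallyIntegrable h.1.locallyIntegrable
  · obtain ⟨U, p, -, h1, -, h2⟩ := key ξ
    simpa using h2.sub h1 h'.2.1.locallyIntegrable h.2.1.locallyIntegrable

/-- A bounded nonnegative function on the line that decays exponentially vanishes. -/
theorem eq_zero_of_hasDerivAt_le {E E' : ℝ → ℝ} {κ M : ℝ} (hκ : 0 < κ) (h0 : ∀ t, 0 ≤ E t)
    (hM : ∀ t, E t ≤ M) (hE : ∀ t, HasDerivAt E (E' t) t) (hE' : ∀ t, E' t ≤ -κ * E t) (t : ℝ) :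
    E t = 0 := by
  have hd : ∀ s, HasDerivAt (fun s => Real.exp (κ * s) * E s)
      (Real.exp (κ * s) * κ * E s + Real.exp (κ * s) * E' s) s := fun s => by
    have h1 : HasDerivAt (fun s => Real.exp (κ * s)) (Real.exp (κ * s) * κ) s := by
      simpa using ((hasDerivAt_id s).const_mul κ).exp
    exact h1.mul (hE s)
  have hanti : Antitone fun s => Real.exp (κ * s) * E s := by
    refine antitone_of_hasDerivAt_nonpos hd fun s => ?_
    have := mul_le_mul_of_nonneg_left (hE' s) (Real.exp_pos (κ * s)).le
    change _ ≤ (0 : ℝ)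
    linarith
  -- The function exp(κs)E(s) is nonincreasing, and boundedness of E makes it tend to 0 as s → -∞;
  -- so it is never positive.
  have hlim : Tendsto (fun s => Real.exp (κ * s) * M) atBot (𝓝 (0 * M)) :=
    (Real.tendsto_exp_atBot.comp (tendsto_id.const_mul_atBot hκ)).mul_const M
  have hle : Real.exp (κ * t) * E t ≤ 0 * M := by
    refine ge_of_tendsto hlim ?_
    filter_upwards [eventually_le_atBot t] with s hs
    exact (hanti hs).trans (mul_le_mul_of_nonneg_left (hM s) (Real.exp_pos _).le)
  rw [zero_mul] at hle
  have := Real.exp_pos (κ * t)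
  nlinarith [h0 t]

/-- Energy method on the whole line. The difference of the solutions has zero flux, so it is
orthogonal to the constant pressure term; Poincaré turns the dissipation into exponential decay, and
almost periodic functions are bounded for all past times. -/
theorem IsBohrSolution.unique {ν : ℝ} (hν : 0 < ν) {g : ℝ → ℂ} {w w' : ℝ → D.H2}
    {π π' : ℝ → ℂ} (h : IsBohrSolution D ν g w π) (h' : IsBohrSolution D ν g w' π') :
    w' = w ∧ π' = π := by
  obtain ⟨P, hP, hPoin⟩ := D.exists_poincare
  obtain ⟨hw, -, wt, -, h⟩ := h
  obtain ⟨hw', -, wt', -, h'⟩ := h'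
  obtain ⟨M, hM⟩ := hw.bounded
  obtain ⟨M', hM'⟩ := hw'.bounded
  have hd : ∀ t, HasDerivAt (fun s => toL2 (w' s - w s)) (wt' t - wt t) t := fun t =>
    (h' t).1.sub (h t).1
  have hb : ∀ t, D.jetL (w' t - w t) ∈ D.H10 := fun t => by
    rw [map_sub]
    exact D.H10.sub_mem (vanishesOnBoundary_iff.1 (h' t).2.1) (vanishesOnBoundary_iff.1 (h t).2.1)
  have hfl : ∀ t, flux (w' t - w t) = 0 := fun t => by
    rw [← fluxL_apply, map_sub, fluxL_apply, fluxL_apply, (h' t).2.2.2, (h t).2.2.2, sub_self]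
  have heq : ∀ t, wt' t - wt t = (ν : ℂ) • lap (w' t - w t) + D.const (π' t - π t) := fun t => by
    rw [← lapL_apply, map_sub, lapL_apply, lapL_apply, const_sub, ← (h' t).2.2.1, ← (h t).2.2.1,
      smul_sub]
    abel
  have hin : ∀ t, inner ℂ (toL2 (w' t - w t)) (wt' t - wt t) =
      ((-(ν * ‖D.gradMap (D.jetL (w' t - w t))‖ ^ 2) : ℝ) : ℂ) := fun t => by
    have h2 := inner_lap (w' t - w t) ⟨_, hb t⟩
    rw [jetL_none] at h2
    have h3 := integral_mul_const_eq_inner (toL2 (w' t - w t)) (π' t - π t)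
    change _ = _ * star (flux (w' t - w t)) at h3
    rw [heq, inner_add_right, inner_smul_right, h2, h3, hfl, inner_self_eq_norm_sq_to_K]
    push_cast
    simp
  have hE : ∀ t, HasDerivAt (fun s => ‖toL2 (w' s - w s)‖ ^ 2)
      (-(2 * (ν * ‖D.gradMap (D.jetL (w' t - w t))‖ ^ 2))) t := fun t => by
    have h1 := (hd t).inner ℂ (hd t)
    have h2 := Complex.reCLM.hasFDerivAt.comp_hasDerivAt t h1
    have e1 : (Complex.reCLM ∘ fun s => inner ℂ (toL2 (w' s - w s)) (toL2 (w' s - w s))) =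
        fun s => ‖toL2 (w' s - w s)‖ ^ 2 := by
      ext s
      exact (norm_sq_eq_re_inner (𝕜 := ℂ) _).symm
    rw [e1, ← inner_conj_symm (wt' t - wt t), hin] at h2
    refine h2.congr_deriv ?_
    rw [Complex.reCLM_apply, Complex.add_re, Complex.conj_re, Complex.ofReal_re]
    ring
  have hzero : ∀ t, toL2 (w' t - w t) = 0 := fun t => by
    have h1 : ∀ s, ‖toL2 (w' s - w s)‖ ^ 2 ≤ (M' + M) ^ 2 := fun s => by
      gcongr
      refine (PiLp.norm_apply_le (p := 2) (w' s - w s).1 (Sum.inl ())).trans ?_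
      exact (norm_sub_le (w' s) (w s)).trans (add_le_add (hM' s) (hM s))
    have h2 := eq_zero_of_hasDerivAt_le (κ := 2 * ν / P ^ 2) (by positivity)
      (fun s => sq_nonneg ‖toL2 (w' s - w s)‖) h1 hE (fun s => ?_) t
    · exact norm_eq_zero.1 (pow_eq_zero_iff (two_ne_zero) |>.1 h2)
    · have h3 : ‖toL2 (w' s - w s)‖ ≤ P * ‖D.gradMap (D.jetL (w' s - w s))‖ := hPoin ⟨_, hb s⟩
      have h4 : ‖toL2 (w' s - w s)‖ ^ 2 ≤ (P * ‖D.gradMap (D.jetL (w' s - w s))‖) ^ 2 := by gcongr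
      rw [neg_mul, neg_le_neg_iff, div_mul_eq_mul_div, div_le_iff₀ (by positivity)]
      nlinarith
  have hw0 : ∀ t, w' t - w t = 0 := fun t => eq_of_toL2_eq (hzero t)
  -- With equal velocities the equation reduces to equality of the two pressures as constant
  -- functions on D.
  refine ⟨funext fun t => sub_eq_zero.1 (hw0 t), funext fun t => const_injective (D := D) ?_⟩
  have h1 : wt' t - wt t = 0 := by
    have := hd t
    simp only [hzero] at this
    exact this.unique (hasDerivAt_const t 0)
  have h2 := heq t
  rw [h1, hw0, ← lapL_apply, map_zero, smul_zero, zero_add, const_sub] at h2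
  exact sub_eq_zero.1 h2.symm

/-! ### Complex conjugation -/

variable (D) in
/-- Complex conjugation on `L²`. -/
def conjL : D.L2 →L[ℝ] D.L2 :=
  ContinuousLinearMap.compLpL 2 D.μ (Complex.conjCLE : ℂ →L[ℝ] ℂ)

theorem coeFn_conjL (u : D.L2) : (D.conjL u : Plane → ℂ) =ᵐ[D.μ] fun x => star (u x) :=
  ContinuousLinearMap.coeFn_compLpL _ u

theorem norm_conjL (u : D.L2) : ‖D.conjL u‖ = ‖u‖ := by
  rw [Lp.norm_def, Lp.norm_def]
  congr 1
  refine eLpNorm_congr_norm_ae ?_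
  filter_upwards [coeFn_conjL u] with x hx
  rw [hx, norm_star]

theorem conjL_const (p : ℂ) : D.conjL (D.const p) = D.const (star p) := by
  apply Lp.ext
  filter_upwards [coeFn_conjL (D.const p), Lp.coeFn_const (p := 2) (μ := D.μ) p,
    Lp.coeFn_const (p := 2) (μ := D.μ) (star p)] with x h1 h2 h3
  have h2' : (D.const p : Plane → ℂ) x = p := h2
  have h3' : (D.const (star p) : Plane → ℂ) x = star p := h3
  rw [h1, h2', h3']

theorem conjL_ofReal_smul (ν : ℝ) (u : D.L2) : D.conjL ((ν : ℂ) • u) = (ν : ℂ) • D.conjL u :=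
  (D.conjL).map_smul ν u

theorem integral_conjL_mul (u : D.L2) (ψ : Plane → ℂ) :
    ∫ x, D.conjL u x * star (ψ x) ∂D.μ = star (∫ x, u x * ψ x ∂D.μ) := by
  rw [Complex.star_def, ← integral_conj]
  refine integral_congr_ae ?_
  filter_upwards [coeFn_conjL u] with x hx
  rw [hx, map_mul]
  rfl

theorem IsWeakDeriv.conj {i : Fin 2} {u v : D.L2} (h : D.IsWeakDeriv i u v) :
    D.IsWeakDeriv i (D.conjL u) (D.conjL v) := by
  intro φ hφ
  have h1 := congrArg star (h _ hφ.conj)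
  rw [star_neg, ← integral_conjL_mul, ← integral_conjL_mul, partialDeriv_conj hφ] at h1
  simpa only [star_star] using h1

/-- Complex conjugation on `H²`. -/
def conjH2 (U : D.H2) : D.H2 :=
  ⟨WithLp.toLp 2 fun k => D.conjL (U.1 k), fun i => (U.2.1 i).conj, fun i j => (U.2.2 i j).conj⟩

theorem norm_conjH2_sub (U V : D.H2) : ‖conjH2 U - conjH2 V‖ = ‖U - V‖ := by
  change ‖(conjH2 U - conjH2 V).1‖ = ‖(U - V).1‖
  rw [← sq_eq_sq₀ (norm_nonneg _) (norm_nonneg _), PiLp.norm_sq_eq_of_L2, PiLp.norm_sq_eq_of_L2]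
  refine Finset.sum_congr rfl fun k _ => ?_
  change ‖D.conjL (U.1 k) - D.conjL (V.1 k)‖ ^ 2 = ‖U.1 k - V.1 k‖ ^ 2
  rw [← map_sub, norm_conjL]

theorem lap_conjH2 (U : D.H2) : lap (conjH2 U) = D.conjL (lap U) := by
  rw [lap, lap, map_sum]
  rfl

theorem flux_conjH2 (U : D.H2) : flux (conjH2 U) = star (flux U) := by
  have h := integral_conjL_mul (toL2 U) fun _ => 1
  simp only [star_one, mul_one] at h
  exact h

theorem VanishesOnBoundary.conj {U : D.H2} (h : VanishesOnBoundary U) :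
    VanishesOnBoundary (conjH2 U) := by
  intro ε hε
  obtain ⟨φ, hφ, h0, h1⟩ := h ε hε
  have key : ∀ (u : D.L2) (ψ : Plane → ℂ), eLpNorm (fun x => u x - ψ x) 2 D.μ ≤ ε →
      eLpNorm (fun x => D.conjL u x - star (ψ x)) 2 D.μ ≤ ε := by
    intro u ψ hu
    refine le_trans (le_of_eq (eLpNorm_congr_norm_ae ?_)) hu
    filter_upwards [coeFn_conjL u] with x hx
    rw [hx, ← star_sub, norm_star]
  refine ⟨_, hφ.conj, key _ _ h0, fun i => ?_⟩
  rw [partialDeriv_conj hφ]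
  exact key _ _ (h1 i)

theorem IsBohrSolution.conj {ν : ℝ} {g : ℝ → ℂ} {w : ℝ → D.H2} {π : ℝ → ℂ}
    (h : IsBohrSolution D ν g w π) :
    IsBohrSolution D ν (fun t => star (g t)) (fun t => conjH2 (w t)) (fun t => star (π t)) := by
  obtain ⟨hw, hπ, wt, hwt, h⟩ := h
  refine ⟨hw.comp_isometry _ norm_conjH2_sub, hπ.comp_isometry _ fun x y => ?_,
    fun t => D.conjL (wt t), hwt.comp_isometry _ fun x y => ?_, fun t => ?_⟩
  · rw [← star_sub, norm_star]
  · rw [← map_sub, norm_conjL]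
  · obtain ⟨h1, h2, h3, h4⟩ := h t
    refine ⟨(D.conjL).hasFDerivAt.comp_hasDerivAt t h1, h2.conj, ?_, ?_⟩
    · rw [lap_conjH2, ← conjL_ofReal_smul, ← map_sub, h3, conjL_const]
    · rw [flux_conjH2, h4]

/-- The coefficients of the equation are real, so the conjugate pair solves it with the same flux;
uniqueness identifies the two. -/
theorem IsBohrSolution.im_eq_zero {ν : ℝ} (hν : 0 < ν) {g : ℝ → ℂ} {w : ℝ → D.H2} {π : ℝ → ℂ}
    (h : IsBohrSolution D ν g w π) (hg : ∀ t, star (g t) = g t) :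
    (∀ t, (π t).im = 0) ∧ ∀ t, ∀ᵐ x ∂D.μ, (toL2 (w t) x).im = 0 := by
  have h' := h.conj
  simp only [hg] at h'
  obtain ⟨h1, h2⟩ := h.unique hν h'
  refine ⟨fun t => Complex.conj_eq_iff_im.1 (congrFun h2 t), fun t => ?_⟩
  have h3 : D.conjL (toL2 (w t)) = toL2 (w t) := congrArg toL2 (congrFun h1 t)
  filter_upwards [coeFn_conjL (toL2 (w t))] with x hx
  rw [h3] at hx
  exact Complex.conj_eq_iff_im.1 hx.symm

/-- For real f the coefficients at ξ and -ξ are conjugate, so conjugating the series only reindexes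
it by ξ ↦ -ξ. -/
theorem star_tsum_bohrChar {f fhat : ℝ → ℂ} (hfhat : ∀ ξ, HasBohrCoeff f ξ (fhat ξ))
    (hf : ∀ t, (f t).im = 0) (t : ℝ) :
    star (∑' ξ, fhat ξ * bohrChar ξ t) = ∑' ξ, fhat ξ * bohrChar ξ t := by
  have hsymm : ∀ ξ, star (fhat ξ) = fhat (-ξ) := fun ξ => by
    have h1 := (hfhat ξ).star
    have h2 : (fun t => star (f t)) = f := funext fun t => Complex.conj_eq_iff_im.2 (hf t)
    rw [h2] at h1
    exact h1.unique (hfhat (-ξ))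
  rw [tsum_star, ← (Equiv.neg ℝ).tsum_eq]
  refine tsum_congr fun ξ => ?_
  rw [Equiv.neg_apply, star_mul', hsymm, neg_neg, ← bohrChar_neg, neg_neg]

end SmoothDomain


end

/-! ### Assembly of the solution from its modes -/

theorem proposition3p6 (D : SmoothDomain) :
    ∃ c : ℝ, 0 < c ∧
      ∀ (ν : ℝ), 0 < ν →
      ∀ (f : ℝ → ℂ) (fhat : ℝ → ℂ),
        LocallyIntegrable f volume →
        (∀ ξ : ℝ, HasBohrCoeff f ξ (fhat ξ)) →
        Summable (fun ξ : ℝ => (1 + |ξ|) * ‖fhat ξ‖) →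
        ∃ (w : ℝ → D.H2) (π : ℝ → ℂ) (what : ℝ → D.H2) (pihat : ℝ → ℂ),
          -- `(w, π)` solves the problem with `w`, `∂ₜw`, `π` almost periodic in the sense of Bohr;
          -- the flux is the continuous representative of `f`
          SmoothDomain.IsBohrSolution D ν (fun t => ∑' ξ : ℝ, fhat ξ * bohrChar ξ t) w π ∧
          -- it solves the problem with flux `f` in the sense of Besicovitch
          SmoothDomain.IsBesicovitchSolution D ν f w π ∧
          -- the Fourier coefficients of the solution and their bounds
          (∀ ξ : ℝ, HasBohrCoeff w ξ (what ξ)) ∧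
          (∀ ξ : ℝ, HasBohrCoeff π ξ (pihat ξ)) ∧
          Summable (fun ξ : ℝ => ‖SmoothDomain.lap (what ξ)‖) ∧
          Summable (fun ξ : ℝ => ‖pihat ξ‖) ∧
          Summable (fun ξ : ℝ => |ξ| * ‖SmoothDomain.toL2 (what ξ)‖) ∧
          ((∑' ξ : ℝ, ‖SmoothDomain.lap (what ξ)‖)
            ≤ c * (∑' ξ : ℝ, ‖fhat ξ‖) + c / ν * (∑' ξ : ℝ, |ξ| * ‖fhat ξ‖)) ∧
          ((∑' ξ : ℝ, ‖pihat ξ‖) + (∑' ξ : ℝ, |ξ| * ‖SmoothDomain.toL2 (what ξ)‖)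
            ≤ c * ν * (∑' ξ : ℝ, ‖fhat ξ‖) + c * (∑' ξ : ℝ, |ξ| * ‖fhat ξ‖)) ∧
          -- uniqueness in the sense of Besicovitch, up to equality of Fourier coefficients
          (∀ (w' : ℝ → D.H2) (π' : ℝ → ℂ), SmoothDomain.IsBesicovitchSolution D ν f w' π' →
            ApEquiv w' w ∧ ApEquiv π' π) ∧
          -- uniqueness in the sense of Bohr
          (∀ (w' : ℝ → D.H2) (π' : ℝ → ℂ),
            SmoothDomain.IsBohrSolution D ν (fun t => ∑' ξ : ℝ, fhat ξ * bohrChar ξ t) w' π' →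
            w' = w ∧ π' = π) ∧
          -- real fluxes have real solutions
          ((∀ t : ℝ, (f t).im = 0) →
            (∀ t : ℝ, (π t).im = 0) ∧
            ∀ t : ℝ, ∀ᵐ x ∂D.μ, (SmoothDomain.toL2 (w t) x).im = 0) := by
  obtain ⟨c, hc, hbound⟩ := D.exists_mode_bound
  obtain ⟨C, hC, hH2⟩ := D.exists_norm_le_lap
  refine ⟨c, hc, fun ν hν f fhat hf hfhat hsum => ?_⟩
  choose U p hmode hflux using fun ξ : ℝ => SmoothDomain.exists_mode_of_flux (D := D) hν ξ (fhat ξ)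
  have s0 : Summable fun ξ : ℝ => ‖fhat ξ‖ := hsum.of_nonneg_of_le (fun ξ => norm_nonneg _)
    fun ξ => le_mul_of_one_le_left (norm_nonneg _) (le_add_of_nonneg_right (abs_nonneg ξ))
  have s1 : Summable fun ξ : ℝ => |ξ| * ‖fhat ξ‖ := hsum.of_nonneg_of_le (fun ξ => by positivity)
    fun ξ => mul_le_mul_of_nonneg_right (by linarith) (norm_nonneg _)
  have blap : ∀ ξ, ‖SmoothDomain.lap (U ξ)‖ ≤ c * ‖fhat ξ‖ + c / ν * (|ξ| * ‖fhat ξ‖) := fun ξ => by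
    refine ((hbound ν ξ _ _ hν (hmode ξ)).2.2).trans (le_of_eq ?_)
    rw [hflux]; ring
  have bp : ∀ ξ, ‖p ξ‖ + |ξ| * ‖SmoothDomain.toL2 (U ξ)‖ ≤
      c * ν * ‖fhat ξ‖ + c * (|ξ| * ‖fhat ξ‖) := fun ξ => by
    refine ((hbound ν ξ _ _ hν (hmode ξ)).2.1).trans (le_of_eq ?_)
    rw [hflux]; ring
  have t1 := (s0.mul_left c).add (s1.mul_left (c / ν))
  have t2 := (s0.mul_left (c * ν)).add (s1.mul_left c)
  have slap : Summable fun ξ => ‖SmoothDomain.lap (U ξ)‖ :=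
    t1.of_nonneg_of_le (fun ξ => norm_nonneg _) blap
  have sp : Summable fun ξ => ‖p ξ‖ := t2.of_nonneg_of_le (fun ξ => norm_nonneg _) fun ξ =>
    le_trans (le_add_of_nonneg_right (by positivity)) (bp ξ)
  have sd : Summable fun ξ => |ξ| * ‖SmoothDomain.toL2 (U ξ)‖ :=
    t2.of_nonneg_of_le (fun ξ => by positivity) fun ξ =>
      le_trans (le_add_of_nonneg_left (norm_nonneg _)) (bp ξ)
  -- Summability in the full H² norm comes from that of the Laplacians. The regularity constant C is
  -- used only here and does not enter the final estimates.
  have sU : Summable fun ξ => ‖U ξ‖ := (slap.mul_left C).of_nonneg_of_le (fun ξ => norm_nonneg _)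
    fun ξ => hH2 _ (hmode ξ).1
  have hbohr := SmoothDomain.isBohrSolution_trigSeries sU sd sp hmode
  have hbes := SmoothDomain.isBesicovitchSolution_trigSeries hf (fun ξ => by
    rw [hflux]; exact hfhat ξ) sU sd sp hmode
  simp only [hflux] at hbohr
  refine ⟨trigSeries U, trigSeries p, U, p, hbohr, hbes, hasBohrCoeff_trigSeries sU,
    hasBohrCoeff_trigSeries sp, slap, sp, sd, ?_, ?_, fun w' π' h' => hbes.apEquiv hν hf hfhat h',
    fun w' π' h' => hbohr.unique hν h',
    fun hreal => hbohr.im_eq_zero hν (SmoothDomain.star_tsum_bohrChar hfhat hreal)⟩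
  · rw [← tsum_mul_left, ← tsum_mul_left, ← (s0.mul_left c).tsum_add (s1.mul_left (c / ν))]
    exact slap.tsum_le_tsum blap t1
  · rw [← tsum_mul_left, ← tsum_mul_left, ← (s0.mul_left _).tsum_add (s1.mul_left c),
      ← sp.tsum_add sd]
    exact (sp.add sd).tsum_le_tsum bp t2
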